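/- Let $\mathbb S^2\subset\mathbb R^3$ be the unit sphere with surface measure $dx$, $P_\ell$ the $\ell$-th Legendre polynomial, and $p\ge 1$. Let $\{T(x,t)\}$ and $\{Z(x,t)\}$, $(x,t)\in\mathbb S^2\times\mathbb Z$, be jointly measurable real random fields on a common probability space, where $T$ is zero-mean, Gaussian, isotropic and stationary (i.e. $\mathbb E[T(x,t)T(y,s)]$ depends only on $\langle x,y\rangle$ and $t-s$) and $Z$ is a Gaussian spherical white noise: the fields $Z(\cdot,t)$, $t\in\mathbb Z$, are independent zero-mean Gaussian with covariance $\mathbb E[Z(x,t)Z(y,t)]=\sum_{\ell\ge0}\frac{2\ell+1}{4\pi}C_{\ell;Z}P_\ell(\langle x,y\rangle)$, $C_{\ell;Z}\ge 0$, $\sum_\ell(2\ell+1)C_{\ell;Z}<\infty$. Suppose that $T$ is a spherical autoregression of order $p$: there are kernels $k_1,\dots,k_p\in L^2[-1,1]$ such that, for all $(x,t)$, almost surely $$T(x,t)=\sum_{j=1}^p(\Phi_jT_{t-j})(x)+Z(x,t),\qquad (\Phi_jf)(x)=\int_{\mathbb S^2}k_j(\langle x,y\rangle)f(y)\,dy,\qquad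 T_t=T(\cdot,t).$$ Let $\phi_{\ell;j}=2\pi\int_{-1}^1k_j(z)P_\ell(z)\,dz$ be the Legendre coefficients of the kernels, so that $k_j=\sum_\ell\phi_{\ell;j}\frac{2\ell+1}{4\pi}P_\ell$ in $L^2[-1,1]$, and assume: 1. (Stationarity) there is $\delta>0$ such that, for all $\ell\ge0$ and $z\in\mathbb C$ with $|z|\le1+\delta$, $1-\phi_{\ell;1}z-\dots-\phi_{\ell;p}z^p\ne0$; 2. (Identifiability) $C_{\ell;Z}>0$ for all $\ell\ge0$; 3. (Smoothness) there are $\gamma_j>0$ and $\beta_j>1$ such that $|\phi_{\ell;j}|\le\gamma_j\ell^{-\beta_j}$ for all $\ell\ge1$ and $j=1,\dots,p$; put $\beta_*=\min_j\beta_j$. Let $0<d<1$ and let $L_N$ be integers with $L_N\sim N^d$, i.e. $L_N/N^d$ is bounded above and below by positive constants. For $N>p$ let $\widehat k_N=(\widehat k_{1;N},\dots,\widehat k_{p;N})$ be a minimizer of $$\sum_{t=1}^N\Big\|T_{t+p}-\sum_{j=1}^p\Phi_jT_{t+p-j}\Big\|^2_{L^2(\mathbb S^2)}$$ over all $p$-tuples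 of kernels in $\mathrm{span}\{\tfrac{2\ell+1}{4\pi}P_\ell:\ell\le L_N\}$, where $\Phi_j$ now denotes the operator with the $j$-th kernel of the tuple. With $k=(k_1,\dots,k_p)$ and $\|\cdot\|$ the Euclidean norm of $\mathbb R^p$, as $N\to\infty$, $$\mathbb E\Big[\int_{-1}^1\|\widehat k_N(z)-k(z)\|^2dz\Big]=\mathcal O\big(N^{d-1}+N^{2d(1-\beta_*)}\big).$$ If moreover $\beta_j>2$ for all $j$ and $0<d<\frac13$, then each Legendre expansion $\sum_\ell\phi_{\ell;j}\frac{2\ell+1}{4\pi}P_\ell(z)$ converges at every $z\in[-1,1]$ and defines a continuous version of $k_j$, and with this version $$\mathbb E\Big[\sup_{z\in[-1,1]}\|\widehat k_N(z)-k(z)\|\Big]=\mathcal O\big(N^{(3d-1)/2}+N^{d(2-\beta_*)}\big).$$ -/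

import Mathlib

open MeasureTheory ProbabilityTheory Filter Asymptotics

namespace SPHAR

/-- The unit sphere `S²` of `ℝ³`. -/
abbrev S2 : Type := Metric.sphere (0 : EuclideanSpace ℝ (Fin 3)) 1

/-- The surface (Lebesgue) measure `dx` on `S²`, of total mass `4π`. -/
noncomputable def surf : Measure S2 :=
  (volume : Measure (EuclideanSpace ℝ (Fin 3))).toSphere

/-- The inner product `⟨x, y⟩` of two points of the sphere. -/
noncomputable def dot (x y : S2) : ℝ :=
  inner ℝ (x : EuclideanSpace ℝ (Fin 3)) (y : EuclideanSpace ℝ (Fin 3))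

/-- The `ℓ`-th Legendre polynomial, by Rodrigues' formula. -/
noncomputable def legendre (l : ℕ) : Polynomial ℝ :=
  Polynomial.C (1 / ((2 : ℝ) ^ l * (l.factorial : ℝ))) *
    (Polynomial.derivative^[l] ((Polynomial.X ^ 2 - 1) ^ l))

/-- The function `z ↦ (2ℓ+1)/(4π) P_ℓ(z)`. -/
noncomputable def zonal (l : ℕ) (z : ℝ) : ℝ :=
  (2 * (l : ℝ) + 1) / (4 * Real.pi) * (legendre l).eval z

/-- The isotropic kernel operator `(Φ f)(x) = ∫_{S²} κ(⟨x, y⟩) f(y) dy`. -/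
noncomputable def kernelOp (κ : ℝ → ℝ) (f : S2 → ℝ) (x : S2) : ℝ :=
  ∫ y, κ (dot x y) * f y ∂surf

/-- The coefficient `φ_ℓ` of `κ` in its Legendre expansion
`κ = ∑ φ_ℓ (2ℓ+1)/(4π) P_ℓ` in `L²[-1,1]`; it is obtained by integrating against `P_ℓ`, because
`∫ P_ℓ² = 2/(2ℓ+1)`. -/
noncomputable def coeff (κ : ℝ → ℝ) (l : ℕ) : ℝ :=
  2 * Real.pi * ∫ z in Set.Icc (-1 : ℝ) 1, κ z * (legendre l).eval z

variable {Ω : Type*} [MeasurableSpace Ω]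

/-- A (jointly measurable) zero-mean Gaussian random field on `S² × ℤ`, isotropic in space and
stationary in time. Finite variance is part of Gaussianity. -/
structure IsGaussianIsotropicStationary (P : Measure Ω) (T : S2 → ℤ → Ω → ℝ) : Prop where
  measurable : Measurable fun q : Ω × S2 × ℤ => T q.2.1 q.2.2 q.1
  gaussian : IsGaussianProcess (fun q : S2 × ℤ => T q.1 q.2) P
  mean_zero : ∀ x t, ∫ ω, T x t ω ∂P = 0
  covariance : ∃ Γ₀ : ℝ → ℤ → ℝ, ∀ x y t s,
    ∫ ω, T x t ω * T y s ω ∂P = Γ₀ (dot x y) (t - s)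

/-- Gaussian spherical white noise with angular power spectrum `C`: a sequence, independent over
time, of zero-mean Gaussian isotropic fields with common covariance function
`∑ (2ℓ+1)/(4π) C_ℓ P_ℓ(⟨x, y⟩)`, where `∑ (2ℓ+1)/(4π) C_ℓ < ∞`. -/
structure IsSphericalWhiteNoise (P : Measure Ω) (Z : S2 → ℤ → Ω → ℝ) (C : ℕ → ℝ) : Prop where
  measurable : Measurable fun q : Ω × S2 × ℤ => Z q.2.1 q.2.2 q.1
  gaussian : ∀ t, IsGaussianProcess (fun x => Z x t) P
  mean_zero : ∀ x t, ∫ ω, Z x t ω ∂P = 0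
  spectrum_nonneg : ∀ l, 0 ≤ C l
  spectrum_summable : Summable fun l : ℕ => (2 * (l : ℝ) + 1) / (4 * Real.pi) * C l
  covariance : ∀ t x y,
    HasSum (fun l : ℕ => C l * zonal l (dot x y)) (∫ ω, Z x t ω * Z y t ω ∂P)
  indep : iIndepFun (fun (t : ℤ) (ω : Ω) (x : S2) => Z x t ω) P

/-- `T` satisfies the spherical autoregression
`T_t(x) = (Φ_1 T_{t-1})(x) + ⋯ + (Φ_p T_{t-p})(x) + Z_t(x)` of order `p` with kernels
`k_1, …, k_p ∈ L²[-1,1]` (numbered from `0` here). For each `(x, t)` the equality is one of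
random variables; by Fubini it then holds almost everywhere on `Ω × S²`. -/
structure IsSPHAR {p : ℕ} (P : Measure Ω) (k : Fin p → ℝ → ℝ) (T Z : S2 → ℤ → Ω → ℝ) : Prop where
  memLp : ∀ j, MemLp (k j) 2 (volume.restrict (Set.Icc (-1 : ℝ) 1))
  equation : ∀ x t, ∀ᵐ ω ∂P,
    T x t ω = (∑ j : Fin p, kernelOp (k j) (fun y => T y (t - ((j : ℤ) + 1)) ω) x) + Z x t ω

/-- The associated polynomial `φ_ℓ(z) = 1 - φ_{ℓ;1} z - ⋯ - φ_{ℓ;p} z^p`. -/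
noncomputable def assocPoly {p : ℕ} (k : Fin p → ℝ → ℝ) (l : ℕ) (z : ℂ) : ℂ :=
  1 - ∑ j : Fin p, (coeff (k j) l : ℂ) * z ^ ((j : ℕ) + 1)

/-- No associated polynomial has a root in a fixed `δ`-enlargement of the closed unit disk. -/
def StationarityCondition {p : ℕ} (k : Fin p → ℝ → ℝ) : Prop :=
  ∃ δ : ℝ, 0 < δ ∧ ∀ (l : ℕ) (z : ℂ), ‖z‖ ≤ 1 + δ → assocPoly k l z ≠ 0

/-- The span of `(2ℓ+1)/(4π) P_ℓ`, `ℓ ≤ L`. -/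
noncomputable def zonalSpan (L : ℕ) : Submodule ℝ (ℝ → ℝ) :=
  Submodule.span ℝ {f | ∃ l ≤ L, f = zonal l}

/-- The least-squares criterion
`∑_{t=1}^N ‖T_{t+p} - ∑_{j=1}^p Φ_j T_{t+p-j}‖²_{L²(S²)}`, where `Φ_j` has kernel `κ_j` and
`T = T(x, t)` is one realization of the field. -/
noncomputable def leastSquares {p : ℕ} (T : S2 → ℤ → ℝ) (N : ℕ) (κ : Fin p → ℝ → ℝ) : ℝ :=
  ∑ t ∈ Finset.Icc 1 N, ∫ x,
    (T x ((t : ℤ) + p) -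
      ∑ j : Fin p, kernelOp (κ j) (fun y => T y ((t : ℤ) + p - ((j : ℤ) + 1))) x) ^ 2 ∂surf

/-- `κ` minimizes the least-squares criterion over `p`-tuples of elements of `zonalSpan L`. -/
def IsLeastSquaresEstimate {p : ℕ} (T : S2 → ℤ → ℝ) (N L : ℕ) (κ : Fin p → ℝ → ℝ) : Prop :=
  (∀ j, κ j ∈ zonalSpan L) ∧
    ∀ κ' : Fin p → ℝ → ℝ, (∀ j, κ' j ∈ zonalSpan L) →
      leastSquares T N κ ≤ leastSquares T N κ'

/-- The difference `κ(z) - κ'(z)` as a vector of Euclidean `ℝ^p`. -/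
noncomputable def diffVec {p : ℕ} (κ κ' : Fin p → ℝ → ℝ) (z : ℝ) : EuclideanSpace ℝ (Fin p) :=
  WithLp.toLp 2 fun j => κ j z - κ' j z

end SPHAR

namespace SPHAR

/-! ### Legendre polynomials -/

section Legendre

open Polynomial intervalIntegral

/-! By the Funk–Hecke formula (`integral_mul_zonal`), an isotropic kernel operator multiplies
spherical harmonics of degree `l` by the `l`-th Legendre coefficient of its kernel. The `2l+1`
harmonic coefficients of `T` of degree `l` are therefore scalar autoregressions with common
coefficients `φ_{l;j}`, driven by orthogonal Gaussian noises of variance `C l`. Least squares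
decouples over degrees: perturbing the minimizer in degree `l` alone gives `Q(e) ≤ 2⟨e, V⟩` for the
error `e` of its coefficients of degree `l` (`IsLeastSquaresEstimate.quadForm_le`), where `Q` is the
Gram form of the regressors and `V` their cross products with the noise, both sums over `M =
(2l+1)N` observations.

The heart is the bound `E‖e‖² ≤ K / ((2l+1)N)` with `K` independent of `l`
(`exists_coeff_error_bound`). In Parseval's identity degree `l` has weight of order `2l+1`, so the
degrees up to `L_N` contribute `O(L_N / N)`, and the tail, of terms `l^(1-2β_*)`, contributes
`O(L_N^(2-2β_*))`. For the uniform norm the weight `2l+1` multiplies the root of the mean square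
error, giving `O(L_N^(3/2) N^(-1/2))`, and the tail is `O(L_N^(2-β_*))`.

`V` is a martingale in `N` with conditionally Gaussian increments, so its fourth moment is `O(M²)`
(`IsARFamily.lintegral_crossVec_le`). A bound in mean also requires negative moments of `Q / M`. For
fixed `u`, the combination of `p` consecutive values with weights `u` contains some innovation with
coefficient at least a constant times `‖u‖` (`exists_innovation_coeff_ge`); for disjoint blocks this
innovation is independent of the earlier blocks, so the product of `|Y_b|^(-1/2)` over blocks has
bounded mean, and sufficiently many blocks yield any negative moment of the sum of squares. To reach
the random direction of `e`, `Q(u)^(-(p+2))` is integrated over a shell of vectors `u`: a small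
value of `Q` at one unit vector persists on a ball whose radius is controlled by the trace of `Q`,
and so makes the integral large (`le_shellIntegral`). Hölder's inequality combines the three
factors.

Uniformity in `l` holds because `φ_{l;j} → 0`: the autoregressive polynomials are bounded below on
one circle of radius greater than `1`. Joint Gaussianity of `T` and `Z` is not assumed; the
coefficients of `T` are moving averages of those of `Z` and so lie in the closed Gaussian space
spanned by `Z`. The almost sure bounds hold for all minimizers at once, with a measurable majorant,
so no measurability of the estimators is needed. -/

lemma integral_poly_mul_derivative (p q : ℝ[X]) :
    ∫ x in (-1 : ℝ)..1, p.eval x * (derivative q).eval x =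
      p.eval 1 * q.eval 1 - p.eval (-1) * q.eval (-1) -
        ∫ x in (-1 : ℝ)..1, (derivative p).eval x * q.eval x :=
  integral_mul_deriv_eq_deriv_mul (fun x _ => p.hasDerivAt x) (fun x _ => q.hasDerivAt x)
    ((derivative p).continuous.intervalIntegrable _ _)
    ((derivative q).continuous.intervalIntegrable _ _)

/-- The points `±1` are zeros of order `l`, and fewer than `l` derivatives leave a factor `X² - 1`.
This kills the boundary terms when integrating Rodrigues' formula by parts. -/
lemma eval_iterate_derivative_rodrigues {l k : ℕ} (hk : k < l) {x : ℝ} (hx : x ^ 2 = 1) :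
    (derivative^[k] ((X ^ 2 - 1 : ℝ[X]) ^ l)).eval x = 0 := by
  have h : (X ^ 2 - 1 : ℝ[X]) ∣ derivative^[k] ((X ^ 2 - 1 : ℝ[X]) ^ l) :=
    (dvd_pow_self _ (by omega)).trans
      (pow_sub_dvd_iterate_derivative_of_pow_dvd k (dvd_refl ((X ^ 2 - 1 : ℝ[X]) ^ l)))
  obtain ⟨r, hr⟩ := h
  simp [hr, hx]

lemma integral_rodrigues_mul {l : ℕ} (q : ℝ[X]) (k : ℕ) (hk : k ≤ l) :
    ∫ x in (-1 : ℝ)..1, q.eval x * (derivative^[l] ((X ^ 2 - 1 : ℝ[X]) ^ l)).eval x =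
      (-1) ^ k * ∫ x in (-1 : ℝ)..1, (derivative^[k] q).eval x *
        (derivative^[l - k] ((X ^ 2 - 1 : ℝ[X]) ^ l)).eval x := by
  induction k with
  | zero => simp
  | succ k ih =>
    rw [ih (by omega)]
    have h1 : l - k = (l - (k + 1)) + 1 := by omega
    rw [h1, Function.iterate_succ_apply', integral_poly_mul_derivative,
      eval_iterate_derivative_rodrigues (by omega) (by norm_num),
      eval_iterate_derivative_rodrigues (by omega) (by norm_num), Function.iterate_succ_apply',
      pow_succ]
    ring

lemma integral_mul_legendre_eq_zero {l : ℕ} {q : ℝ[X]} (hq : q.degree < l) :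
    ∫ x in (-1 : ℝ)..1, q.eval x * (legendre l).eval x = 0 := by
  have h0 : derivative^[l] q = 0 := iterate_derivative_eq_zero_of_degree_lt hq
  have h := integral_rodrigues_mul q l le_rfl
  rw [h0] at h
  simp only [eval_zero, zero_mul, intervalIntegral.integral_zero, mul_zero] at h
  simp only [legendre, eval_mul, eval_C]
  have h2 : ∀ x : ℝ, q.eval x * (1 / (2 ^ l * (l.factorial : ℝ)) *
      (derivative^[l] ((X ^ 2 - 1 : ℝ[X]) ^ l)).eval x) = (1 / (2 ^ l * (l.factorial : ℝ))) *
      (q.eval x * (derivative^[l] ((X ^ 2 - 1 : ℝ[X]) ^ l)).eval x) := fun x => by ring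
  simp_rw [h2]
  rw [intervalIntegral.integral_const_mul, h, mul_zero]

/-- In Leibniz' formula only the term with all derivatives on the power survives at `c`. -/
lemma eval_iterate_derivative_sub_pow_mul (l : ℕ) (c : ℝ) (r : ℝ[X]) :
    (derivative^[l] ((X - C c) ^ l * r)).eval c = l.factorial * r.eval c := by
  rw [iterate_derivative_mul, eval_finsetSum, Finset.sum_eq_single 0]
  · simp [iterate_derivative_X_sub_pow_self]
  · intro i hi hi0
    have hil : i ≤ l := Nat.lt_succ_iff.mp (Finset.mem_range.mp hi)
    have : ((X - C c) : ℝ[X]) ∣ derivative^[l - i] ((X - C c) ^ l) :=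
      (dvd_pow_self _ (by omega)).trans
        (pow_sub_dvd_iterate_derivative_of_pow_dvd (l - i) (dvd_refl (((X - C c) : ℝ[X]) ^ l)))
    obtain ⟨s, hs⟩ := this
    simp [hs]
  · simp

lemma legendre_eval_one (l : ℕ) : (legendre l).eval 1 = 1 := by
  have h : (X ^ 2 - 1 : ℝ[X]) ^ l = (X - C 1) ^ l * (X + 1) ^ l := by
    rw [← mul_pow]; congr 1; simp; ring
  rw [legendre, h, eval_mul, eval_C, eval_iterate_derivative_sub_pow_mul]
  have : (l.factorial : ℝ) ≠ 0 := by positivity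
  simp
  field_simp
  norm_num

lemma legendre_eval_neg_one_sq (l : ℕ) : (legendre l).eval (-1) ^ 2 = 1 := by
  have h : (X ^ 2 - 1 : ℝ[X]) ^ l = (X - C (-1)) ^ l * (X - 1) ^ l := by
    rw [← mul_pow]; congr 1; simp; ring
  rw [legendre, h, eval_mul, eval_C, eval_iterate_derivative_sub_pow_mul]
  have : (l.factorial : ℝ) ≠ 0 := by positivity
  simp only [eval_pow, eval_sub, eval_X, eval_one]
  have h2 : ((-1 : ℝ) - 1) ^ l = (-1) ^ l * 2 ^ l := by rw [← mul_pow]; norm_num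
  rw [h2]
  field_simp
  rw [← pow_mul, mul_comm, pow_mul]; norm_num

lemma natDegree_legendre_le (l : ℕ) : (legendre l).natDegree ≤ l := by
  refine natDegree_C_mul_le _ _ |>.trans ((natDegree_iterate_derivative _ _).trans ?_)
  have : ((X ^ 2 - 1 : ℝ[X]) ^ l).natDegree ≤ l * 2 := by
    refine natDegree_pow_le_of_le l ?_
    compute_degree
  omega

lemma eq_zero_of_integral_sq_eq_zero {q : ℝ[X]}
    (h : ∫ x in (-1 : ℝ)..1, q.eval x * q.eval x = 0) : q = 0 := by
  have h1 : ∀ x ∈ Set.Ioo (-1 : ℝ) 1, q.eval x = 0 := by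
    intro x hx
    by_contra hne
    have : 0 < ∫ x in (-1 : ℝ)..1, q.eval x * q.eval x := by
      refine intervalIntegral.integral_pos (by norm_num) (by fun_prop)
        (fun y _ => mul_self_nonneg _) ⟨x, ⟨hx.1.le, hx.2.le⟩, ?_⟩
      exact mul_self_pos.mpr hne
    linarith
  exact q.eq_zero_of_infinite_isRoot
    ((Set.Ioo_infinite (by norm_num : (-1 : ℝ) < 1)).mono fun x hx => h1 x hx)

/-- If the degree were smaller, the polynomial would be orthogonal to itself and vanish, against its
value `1` at `1`. -/
lemma degree_legendre (l : ℕ) : (legendre l).degree = l := by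
  refine le_antisymm (natDegree_le_iff_degree_le.mp (natDegree_legendre_le l)) ?_
  by_contra hlt
  have h0 := eq_zero_of_integral_sq_eq_zero (integral_mul_legendre_eq_zero (not_le.mp hlt))
  have := legendre_eval_one l
  simp [h0] at this

lemma natDegree_legendre (l : ℕ) : (legendre l).natDegree = l :=
  natDegree_eq_of_degree_eq_some (degree_legendre l)

lemma leadingCoeff_legendre_ne_zero (l : ℕ) : (legendre l).coeff l ≠ 0 := by
  have : legendre l ≠ 0 := fun h => by simpa [h] using degree_legendre l
  have h2 := leadingCoeff_ne_zero.mpr this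
  rwa [leadingCoeff, natDegree_legendre] at h2

/-- Subtracting a multiple of the Legendre polynomial of degree `l` lowers the degree. -/
lemma exists_degree_sub_legendre_lt {l : ℕ} {q : ℝ[X]} (hq : q.natDegree ≤ l) :
    ∃ c : ℝ, (q - C c * legendre l).degree < l := by
  refine ⟨q.coeff l / (legendre l).coeff l, ?_⟩
  rw [degree_lt_iff_coeff_zero]
  intro m hm
  rcases hm.eq_or_lt with rfl | hm
  · rw [coeff_sub, coeff_C_mul, div_mul_cancel₀ _ (leadingCoeff_legendre_ne_zero _), sub_self]
  · have h := coeff_eq_zero_of_natDegree_lt ((natDegree_legendre l).trans_lt hm)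
    rw [coeff_sub, coeff_C_mul, coeff_eq_zero_of_natDegree_lt (hq.trans_lt hm), h]
    simp

lemma intervalIntegrable_poly (q : ℝ[X]) (a b : ℝ) :
    IntervalIntegrable (fun x => q.eval x) volume a b := q.continuous.intervalIntegrable _ _

/-- A polynomial of degree at most `l` which is orthogonal to all polynomials of smaller degree is
a multiple of the Legendre polynomial. -/
lemma eq_C_mul_legendre_of_orthogonal {l : ℕ} {q : ℝ[X]} (hq : q.natDegree ≤ l)
    (h : ∀ r : ℝ[X], r.degree < l → ∫ x in (-1 : ℝ)..1, r.eval x * q.eval x = 0) :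
    q = C (q.eval 1) * legendre l := by
  obtain ⟨c, hc⟩ := exists_degree_sub_legendre_lt hq
  -- The difference has degree below `l`, hence is orthogonal to both of its terms and so to itself.
  have h0 : q - C c * legendre l = 0 := by
    apply eq_zero_of_integral_sq_eq_zero
    have h1 := h _ hc
    have h2 := integral_mul_legendre_eq_zero hc
    set r := q - C c * legendre l with hr
    have : ∀ x : ℝ, r.eval x * r.eval x =
        r.eval x * q.eval x - c * (r.eval x * (legendre l).eval x) := by
      intro x
      conv_lhs => enter [2]; rw [hr]
      simp only [eval_sub, eval_mul, eval_C]; ring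
    simp_rw [this]
    rw [intervalIntegral.integral_sub, intervalIntegral.integral_const_mul, h1, h2]
    · simp
    · simpa using intervalIntegrable_poly (r * q) (-1) 1
    · simpa using (intervalIntegrable_poly (r * legendre l) (-1) 1).const_mul c
  have h1 : q = C c * legendre l := sub_eq_zero.mp h0
  have h2 : q.eval 1 = c := by rw [h1]; simp [legendre_eval_one]
  rw [h2]; exact h1

lemma integral_legendre_mul_legendre_of_ne {l m : ℕ} (h : l ≠ m) :
    ∫ x in (-1 : ℝ)..1, (legendre l).eval x * (legendre m).eval x = 0 := by
  rcases h.lt_or_gt with h | h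
  · exact integral_mul_legendre_eq_zero (by rw [degree_legendre]; exact_mod_cast h)
  · simp_rw [mul_comm ((legendre l).eval _)]
    exact integral_mul_legendre_eq_zero (by rw [degree_legendre]; exact_mod_cast h)

/-- Integrate by parts with the factors `x` and `P_l²`. Since `x P_l' - l P_l` has degree below `l`,
it is orthogonal to `P_l`, so `∫ x (P_l²)' = 2l ∫ P_l²`, while the boundary terms amount to `2`. -/
lemma integral_legendre_sq (l : ℕ) :
    ∫ x in (-1 : ℝ)..1, (legendre l).eval x * (legendre l).eval x = 2 / (2 * l + 1) := by
  set c := ∫ x in (-1 : ℝ)..1, (legendre l).eval x * (legendre l).eval x with hc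
  have h1 := integral_poly_mul_derivative X (legendre l * legendre l)
  simp only [eval_X, derivative_mul, eval_mul, eval_add, derivative_X, eval_one, one_mul,
    legendre_eval_one, ← hc] at h1
  have h3 := legendre_eval_neg_one_sq l
  have hdeg : (X * derivative (legendre l) - C (l : ℝ) * legendre l).degree < (l : WithBot ℕ) := by
    rw [degree_lt_iff_coeff_zero]
    intro m hm
    cases m with
    | zero => simp at hm; subst hm; simp
    | succ m =>
      rw [coeff_sub, coeff_C_mul, coeff_X_mul, coeff_derivative]
      rcases hm.eq_or_lt with h | h
      · rw [h]; push_cast; ring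
      · rw [coeff_eq_zero_of_natDegree_lt (by rw [natDegree_legendre]; exact h)]; simp
  have h4 := integral_mul_legendre_eq_zero hdeg
  have h5 : ∀ x : ℝ, x * ((derivative (legendre l)).eval x * (legendre l).eval x +
      (legendre l).eval x * (derivative (legendre l)).eval x) =
      2 * ((X * derivative (legendre l) - C (l : ℝ) * legendre l).eval x * (legendre l).eval x) +
      2 * l * ((legendre l).eval x * (legendre l).eval x) := by
    intro x; simp; ring
  simp_rw [h5] at h1
  rw [intervalIntegral.integral_add (Continuous.intervalIntegrable (by fun_prop) _ _)
      (Continuous.intervalIntegrable (by fun_prop) _ _),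
    intervalIntegral.integral_const_mul, h4, intervalIntegral.integral_const_mul, ← hc] at h1
  rw [eq_div_iff (by positivity)]
  nlinarith

/-- A square-integrable function on `[-1,1]` orthogonal to all Legendre polynomials is orthogonal
to all polynomials. -/
lemma setIntegral_mul_poly_eq_zero {f : ℝ → ℝ}
    (hf : IntegrableOn f (Set.Icc (-1 : ℝ) 1))
    (h : ∀ l, ∫ x in Set.Icc (-1 : ℝ) 1, f x * (legendre l).eval x = 0) (q : ℝ[X]) :
    ∫ x in Set.Icc (-1 : ℝ) 1, f x * q.eval x = 0 := by
  have hint : ∀ r : ℝ[X], IntegrableOn (fun x => f x * r.eval x) (Set.Icc (-1 : ℝ) 1) :=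
    fun r => hf.mul_continuousOn r.continuous.continuousOn isCompact_Icc
  have key : ∀ n : ℕ, ∀ q : ℝ[X], q.degree < n →
      ∫ x in Set.Icc (-1 : ℝ) 1, f x * q.eval x = 0 := by
    intro n
    induction n with
    | zero =>
      intro q hq
      have : q = 0 := by
        rw [← degree_eq_bot]; exact Nat.WithBot.lt_zero_iff.mp (by simpa using hq)
      simp [this]
    | succ n ih =>
      intro q hq
      have hq' : q.natDegree ≤ n := by
        rcases eq_or_ne q 0 with rfl | h0
        · simp
        · exact Nat.lt_succ_iff.mp ((natDegree_lt_iff_degree_lt h0).mpr hq)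
      obtain ⟨c, hc⟩ := exists_degree_sub_legendre_lt hq'
      have h1 := ih _ hc
      simp only [eval_sub, eval_mul, eval_C, mul_sub] at h1
      rw [integral_sub (hint q) (by simpa [mul_left_comm] using (hint (legendre n)).const_mul c)]
        at h1
      simp_rw [mul_left_comm _ c] at h1
      rw [MeasureTheory.integral_const_mul, h n] at h1
      simpa using h1
  exact key (q.natDegree + 1) q
    (lt_of_le_of_lt degree_le_natDegree (by exact_mod_cast Nat.lt_succ_self _))

end Legendre


/-! ### Spherical coordinates -/

section Coordinates

open Real Set
open scoped ENNReal

local notation "E3" => EuclideanSpace ℝ (Fin 3)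

/-- Polar coordinates `(R, a)` in the half-plane, then `s = cos a`: the weight `ρ = R sin a`
supplies the Jacobian of the cosine and leaves `R²`. -/
lemma lintegral_half_plane {h : ℝ × ℝ → ℝ≥0∞} (hh : Measurable h) :
    ∫⁻ x, ∫⁻ ρ in Ioi (0 : ℝ), ENNReal.ofReal ρ * h (x, ρ) =
      ∫⁻ R in Ioi (0 : ℝ), ∫⁻ s in Ioo (-1 : ℝ) 1,
        ENNReal.ofReal (R ^ 2) * h (R * cos (arccos s), R * sin (arccos s)) := by
  have hm : Measurable fun p : ℝ × ℝ => {p : ℝ × ℝ | 0 < p.2}.indicator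
      (fun p => ENNReal.ofReal p.2 * h p) p :=
    (measurable_snd.ennreal_ofReal.mul hh).indicator (measurableSet_lt measurable_const
      measurable_snd)
  have h1 : ∫⁻ x, ∫⁻ ρ in Ioi (0 : ℝ), ENNReal.ofReal ρ * h (x, ρ) =
      ∫⁻ p : ℝ × ℝ, {p : ℝ × ℝ | 0 < p.2}.indicator (fun p => ENNReal.ofReal p.2 * h p) p := by
    rw [Measure.volume_eq_prod, lintegral_prod _ hm.aemeasurable]
    refine lintegral_congr fun x => ?_
    rw [← lintegral_indicator measurableSet_Ioi]
    rfl
  rw [h1, ← lintegral_comp_polarCoord_symm, polarCoord_target, Measure.volume_eq_prod,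
    ← Measure.prod_restrict, lintegral_prod]
  swap
  · exact ((measurable_fst.ennreal_ofReal).smul
      (hm.comp continuous_polarCoord_symm.measurable)).aemeasurable
  refine setLIntegral_congr_fun measurableSet_Ioi fun R hR => ?_
  have hR' : 0 < R := hR
  have himg : Ioo (-1 : ℝ) 1 = cos '' Ioo 0 π := by
    ext s
    constructor
    · intro hs
      exact ⟨arccos s, ⟨arccos_pos.mpr hs.2, by
        rcases (arccos_le_pi s).lt_or_eq with h | h
        · exact h
        · rw [arccos_eq_pi] at h; exact absurd hs.1 (not_lt.mpr h)⟩, cos_arccos hs.1.le hs.2.le⟩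
    · rintro ⟨a, ha, rfl⟩
      refine ⟨?_, ?_⟩
      · rw [← cos_pi]; exact cos_lt_cos_of_nonneg_of_le_pi ha.1.le le_rfl ha.2
      · rw [← cos_zero]; exact cos_lt_cos_of_nonneg_of_le_pi le_rfl ha.2.le ha.1
  dsimp only
  rw [himg, lintegral_image_eq_lintegral_abs_deriv_mul measurableSet_Ioo
    (fun x _ => (hasDerivAt_cos x).hasDerivWithinAt)
    (injOn_cos.mono Ioo_subset_Icc_self)]
  rw [← lintegral_indicator measurableSet_Ioo, ← lintegral_indicator measurableSet_Ioo]
  refine lintegral_congr fun a => ?_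
  simp only [indicator, mem_Ioo, polarCoord_symm_apply, smul_eq_mul, mem_ofPred_eq]
  by_cases ha : 0 < a ∧ a < π
  · have hs : 0 < sin a := sin_pos_of_pos_of_lt_pi ha.1 ha.2
    rw [if_pos ⟨by linarith, ha.2⟩, if_pos (by positivity), if_pos ha,
      arccos_cos ha.1.le ha.2.le, abs_neg, abs_of_pos hs, ← mul_assoc, ← mul_assoc,
      ← ENNReal.ofReal_mul hR'.le, ← ENNReal.ofReal_mul hs.le]
    congr 2; ring
  · rw [if_neg ha]
    -- For angles in `(-π, 0]` the sine is nonpositive, so the point is outside the half-plane.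
    split_ifs with h1 h2
    · exfalso
      have : a ≤ 0 := by by_contra h; exact ha ⟨not_le.mp h, h1.2⟩
      have := sin_nonpos_of_nonpos_of_neg_pi_le this h1.1.le
      nlinarith
    · simp
    · rfl

/-- Cylindrical coordinates about the first axis, followed by `lintegral_half_plane` in each
meridian half-plane. -/
lemma lintegral_spherical {g : ℝ × ℝ × ℝ → ℝ≥0∞} (hg : Measurable g) :
    ∫⁻ q, g q = ∫⁻ θ in Ioo (-π) π, ∫⁻ R in Ioi (0 : ℝ), ∫⁻ s in Ioo (-1 : ℝ) 1,
      ENNReal.ofReal (R ^ 2) * g (R * cos (arccos s), R * sin (arccos s) * cos θ,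
        R * sin (arccos s) * sin θ) := by
  have hmeas : Measurable fun r : (ℝ × ℝ) × ℝ =>
      ENNReal.ofReal r.1.2 * g (r.1.1, r.1.2 * cos r.2, r.1.2 * sin r.2) := by fun_prop
  calc ∫⁻ q, g q = ∫⁻ x, ∫⁻ y : ℝ × ℝ, g (x, y) := by
        rw [Measure.volume_eq_prod, lintegral_prod _ hg.aemeasurable]
    _ = ∫⁻ x, ∫⁻ ρ in Ioi (0 : ℝ), ∫⁻ θ in Ioo (-π) π,
          ENNReal.ofReal ρ * g (x, ρ * cos θ, ρ * sin θ) := by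
        refine lintegral_congr fun x => ?_
        rw [← lintegral_comp_polarCoord_symm, polarCoord_target, Measure.volume_eq_prod,
          ← Measure.prod_restrict, lintegral_prod]
        · rfl
        · refine Measurable.aemeasurable ?_
          exact (measurable_fst.ennreal_ofReal).smul (hg.comp (measurable_const.prodMk
            continuous_polarCoord_symm.measurable))
    _ = ∫⁻ θ in Ioo (-π) π, ∫⁻ x, ∫⁻ ρ in Ioi (0 : ℝ),
          ENNReal.ofReal ρ * g (x, ρ * cos θ, ρ * sin θ) := by
        have : ∀ x, ∫⁻ ρ in Ioi (0 : ℝ), ∫⁻ θ in Ioo (-π) π,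
            ENNReal.ofReal ρ * g (x, ρ * cos θ, ρ * sin θ) = ∫⁻ θ in Ioo (-π) π,
            ∫⁻ ρ in Ioi (0 : ℝ), ENNReal.ofReal ρ * g (x, ρ * cos θ, ρ * sin θ) := by
          intro x
          rw [lintegral_lintegral_swap]
          exact (hmeas.comp (f := fun r : ℝ × ℝ => ((x, r.1), r.2)) (by fun_prop)).aemeasurable
        simp_rw [this]
        rw [lintegral_lintegral_swap]
        exact (Measurable.lintegral_prod_left'
            (f := fun r : ℝ × (ℝ × ℝ) => ENNReal.ofReal r.1 *
              g (r.2.1, r.1 * cos r.2.2, r.1 * sin r.2.2)) (by fun_prop)).aemeasurable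
    _ = _ := by
        refine lintegral_congr fun θ => ?_
        rw [lintegral_half_plane (h := fun p : ℝ × ℝ => g (p.1, p.2 * cos θ, p.2 * sin θ))
          (by fun_prop)]

lemma measurePreserving_frame (b : OrthonormalBasis (Fin 3) ℝ E3) :
    MeasurePreserving (fun q : ℝ × ℝ × ℝ => q.1 • b 0 + q.2.1 • b 1 + q.2.2 • b 2)
      volume volume := by
  have h1 := (volume_preserving_finTwoArrow ℝ).symm
  have h2 := (MeasurePreserving.id (volume : Measure ℝ)).prod h1
  have h3 := (volume_preserving_piFinSuccAbove (fun _ : Fin 3 => ℝ) 0).symm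
  have h4 := b.measurePreserving_repr_symm.comp
    ((PiLp.volume_preserving_toLp (Fin 3)).comp (h3.comp h2))
  refine (congrArg (fun f => MeasurePreserving f volume volume) (funext fun q => ?_)).mpr h4
  simp only [Function.comp_apply]
  rw [← b.sum_repr_symm]
  simp [Fin.sum_univ_three, MeasurableEquiv.piFinSuccAbove, MeasurableEquiv.finTwoArrow]

/-- The point of the sphere with height `s` over the plane orthogonal to `b 0` and longitude `θ`. -/
noncomputable def sphPt (b : OrthonormalBasis (Fin 3) ℝ E3) (q : ℝ × ℝ) : S2 :=
  ⟨cos (arccos q.1) • b 0 + (sin (arccos q.1) * cos q.2) • b 1 +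
    (sin (arccos q.1) * sin q.2) • b 2, by
      rw [mem_sphere_zero_iff_norm, ← sq_eq_sq₀ (norm_nonneg _) zero_le_one,
        ← b.sum_sq_norm_inner_right]
      simp [Fin.sum_univ_three, inner_add_right, inner_smul_right,
        orthonormal_iff_ite.mp b.orthonormal]
      nlinarith [sin_sq_add_cos_sq (arccos q.1), sin_sq_add_cos_sq q.2]⟩

lemma continuous_sphPt (b : OrthonormalBasis (Fin 3) ℝ E3) : Continuous (sphPt b) := by
  unfold sphPt
  fun_prop

lemma smul_mem_image_homeomorph {A : Set S2} {R : ℝ} (hR : 0 < R) (y : S2) :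
    R • (y : E3) ∈ (Subtype.val '' (homeomorphUnitSphereProd E3 ⁻¹'
      (A ×ˢ Iio (⟨1, mem_Ioi.2 one_pos⟩ : Ioi (0 : ℝ))))) ↔ y ∈ A ∧ R < 1 := by
  have h : R • (y : E3) = ((homeomorphUnitSphereProd E3).symm (y, ⟨R, hR⟩) : E3) := rfl
  rw [h, Subtype.val_injective.mem_set_image, mem_preimage, Homeomorph.apply_symm_apply]
  simp [← Subtype.coe_lt_coe]

/-- The surface measure of `A` is three times the volume of the cone over `A` in the unit ball. In
spherical coordinates the radial integral `∫₀¹ R² dR = 1/3` cancels the factor, and what remains is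
uniform in height and longitude. -/
lemma surf_eq_map (b : OrthonormalBasis (Fin 3) ℝ E3) :
    surf = Measure.map (sphPt b) ((volume.restrict (Ioo (-1 : ℝ) 1)).prod
      (volume.restrict (Ioo (-π) π))) := by
  ext A hA
  have hmp := measurePreserving_frame b
  set D : Set E3 := (Subtype.val '' (homeomorphUnitSphereProd E3 ⁻¹'
      (A ×ˢ Iio (⟨1, mem_Ioi.2 one_pos⟩ : Ioi (0 : ℝ))))) with hD
  have hDm : MeasurableSet D :=
    (MeasurableEmbedding.subtype_coe (measurableSet_singleton _).compl).measurableSet_image.mpr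
      ((homeomorphUnitSphereProd E3).measurable (hA.prod measurableSet_Iio))
  have h1 : surf A = 3 * volume D := by
    rw [surf, Measure.toSphere_apply' _ hA, hD, Measure.toSphere_apply_aux]
    simp
  have h2 : volume D = ∫⁻ q : ℝ × ℝ × ℝ,
      D.indicator 1 (q.1 • b 0 + q.2.1 • b 1 + q.2.2 • b 2) := by
    rw [hmp.lintegral_comp (f := D.indicator 1) (measurable_one.indicator hDm),
      lintegral_indicator_one hDm]
  rw [lintegral_spherical] at h2
  swap
  · exact (measurable_one.indicator hDm).comp hmp.measurable
  have h3 : ∀ θ R s : ℝ, 0 < R → D.indicator (1 : E3 → ℝ≥0∞) ((R * cos (arccos s)) • b 0 +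
      (R * sin (arccos s) * cos θ) • b 1 + (R * sin (arccos s) * sin θ) • b 2) =
      (Iio (1 : ℝ)).indicator 1 R * A.indicator 1 (sphPt b (s, θ)) := by
    intro θ R s hR
    have : (R * cos (arccos s)) • b 0 + (R * sin (arccos s) * cos θ) • b 1 +
        (R * sin (arccos s) * sin θ) • b 2 = R • (sphPt b (s, θ) : E3) := by
      simp [sphPt, smul_smul, mul_assoc]
    rw [this]
    by_cases hy : sphPt b (s, θ) ∈ A <;> by_cases h1 : R < 1 <;>
      simp [indicator, hy, h1, hD, smul_mem_image_homeomorph hR]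
  have hAm : Measurable fun q : ℝ × ℝ => A.indicator (1 : S2 → ℝ≥0∞) (sphPt b q) :=
    (measurable_one.indicator hA).comp (continuous_sphPt b).measurable
  have h4 : ∫⁻ R in Ioi (0 : ℝ), ENNReal.ofReal (R ^ 2) * (Iio (1 : ℝ)).indicator 1 R =
      ENNReal.ofReal (1 / 3) := by
    have : ∀ R : ℝ, ENNReal.ofReal (R ^ 2) * (Iio (1 : ℝ)).indicator 1 R =
        (Iio (1 : ℝ)).indicator (fun R => ENNReal.ofReal (R ^ 2)) R := by
      intro R; by_cases h : R < 1 <;> simp [indicator, h]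
    simp_rw [this]
    rw [lintegral_indicator measurableSet_Iio, Measure.restrict_restrict measurableSet_Iio,
      Iio_inter_Ioi, Measure.restrict_congr_set Ioo_ae_eq_Ioc, ← ofReal_integral_eq_lintegral_ofReal,
      ← intervalIntegral.integral_of_le zero_le_one]
    · norm_num
    · exact ((continuous_pow 2).integrableOn_Icc).mono_set Ioc_subset_Icc_self
    · exact ae_of_all _ fun x => sq_nonneg x
  have h5 : volume D = ENNReal.ofReal (1 / 3) * ∫⁻ θ in Ioo (-π) π, ∫⁻ s in Ioo (-1 : ℝ) 1,
      A.indicator (1 : S2 → ℝ≥0∞) (sphPt b (s, θ)) := by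
    rw [h2, ← lintegral_const_mul _ (Measurable.lintegral_prod_left' hAm)]
    refine lintegral_congr fun θ => ?_
    rw [← h4, ← lintegral_mul_const]
    · refine setLIntegral_congr_fun measurableSet_Ioi fun R hR => ?_
      simp only
      have hAθ : Measurable fun s : ℝ => A.indicator (1 : S2 → ℝ≥0∞) (sphPt b (s, θ)) :=
        hAm.comp (by fun_prop : Measurable fun s : ℝ => (s, θ))
      rw [← lintegral_const_mul _ hAθ]
      refine lintegral_congr fun s => ?_
      rw [h3 θ R s hR, mul_assoc]
    · exact (by fun_prop : Measurable fun R : ℝ => ENNReal.ofReal (R ^ 2)).mul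
        (measurable_one.indicator measurableSet_Iio)
  rw [h1, h5, Measure.map_apply (continuous_sphPt b).measurable hA,
    ← lintegral_indicator_one ((continuous_sphPt b).measurable hA), lintegral_prod_symm,
    ← mul_assoc]
  · have : (3 : ℝ≥0∞) * ENNReal.ofReal (1 / 3) = 1 := by
      rw [show (3 : ℝ≥0∞) = ENNReal.ofReal 3 by simp, ← ENNReal.ofReal_mul (by norm_num)]
      norm_num
    rw [this, one_mul]
    rfl
  · exact hAm.aemeasurable

lemma continuous_dot_right (x : S2) : Continuous (dot x) := by
  unfold dot; fun_prop

lemma dot_comm (x y : S2) : dot x y = dot y x := real_inner_comm _ _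

lemma dot_self (x : S2) : dot x x = 1 := by
  rw [dot, real_inner_self_eq_norm_sq, mem_sphere_zero_iff_norm.mp x.2]; norm_num

lemma dot_mem_Icc (x y : S2) : dot x y ∈ Icc (-1 : ℝ) 1 := by
  have h := abs_real_inner_le_norm (x : E3) (y : E3)
  rw [mem_sphere_zero_iff_norm.mp x.2, mem_sphere_zero_iff_norm.mp y.2, one_mul] at h
  exact abs_le.mp h

lemma exists_frame (x : S2) : ∃ b : OrthonormalBasis (Fin 3) ℝ E3, b 0 = x := by
  have h : Orthonormal ℝ (({0} : Set (Fin 3)).domRestrict (fun _ => (x : E3))) := by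
    constructor
    · intro i; exact mem_sphere_zero_iff_norm.mp x.2
    · intro i j hij; exact absurd (Subsingleton.elim i j) hij
  obtain ⟨b, hb⟩ := h.exists_orthonormalBasis_extension_of_card_eq (by simp)
  exact ⟨b, hb 0 rfl⟩

lemma dot_sphPt (b : OrthonormalBasis (Fin 3) ℝ E3) (w : S2) (q : ℝ × ℝ) :
    dot w (sphPt b q) = inner ℝ (w : E3) (b 0) * cos (arccos q.1) + sin (arccos q.1) *
      (inner ℝ (w : E3) (b 1) * cos q.2 + inner ℝ (w : E3) (b 2) * sin q.2) := by
  simp only [dot, sphPt, inner_add_right, inner_smul_right]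
  ring

lemma dot_sphPt_self {b : OrthonormalBasis (Fin 3) ℝ E3} {x : S2} (hb : b 0 = x) {q : ℝ × ℝ}
    (hq : q.1 ∈ Icc (-1 : ℝ) 1) : dot x (sphPt b q) = q.1 := by
  rw [dot_sphPt, ← hb, cos_arccos hq.1 hq.2]
  simp [orthonormal_iff_ite.mp b.orthonormal]

/-- Archimedes' theorem: the height function pushes the surface measure forward to `2π` times
Lebesgue measure on `[-1,1]`. -/
lemma map_dot_surf (x : S2) :
    surf.map (dot x) = ENNReal.ofReal (2 * π) • volume.restrict (Icc (-1 : ℝ) 1) := by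
  obtain ⟨b, hb⟩ := exists_frame x
  rw [surf_eq_map b, Measure.map_map (continuous_dot_right x).measurable
    (continuous_sphPt b).measurable]
  have : dot x ∘ sphPt b =ᵐ[(volume.restrict (Ioo (-1 : ℝ) 1)).prod
      (volume.restrict (Ioo (-π) π))] Prod.fst := by
    rw [Measure.prod_restrict]
    filter_upwards [ae_restrict_mem (measurableSet_Ioo.prod measurableSet_Ioo)] with q hq
    exact dot_sphPt_self hb ⟨hq.1.1.le, hq.1.2.le⟩
  rw [Measure.map_congr this, Measure.map_fst_prod,
    Measure.restrict_congr_set (Ioo_ae_eq_Icc (a := (-1 : ℝ)) (b := 1)), Measure.restrict_apply_univ,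
    volume_Ioo]
  congr 2; ring

lemma quasiMeasurePreserving_dot (x : S2) :
    Measure.QuasiMeasurePreserving (dot x) surf (volume.restrict (Icc (-1 : ℝ) 1)) := by
  refine ⟨(continuous_dot_right x).measurable, ?_⟩
  rw [map_dot_surf]
  exact Measure.smul_absolutelyContinuous

instance : IsFiniteMeasure surf := by unfold surf; infer_instance

lemma memLp_comp_dot {k : ℝ → ℝ} {p : ℝ≥0∞} (hk : MemLp k p (volume.restrict (Icc (-1 : ℝ) 1)))
    (x : S2) : MemLp (fun y => k (dot x y)) p surf := by
  have h : MemLp k p (surf.map (dot x)) := by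
    rw [map_dot_surf]; exact hk.smul_measure ENNReal.ofReal_ne_top
  exact (memLp_map_measure_iff h.1 (continuous_dot_right x).aemeasurable).mp h

lemma integral_comp_dot {k : ℝ → ℝ} (hk : AEStronglyMeasurable k (volume.restrict (Icc (-1 : ℝ) 1)))
    (x : S2) : ∫ y, k (dot x y) ∂surf = 2 * π * ∫ s in Icc (-1 : ℝ) 1, k s := by
  have h : AEStronglyMeasurable k (surf.map (dot x)) := by
    rw [map_dot_surf]; exact hk.smul_measure _
  rw [← integral_map (continuous_dot_right x).aemeasurable h, map_dot_surf, integral_smul_measure,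
    ENNReal.toReal_ofReal (by positivity), smul_eq_mul]

/-- With pole `x` the first factor depends on the height only, so the second matters only through
its integrals over parallels. -/
lemma integral_mul_poly_dot {b : OrthonormalBasis (Fin 3) ℝ E3} {x : S2} (hb : b 0 = x) (w : S2)
    {k : ℝ → ℝ} (hk : IntegrableOn k (Icc (-1 : ℝ) 1)) (q r : Polynomial ℝ)
    (hr : ∀ s ∈ Icc (-1 : ℝ) 1, ∫ θ in (-π)..π, q.eval (dot w (sphPt b (s, θ))) = r.eval s) :
    ∫ y, k (dot x y) * q.eval (dot w y) ∂surf = ∫ s in Icc (-1 : ℝ) 1, k s * r.eval s := by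
  have hmeas : AEStronglyMeasurable (fun y => k (dot x y) * q.eval (dot w y)) surf :=
    (hk.aestronglyMeasurable.comp_quasiMeasurePreserving (quasiMeasurePreserving_dot x)).mul
      (q.continuous.comp (continuous_dot_right w)).aestronglyMeasurable
  have hkI : Integrable k (volume.restrict (Ioo (-1 : ℝ) 1)) := hk.mono_set Ioo_subset_Icc_self
  rw [surf_eq_map b] at hmeas ⊢
  rw [integral_map (continuous_sphPt b).aemeasurable hmeas]
  have hae : (fun q' : ℝ × ℝ => k (dot x (sphPt b q')) * q.eval (dot w (sphPt b q')))
      =ᵐ[(volume.restrict (Ioo (-1 : ℝ) 1)).prod (volume.restrict (Ioo (-π) π))]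
      fun q' => k q'.1 * q.eval (dot w (sphPt b q')) := by
    rw [Measure.prod_restrict]
    filter_upwards [ae_restrict_mem (measurableSet_Ioo.prod measurableSet_Ioo)] with q' hq
    rw [dot_sphPt_self hb ⟨hq.1.1.le, hq.1.2.le⟩]
  obtain ⟨B, hB⟩ : ∃ B, ∀ z ∈ Icc (-1 : ℝ) 1, ‖q.eval z‖ ≤ B :=
    isCompact_Icc.exists_bound_of_continuousOn q.continuous.continuousOn
  rw [integral_congr_ae hae, integral_prod]
  · rw [integral_Icc_eq_integral_Ioo]
    refine setIntegral_congr_fun measurableSet_Ioo fun s hs => ?_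
    simp only
    rw [integral_const_mul, ← hr s ⟨hs.1.le, hs.2.le⟩, intervalIntegral.integral_of_le
      (by linarith [pi_pos]), integral_Ioc_eq_integral_Ioo]
  · refine (hkI.comp_fst _).mul_bdd (c := B) ?_ (ae_of_all _ fun q' => hB _ (dot_mem_Icc _ _))
    exact (q.continuous.comp ((continuous_dot_right w).comp
      (continuous_sphPt b))).aestronglyMeasurable

/-- Shifting `θ` by `π` changes the sign of the integrand but not the integral over a period. -/
lemma integral_trig_pow_odd (c₁ c₂ : ℝ) {j : ℕ} (hj : Odd j) :
    ∫ θ in (-π)..π, (c₁ * cos θ + c₂ * sin θ) ^ j = 0 := by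
  have hper : Function.Periodic (fun θ => (c₁ * cos θ + c₂ * sin θ) ^ j) (2 * π) := by
    intro θ; simp [cos_add_two_pi, sin_add_two_pi]
  have h1 := hper.intervalIntegral_add_eq (-π) 0
  have h2 := intervalIntegral.integral_comp_add_right (a := -π) (b := π)
    (fun θ => (c₁ * cos θ + c₂ * sin θ) ^ j) π
  have h3 : ∀ θ, (c₁ * cos (θ + π) + c₂ * sin (θ + π)) ^ j =
      -(c₁ * cos θ + c₂ * sin θ) ^ j := by
    intro θ
    rw [cos_add_pi, sin_add_pi, ← hj.neg_pow]; congr 1; ring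
  simp_rw [h3] at h2
  rw [intervalIntegral.integral_neg] at h2
  have e1 : -π + 2 * π = π := by ring
  have e2 : -π + π = 0 := by ring
  have e3 : π + π = 0 + 2 * π := by ring
  rw [e1] at h1
  rw [e2, e3] at h2
  linarith

/-- Expand by the binomial theorem. Odd powers of `sin (arccos s)` come with vanishing trigonometric
integrals; the even ones are powers of `1 - s²`, which keeps the result polynomial of degree at most
`d`. -/
lemma exists_average_pow (b : OrthonormalBasis (Fin 3) ℝ E3) (w : S2) (d : ℕ) :
    ∃ r : Polynomial ℝ, r.natDegree ≤ d ∧ ∀ s ∈ Icc (-1 : ℝ) 1,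
      ∫ θ in (-π)..π, (dot w (sphPt b (s, θ))) ^ d = r.eval s := by
  open Polynomial in
  set c₀ := inner ℝ (w : E3) (b 0)
  set c₁ := inner ℝ (w : E3) (b 1)
  set c₂ := inner ℝ (w : E3) (b 2)
  let I : ℕ → ℝ := fun j => ∫ θ in (-π)..π, (c₁ * cos θ + c₂ * sin θ) ^ j
  let Q : ℕ → Polynomial ℝ := fun j => if Even j then
    C ((d.choose j : ℝ) * I j * c₀ ^ (d - j)) * (X ^ (d - j) * (1 - X ^ 2) ^ (j / 2)) else 0
  refine ⟨∑ j ∈ Finset.range (d + 1), Q j, ?_, ?_⟩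
  · refine natDegree_sum_le_of_forall_le _ _ fun j hj => ?_
    have hjd : j ≤ d := Nat.lt_succ_iff.mp (Finset.mem_range.mp hj)
    simp only [Q]
    split_ifs with he
    · refine (natDegree_C_mul_le _ _).trans (natDegree_mul_le.trans ?_)
      have h1 : ((1 - X ^ 2 : ℝ[X]) ^ (j / 2)).natDegree ≤ (j / 2) * 2 :=
        natDegree_pow_le_of_le _ (by compute_degree)
      have h2 : (X ^ (d - j) : ℝ[X]).natDegree = d - j := natDegree_X_pow _
      omega
    · simp
  · intro s hs
    have hcos := cos_arccos hs.1 hs.2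
    have hsin : sin (arccos s) ^ 2 = 1 - s ^ 2 := by
      rw [sin_arccos, sq_sqrt]; nlinarith [hs.1, hs.2]
    have h1 : ∀ θ, (dot w (sphPt b (s, θ))) ^ d = ∑ j ∈ Finset.range (d + 1),
        ((d.choose j : ℝ) * sin (arccos s) ^ j * (c₀ * s) ^ (d - j)) *
          (c₁ * cos θ + c₂ * sin θ) ^ j := by
      intro θ
      rw [dot_sphPt, hcos, add_comm, add_pow]
      refine Finset.sum_congr rfl fun j _ => ?_
      rw [mul_pow]; ring
    simp_rw [h1]
    rw [intervalIntegral.integral_finsetSum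
      (fun j _ => Continuous.intervalIntegrable (by fun_prop) _ _), eval_finsetSum]
    refine Finset.sum_congr rfl fun j _ => ?_
    rw [intervalIntegral.integral_const_mul]
    simp only [Q]
    split_ifs with he
    · obtain ⟨i, rfl⟩ := he
      have : (i + i) / 2 = i := by omega
      rw [this]
      simp only [eval_mul, eval_C, eval_pow, eval_X, eval_sub, eval_one]
      rw [← hsin, ← pow_mul, two_mul, mul_pow]
      simp only [I]
      ring
    · rw [integral_trig_pow_odd _ _ (Nat.not_even_iff_odd.mp he)]; simp

/-- The average of a polynomial of `⟨w, ·⟩` over the parallels around a pole is a polynomial of the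
height, of no larger degree. -/
lemma exists_average (b : OrthonormalBasis (Fin 3) ℝ E3) (w : S2) (q : Polynomial ℝ) :
    ∃ r : Polynomial ℝ, r.natDegree ≤ q.natDegree ∧ ∀ s ∈ Icc (-1 : ℝ) 1,
      ∫ θ in (-π)..π, q.eval (dot w (sphPt b (s, θ))) = r.eval s := by
  open Polynomial in
  choose R hR1 hR2 using exists_average_pow b w
  refine ⟨∑ i ∈ Finset.range (q.natDegree + 1), C (q.coeff i) * R i, ?_, ?_⟩
  · refine natDegree_sum_le_of_forall_le _ _ fun i hi => ?_
    exact (natDegree_C_mul_le _ _).trans ((hR1 i).trans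
      (Nat.lt_succ_iff.mp (Finset.mem_range.mp hi)))
  · intro s hs
    have hc : Continuous fun θ : ℝ => dot w (sphPt b (s, θ)) :=
      (continuous_dot_right w).comp ((continuous_sphPt b).comp (by fun_prop))
    simp_rw [eval_eq_sum_range (p := q)]
    rw [intervalIntegral.integral_finsetSum
      (fun j _ => Continuous.intervalIntegrable (by fun_prop) _ _), eval_finsetSum]
    refine Finset.sum_congr rfl fun i _ => ?_
    rw [intervalIntegral.integral_const_mul, hR2 i s hs, eval_mul, eval_C]

/-- The average `r` about `x` is a polynomial of degree at most `l`. For `m` of lower degree, `∫ m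
r` is a spherical integral of `m(⟨x,y⟩) P_l(⟨w,y⟩)`; averaging it about `w` instead turns `m` into a
polynomial of degree below `l`, to which `P_l` is orthogonal. Hence `r` is a multiple of `P_l`, and
the pole `s = 1` determines the factor. -/
lemma average_legendre {b : OrthonormalBasis (Fin 3) ℝ E3} {x : S2} (hb : b 0 = x) (w : S2)
    (l : ℕ) : ∀ s ∈ Icc (-1 : ℝ) 1, ∫ θ in (-π)..π, (legendre l).eval (dot w (sphPt b (s, θ))) =
      (Polynomial.C (2 * π * (legendre l).eval (dot w x)) * legendre l).eval s := by
  obtain ⟨r, hr1, hr2⟩ := exists_average b w (legendre l)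
  have hr := eq_C_mul_legendre_of_orthogonal (hr1.trans (natDegree_legendre_le l)) ?_
  · have h1 := hr2 1 (by simp)
    have h2 : ∀ θ, sphPt b (1, θ) = x := by
      intro θ
      ext1
      simp [sphPt, hb]
    simp_rw [h2] at h1
    rw [intervalIntegral.integral_const, smul_eq_mul] at h1
    intro s hs
    rw [hr2 s hs, hr, ← h1]
    congr 4; ring
  · intro m hm
    obtain ⟨b', hb'⟩ := exists_frame w
    obtain ⟨m', hm1, hm2⟩ := exists_average b' x m
    have e1 := integral_mul_poly_dot hb w (k := fun s => m.eval s)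
      (m.continuous.integrableOn_Icc) (legendre l) r hr2
    have e2 := integral_mul_poly_dot hb' x (k := fun s => (legendre l).eval s)
      ((legendre l).continuous.integrableOn_Icc) m m' hm2
    have hdeg : m'.degree < (l : WithBot ℕ) := by
      -- `natDegree` does not distinguish `0` from the constants, so for `m = 0` the average is
      -- shown to be zero directly.
      rcases eq_or_ne m 0 with rfl | hm0
      · have : m' = 0 := by
          have h0 : m'.natDegree = 0 := by simpa using hm1
          rw [Polynomial.eq_C_of_natDegree_eq_zero h0] at hm2 ⊢
          have := hm2 0 (by simp)
          simp at this
          rw [← this]; simp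
        rw [this, Polynomial.degree_zero]; exact WithBot.bot_lt_coe l
      · have := (Polynomial.natDegree_lt_iff_degree_lt hm0).mpr hm
        exact lt_of_le_of_lt Polynomial.degree_le_natDegree
          (by exact_mod_cast hm1.trans_lt this)
    have e3 := integral_mul_legendre_eq_zero hdeg
    rw [intervalIntegral.integral_of_le (by norm_num), ← integral_Icc_eq_integral_Ioc] at e3 ⊢
    rw [← e1, ← e3]
    simp_rw [mul_comm (m'.eval _)]
    rw [← e2]
    simp_rw [mul_comm]

/-- The Funk–Hecke formula. -/
lemma integral_mul_zonal {k : ℝ → ℝ} (hk : IntegrableOn k (Icc (-1 : ℝ) 1)) (x w : S2) (l : ℕ) :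
    ∫ y, k (dot x y) * zonal l (dot y w) ∂surf = coeff k l * zonal l (dot x w) := by
  obtain ⟨b, hb⟩ := exists_frame x
  have h := integral_mul_poly_dot hb w hk (legendre l) _ (average_legendre hb w l)
  have h1 : ∀ y, k (dot x y) * zonal l (dot y w) = (2 * (l : ℝ) + 1) / (4 * π) *
      (k (dot x y) * (legendre l).eval (dot w y)) := by
    intro y; rw [zonal, dot_comm y w]; ring
  simp_rw [h1]
  rw [integral_const_mul, h]
  simp only [Polynomial.eval_mul, Polynomial.eval_C]
  simp_rw [mul_left_comm (k _)]
  rw [integral_const_mul, coeff, zonal, dot_comm x w]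
  ring

end Coordinates


/-! ### Zonal kernels and spherical harmonics -/

section Harmonics

open Real Set
open scoped ENNReal

lemma continuous_zonal (l : ℕ) : Continuous (zonal l) := by
  unfold zonal; fun_prop

lemma zonal_one (l : ℕ) : zonal l 1 = (2 * (l : ℝ) + 1) / (4 * π) := by
  rw [zonal, legendre_eval_one, mul_one]

lemma continuous_dot : Continuous fun q : S2 × S2 => dot q.1 q.2 := by
  unfold dot; fun_prop

lemma coeff_zonal (m l : ℕ) : coeff (zonal m) l = if m = l then 1 else 0 := by
  have h : ∀ z, zonal m z * (legendre l).eval z = (2 * (m : ℝ) + 1) / (4 * π) *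
      ((legendre m).eval z * (legendre l).eval z) := fun z => by rw [zonal]; ring
  rw [coeff]
  simp_rw [h]
  rw [integral_const_mul, integral_Icc_eq_integral_Ioc,
    ← intervalIntegral.integral_of_le (by norm_num)]
  split_ifs with hml
  · subst hml
    rw [integral_legendre_sq]
    have := pi_pos
    field_simp
    norm_num
  · rw [integral_legendre_mul_legendre_of_ne hml]; simp

lemma integral_zonal_mul_zonal (m l : ℕ) (x w : S2) :
    ∫ y, zonal m (dot x y) * zonal l (dot y w) ∂surf =
      if m = l then zonal l (dot x w) else 0 := by
  rw [integral_mul_zonal (continuous_zonal m).integrableOn_Icc, coeff_zonal]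
  split_ifs <;> simp

lemma memLp_of_continuous {f : S2 → ℝ} (hf : Continuous f) (p : ℝ≥0∞) : MemLp f p surf := by
  obtain ⟨B, hB⟩ := isCompact_univ.exists_bound_of_continuousOn hf.continuousOn
  exact MemLp.of_bound hf.aestronglyMeasurable B (ae_of_all _ fun x => hB x (mem_univ x))

lemma integrable_of_continuous {f : S2 → ℝ} (hf : Continuous f) : Integrable f surf :=
  memLp_one_iff_integrable.mp (memLp_of_continuous hf 1)

lemma continuous_zonal_dot (l : ℕ) (x : S2) : Continuous fun y => zonal l (dot x y) :=
  (continuous_zonal l).comp (continuous_dot_right x)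

lemma surf_real_univ : surf.real univ = 4 * π := by
  let x : S2 := ⟨EuclideanSpace.single 0 1, by simp⟩
  have h := integral_comp_dot (k := fun _ => 1) aestronglyMeasurable_const x
  simp at h
  rw [h]; ring

/-- The zonal function with pole `x`, as an element of `L²(S²)`. -/
noncomputable def zonalLp (l : ℕ) (x : S2) : Lp ℝ 2 surf :=
  (memLp_of_continuous (continuous_zonal_dot l x) 2).toLp _

lemma inner_eq_integral {α : Type*} [MeasurableSpace α] {μ : Measure α} (f g : Lp ℝ 2 μ) :
    inner ℝ f g = ∫ x, f x * g x ∂μ := by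
  rw [L2.inner_def]
  simp [mul_comm]

lemma inner_toLp {α : Type*} [MeasurableSpace α] {μ : Measure α} {f g : α → ℝ}
    (hf : MemLp f 2 μ) (hg : MemLp g 2 μ) :
    inner ℝ (hf.toLp f) (hg.toLp g) = ∫ x, f x * g x ∂μ := by
  rw [inner_eq_integral]
  exact integral_congr_ae (hf.coeFn_toLp.mul hg.coeFn_toLp)

lemma inner_zonalLp (l : ℕ) (x w : S2) :
    inner ℝ (zonalLp l x) (zonalLp l w) = zonal l (dot x w) := by
  rw [zonalLp, zonalLp, inner_toLp]
  simp_rw [dot_comm w]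
  rw [integral_zonal_mul_zonal, if_pos rfl]

/-- Cauchy–Schwarz: `zonal l z` is the inner product of two zonal functions with poles at inner
product `z`, each of squared norm `zonal l 1`. -/
lemma abs_zonal_le (l : ℕ) {z : ℝ} (hz : z ∈ Icc (-1 : ℝ) 1) :
    |zonal l z| ≤ (2 * (l : ℝ) + 1) / (4 * π) := by
  let x : S2 := ⟨EuclideanSpace.single 0 1, by simp⟩
  obtain ⟨b, hb⟩ := exists_frame x
  have h1 : dot x (sphPt b (z, 0)) = z := dot_sphPt_self hb hz
  have h2 : ∀ w, ‖zonalLp l w‖ ^ 2 = (2 * (l : ℝ) + 1) / (4 * π) := fun w => by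
    rw [← real_inner_self_eq_norm_sq, inner_zonalLp, dot_self, zonal_one]
  have h3 := abs_real_inner_le_norm (zonalLp l x) (zonalLp l (sphPt b (z, 0)))
  rw [inner_zonalLp, h1] at h3
  have h4 := h2 x
  have h5 := h2 (sphPt b (z, 0))
  nlinarith [sq_nonneg (‖zonalLp l x‖ - ‖zonalLp l (sphPt b (z, 0))‖)]

/-- Expanding powers of `⟨x, y⟩` writes every zonal function as a combination of finitely many
monomials in the coordinates of `y`. -/
lemma finiteDimensional_span_zonalLp (l : ℕ) :
    FiniteDimensional ℝ (Submodule.span ℝ (range (zonalLp l))) := by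
  have hc : ∀ (i : Σ d : Fin (l + 1), (Fin d → Fin 3)),
      Continuous fun y : S2 => ∏ j, (y : EuclideanSpace ℝ (Fin 3)) (i.2 j) := by
    intro i; fun_prop
  let mono : (Σ d : Fin (l + 1), (Fin d → Fin 3)) → Lp ℝ 2 surf :=
    fun i => (memLp_of_continuous (hc i) 2).toLp _
  have hfin : FiniteDimensional ℝ (Submodule.span ℝ (range mono)) :=
    FiniteDimensional.span_of_finite ℝ (finite_range mono)
  refine Submodule.finiteDimensional_of_le (S₂ := Submodule.span ℝ (range mono)) ?_
  rw [Submodule.span_le]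
  rintro _ ⟨x, rfl⟩
  let c : (Σ d : Fin (l + 1), (Fin d → Fin 3)) → ℝ := fun i =>
    (2 * (l : ℝ) + 1) / (4 * π) * (legendre l).coeff i.1 *
      ∏ j, (x : EuclideanSpace ℝ (Fin 3)) (i.2 j)
  have h : zonalLp l x = ∑ i, c i • mono i := by
    have hsum : (∑ i, c i • mono i : Lp ℝ 2 surf) =ᵐ[surf] ∑ i, (c i • mono i : Lp ℝ 2 surf) :=
      Lp.coeFn_finsetSum _ _
    apply Lp.ext
    filter_upwards [(memLp_of_continuous (continuous_zonal_dot l x) 2).coeFn_toLp, hsum,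
      ae_all_iff.mpr fun i => Lp.coeFn_smul (c i) (mono i),
      ae_all_iff.mpr fun i => (memLp_of_continuous (hc i) 2).coeFn_toLp] with y h1 h2 h3 h4
    rw [zonalLp, h1, h2, Finset.sum_apply]
    have h5 : ∀ i, (c i • mono i : Lp ℝ 2 surf) y =
        c i * ∏ j, (y : EuclideanSpace ℝ (Fin 3)) (i.2 j) := by
      intro i
      rw [h3, Pi.smul_apply, h4, smul_eq_mul]
    simp_rw [h5]
    rw [Fintype.sum_sigma, zonal, Polynomial.eval_eq_sum_range, natDegree_legendre,
      Finset.sum_range, Finset.mul_sum]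
    refine Finset.sum_congr rfl fun d _ => ?_
    have h6 : dot x y = ∑ i : Fin 3, (x : EuclideanSpace ℝ (Fin 3)) i *
        (y : EuclideanSpace ℝ (Fin 3)) i := by
      rw [dot, PiLp.inner_apply]; simp [mul_comm]
    rw [h6, Finset.sum_pow', Fintype.piFinset_univ, Finset.mul_sum, Finset.mul_sum]
    refine Finset.sum_congr rfl fun f _ => ?_
    simp only [c]
    rw [Finset.prod_mul_distrib]; ring
  rw [h]
  exact Submodule.sum_mem _ fun i _ => Submodule.smul_mem _ _ (Submodule.subset_span ⟨i, rfl⟩)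

/-- The reproducing property provides each class in the span with a canonical continuous
representative. -/
lemma continuous_inner_zonalLp_and_ae_eq {l : ℕ} {f : Lp ℝ 2 surf}
    (hf : f ∈ Submodule.span ℝ (range (zonalLp l))) :
    (Continuous fun x => inner ℝ f (zonalLp l x)) ∧
      f =ᵐ[surf] fun x => inner ℝ f (zonalLp l x) := by
  induction hf using Submodule.span_induction with
  | mem f hf =>
    obtain ⟨w, rfl⟩ := hf
    simp_rw [inner_zonalLp]
    exact ⟨continuous_zonal_dot l w, (memLp_of_continuous (continuous_zonal_dot l w) 2).coeFn_toLp⟩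
  | zero =>
    simp_rw [inner_zero_left]
    exact ⟨continuous_const, Lp.coeFn_zero ℝ 2 surf⟩
  | add f g _ _ hf hg =>
    simp_rw [inner_add_left]
    refine ⟨hf.1.add hg.1, ?_⟩
    filter_upwards [Lp.coeFn_add f g, hf.2, hg.2] with x h1 h2 h3
    rw [h1, Pi.add_apply]; exact congrArg₂ _ h2 h3
  | smul c f _ hf =>
    simp_rw [real_inner_smul_left]
    refine ⟨hf.1.const_mul c, ?_⟩
    filter_upwards [Lp.coeFn_smul c f, hf.2] with x h1 h2
    rw [h1, Pi.smul_apply, smul_eq_mul]; exact congrArg _ h2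

/-- An orthonormal basis of the spherical harmonics of degree `l`; the zonal kernel is the
reproducing kernel of their span. -/
theorem exists_harmonics (l : ℕ) : ∃ e : Fin (2 * l + 1) → S2 → ℝ, (∀ m, Continuous (e m)) ∧
    (∀ m m', ∫ x, e m x * e m' x ∂surf = if m = m' then 1 else 0) ∧
    ∀ x y, zonal l (dot x y) = ∑ m, e m x * e m y := by
  have := finiteDimensional_span_zonalLp l
  set S := Submodule.span ℝ (range (zonalLp l)) with hS
  let b := stdOrthonormalBasis ℝ S
  let e : Fin (Module.finrank ℝ S) → S2 → ℝ := fun m x => inner ℝ (b m : Lp ℝ 2 surf) (zonalLp l x)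
  have hc : ∀ m, Continuous (e m) := fun m => (continuous_inner_zonalLp_and_ae_eq (b m).2).1
  have hae : ∀ m, (b m : Lp ℝ 2 surf) =ᵐ[surf] e m :=
    fun m => (continuous_inner_zonalLp_and_ae_eq (b m).2).2
  have horth : ∀ m m', ∫ x, e m x * e m' x ∂surf = if m = m' then 1 else 0 := by
    intro m m'
    rw [← orthonormal_iff_ite.mp b.orthonormal m m', Submodule.coe_inner, inner_eq_integral]
    exact integral_congr_ae ((hae m).mul (hae m')).symm
  have hrep : ∀ x y, zonal l (dot x y) = ∑ m, e m x * e m y := by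
    intro x y
    have hx : zonalLp l x ∈ S := Submodule.subset_span ⟨x, rfl⟩
    have hy : zonalLp l y ∈ S := Submodule.subset_span ⟨y, rfl⟩
    have h := b.sum_inner_mul_inner ⟨zonalLp l x, hx⟩ ⟨zonalLp l y, hy⟩
    rw [Submodule.coe_inner, inner_zonalLp] at h
    rw [← h]
    refine Finset.sum_congr rfl fun m _ => ?_
    rw [Submodule.coe_inner, Submodule.coe_inner, real_inner_comm]
  -- Trace of the reproducing kernel: the integral over the diagonal is `4π · (2l+1)/(4π)` by
  -- evaluation and the number of basis elements by orthonormality.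
  have hcard : Module.finrank ℝ S = 2 * l + 1 := by
    have h1 : ∫ x, zonal l (dot x x) ∂surf = 2 * l + 1 := by
      simp_rw [dot_self, zonal_one]
      rw [integral_const, surf_real_univ, smul_eq_mul]
      field_simp
    simp_rw [hrep] at h1
    rw [integral_finsetSum _ fun m _ => integrable_of_continuous (by fun_prop)] at h1
    simp_rw [horth] at h1
    simp at h1
    exact_mod_cast h1
  refine ⟨fun m => e (finCongr hcard.symm m), fun m => hc _, fun m m' => ?_, fun x y => ?_⟩
  · rw [horth]; simp
  · rw [hrep]
    exact (Equiv.sum_comp (finCongr hcard.symm) fun m => e m x * e m y).symm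

end Harmonics


/-! ### Gaussian Hilbert spaces -/

section GaussianSpace

set_option linter.unusedSectionVars false

open scoped ENNReal NNReal

variable {Ω : Type*} [MeasurableSpace Ω] {P : Measure Ω}

/-- A linear space of square-integrable random variables is a (centred) Gaussian space if all of
its elements are centred Gaussian. -/
def IsGaussianSpace (H : Submodule ℝ (Lp ℝ 2 P)) : Prop :=
  ∀ X ∈ H, P.map X = gaussianReal 0 (‖X‖₊ ^ 2)

lemma aemeasurable_Lp (X : Lp ℝ 2 P) : AEMeasurable X P :=
  (Lp.stronglyMeasurable X).measurable.aemeasurable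

lemma measurable_Lp (X : Lp ℝ 2 P) : Measurable X := (Lp.stronglyMeasurable X).measurable

variable [IsProbabilityMeasure P] {H : Submodule ℝ (Lp ℝ 2 P)}

lemma IsGaussianSpace.hasGaussianLaw (hH : IsGaussianSpace H) {ι : Type*} [Finite ι]
    {X : ι → Lp ℝ 2 P} (hX : ∀ i, X i ∈ H) : HasGaussianLaw (fun ω i => X i ω) P := by
  have := Fintype.ofFinite ι
  classical
  have hm : Measurable fun ω i => X i ω := measurable_pi_lambda _ fun i => measurable_Lp _
  refine ⟨isGaussian_of_map_eq_gaussianReal fun L => ?_⟩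
  let Y : Lp ℝ 2 P := ∑ i, L (Pi.single i 1) • X i
  have hY : Y ∈ H := Submodule.sum_mem _ fun i _ => H.smul_mem _ (hX i)
  have hae : (fun ω => L fun i => X i ω) =ᵐ[P] Y := by
    have hsum : (Y : Ω → ℝ) =ᵐ[P] ∑ i, (L (Pi.single i 1) • X i : Lp ℝ 2 P) :=
      Lp.coeFn_finsetSum _ _
    filter_upwards [hsum, ae_all_iff.mpr fun i => Lp.coeFn_smul (L (Pi.single i 1)) (X i)]
      with ω h1 h2
    rw [h1, Finset.sum_apply]
    have h3 : (fun i => X i ω) = ∑ i, X i ω • Pi.single i (1 : ℝ) := by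
      ext j; simp [Finset.sum_apply, Pi.single_apply]
    rw [h3, map_sum]
    refine Finset.sum_congr rfl fun i _ => ?_
    rw [h2, Pi.smul_apply, map_smul, smul_eq_mul, smul_eq_mul, mul_comm]
  refine ⟨0, ‖Y‖₊ ^ 2, ?_⟩
  rw [Measure.map_map L.continuous.measurable hm]
  exact (Measure.map_congr hae).trans (hH Y hY)

lemma IsGaussianSpace.isGaussianProcess (hH : IsGaussianSpace H) {ι : Type*}
    {X : ι → Lp ℝ 2 P} (hX : ∀ i, X i ∈ H) : IsGaussianProcess (fun i ω => X i ω) P :=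
  ⟨fun I => hH.hasGaussianLaw (X := fun i : I => X i) fun i => hX i⟩

lemma IsGaussianSpace.integral_eq_zero (hH : IsGaussianSpace H) {X : Lp ℝ 2 P} (hX : X ∈ H) :
    ∫ ω, X ω ∂P = 0 := by
  have h := integral_map (aemeasurable_Lp X) (f := fun x : ℝ => x) (by fun_prop)
  rw [hH X hX] at h
  rw [← h, integral_id_gaussianReal]

/-- Within a Gaussian space, orthogonality is independence; all conditioning below rests on this. -/
lemma IsGaussianSpace.indepFun (hH : IsGaussianSpace H) {ι κ : Type*} {X : ι → Lp ℝ 2 P}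
    {Y : κ → Lp ℝ 2 P} (hX : ∀ i, X i ∈ H) (hY : ∀ j, Y j ∈ H)
    (hXY : ∀ i j, inner ℝ (X i) (Y j) = 0) :
    IndepFun (fun ω i => X i ω) (fun ω j => Y j ω) P := by
  refine IsGaussianProcess.indepFun_of_covariance_eq_zero (X := fun i ω => X i ω)
    (Y := fun j ω => Y j ω) ?_ (fun i => aemeasurable_Lp _) (fun j => aemeasurable_Lp _) ?_
  · have h := hH.isGaussianProcess (X := Sum.elim X Y) (by rintro (i | j) <;> simp [hX, hY])
    convert h using 1
    ext (i | j) <;> rfl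
  · intro i j
    rw [covariance_eq_sub (Lp.memLp _) (Lp.memLp _), hH.integral_eq_zero (hX i), zero_mul, sub_zero,
      ← hXY i j, inner_eq_integral]
    rfl

lemma lintegral_of_indepFun {α β : Type*} [MeasurableSpace α] [MeasurableSpace β] {X : Ω → α}
    {Y : Ω → β} (hX : Measurable X) (hY : Measurable Y) (h : IndepFun X Y P)
    {F : α × β → ℝ≥0∞} (hF : Measurable F) :
    ∫⁻ ω, F (X ω, Y ω) ∂P = ∫⁻ ω, ∫⁻ ω', F (X ω, Y ω') ∂P ∂P := by
  have h1 := (indepFun_iff_map_prod_eq_prod_map_map hX.aemeasurable hY.aemeasurable).mp h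
  calc ∫⁻ ω, F (X ω, Y ω) ∂P = ∫⁻ q, F q ∂(P.map fun ω => (X ω, Y ω)) :=
        (lintegral_map hF (hX.prodMk hY)).symm
    _ = ∫⁻ x, ∫⁻ y, F (x, y) ∂(P.map Y) ∂(P.map X) := by
        have := Measure.isProbabilityMeasure_map (μ := P) hY.aemeasurable
        rw [h1, lintegral_prod _ hF.aemeasurable]
    _ = ∫⁻ ω, ∫⁻ y, F (X ω, y) ∂(P.map Y) ∂P := by
        have := Measure.isProbabilityMeasure_map (μ := P) hY.aemeasurable
        rw [lintegral_map (f := fun x => ∫⁻ y, F (x, y) ∂(P.map Y)) hF.lintegral_prod_right' hX]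
    _ = _ := by
        refine lintegral_congr fun ω => ?_
        rw [lintegral_map (f := fun y => F (X ω, y)) (hF.comp measurable_prodMk_left) hY]

/-! ### Negative moments -/

lemma lintegral_rpow_unit_lt_top :
    ∫⁻ y in Set.Icc (-1 : ℝ) 1, (‖y‖ₑ⁻¹) ^ (1 / 2 : ℝ) < ∞ := by
  have h : IntegrableOn (fun y : ℝ => y ^ (-(1 / 2) : ℝ)) (Set.Ioc 0 1) := by
    have := intervalIntegral.intervalIntegrable_rpow' (a := 0) (b := 1)
      (by norm_num : (-1 : ℝ) < -(1 / 2))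
    rwa [intervalIntegrable_iff_integrableOn_Ioc_of_le zero_le_one] at this
  have h1 : ∫⁻ y in Set.Ioc (0 : ℝ) 1, (‖y‖ₑ⁻¹) ^ (1 / 2 : ℝ) < ∞ := by
    have h2 := h.2
    rw [HasFiniteIntegral] at h2
    refine lt_of_eq_of_lt ?_ h2
    refine setLIntegral_congr_fun measurableSet_Ioc fun y hy => ?_
    have hy0 : 0 < y := hy.1
    have hy1 : 0 ≤ y ^ (-(1 / 2) : ℝ) := by positivity
    rw [Real.enorm_eq_ofReal hy0.le, Real.enorm_eq_ofReal hy1, ← ENNReal.ofReal_rpow_of_pos hy0,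
      ENNReal.rpow_neg, ENNReal.inv_rpow]
  have h2 : ∫⁻ y in Set.Ico (-1 : ℝ) 0, (‖y‖ₑ⁻¹) ^ (1 / 2 : ℝ) =
      ∫⁻ y in Set.Ioc (0 : ℝ) 1, (‖y‖ₑ⁻¹) ^ (1 / 2 : ℝ) := by
    have := (Measure.measurePreserving_neg (volume : Measure ℝ)).setLIntegral_comp_preimage
      (s := Set.Ioc (0 : ℝ) 1) measurableSet_Ioc (f := fun y : ℝ => (‖y‖ₑ⁻¹) ^ (1 / 2 : ℝ))
      (by fun_prop)
    rw [← this]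
    simp
  have h3 : Set.Icc (-1 : ℝ) 1 ⊆ Set.Ico (-1 : ℝ) 0 ∪ (Set.Icc 0 0 ∪ Set.Ioc (0 : ℝ) 1) := by
    intro y hy
    rcases lt_trichotomy y 0 with h | h | h
    · exact Or.inl ⟨hy.1, h⟩
    · exact Or.inr (Or.inl (by simp [h]))
    · exact Or.inr (Or.inr ⟨h, hy.2⟩)
  refine (lintegral_mono_set h3).trans_lt ((lintegral_union_le _ _ _).trans_lt ?_)
  refine ENNReal.add_lt_top.mpr ⟨h2 ▸ h1, (lintegral_union_le _ _ _).trans_lt ?_⟩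
  refine ENNReal.add_lt_top.mpr ⟨?_, h1⟩
  rw [setLIntegral_measure_zero _ _ (by simp)]
  exact ENNReal.zero_lt_top

/-- A bound for the moment of order `-1/2` of a Gaussian variable of variance at least `v₀`. -/
noncomputable def negMomentBound (v₀ : ℝ) : ℝ≥0∞ :=
  1 + ENNReal.ofReal (√(2 * Real.pi * v₀))⁻¹ *
    ∫⁻ y in Set.Icc (-1 : ℝ) 1, (‖y‖ₑ⁻¹) ^ (1 / 2 : ℝ)

lemma negMomentBound_lt_top (v₀ : ℝ) : negMomentBound v₀ < ∞ :=
  ENNReal.add_lt_top.mpr ⟨ENNReal.one_lt_top,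
    ENNReal.mul_lt_top ENNReal.ofReal_lt_top lintegral_rpow_unit_lt_top⟩

/-- Where `|h + x| > 1` the integrand is below `1`. On the rest the density is at most
`(2πv₀)^(-1/2)`, and translation invariance of Lebesgue measure removes the shift `h`. -/
lemma lintegral_gaussianReal_neg_moment_le {v₀ : ℝ} (hv₀ : 0 < v₀) {v : ℝ≥0} (hv : v₀ ≤ v) (h : ℝ) :
    ∫⁻ x, (‖h + x‖ₑ⁻¹) ^ (1 / 2 : ℝ) ∂(gaussianReal 0 v) ≤ negMomentBound v₀ := by
  have hv0 : v ≠ 0 := by rintro rfl; simp at hv; linarith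
  let f : ℝ → ℝ≥0∞ := fun y => (‖y‖ₑ⁻¹) ^ (1 / 2 : ℝ)
  have hf : Measurable f := by fun_prop
  have hle : ∀ x, f (h + x) ≤ 1 + (Set.Icc (-1 : ℝ) 1).indicator f (h + x) := by
    intro x
    by_cases hx : h + x ∈ Set.Icc (-1 : ℝ) 1
    · rw [Set.indicator_of_mem hx]; exact le_add_self
    · rw [Set.indicator_of_notMem hx, add_zero]
      refine ENNReal.rpow_le_one (ENNReal.inv_le_one.mpr ?_) (by norm_num)
      have : 1 ≤ |h + x| := by
        by_contra hlt
        exact hx (Set.mem_Icc.mpr (abs_le.mp (not_le.mp hlt).le))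
      rw [← ofReal_norm, Real.norm_eq_abs]
      exact ENNReal.one_le_ofReal.mpr this
  have hfi : Measurable ((Set.Icc (-1 : ℝ) 1).indicator f) := hf.indicator measurableSet_Icc
  have hfi' : Measurable fun x => (Set.Icc (-1 : ℝ) 1).indicator f (h + x) :=
    hfi.comp (measurable_const_add h)
  calc ∫⁻ x, f (h + x) ∂(gaussianReal 0 v)
      ≤ ∫⁻ x, (1 + (Set.Icc (-1 : ℝ) 1).indicator f (h + x)) ∂(gaussianReal 0 v) :=
        lintegral_mono hle
    _ = 1 + ∫⁻ x, gaussianPDF 0 v x * (Set.Icc (-1 : ℝ) 1).indicator f (h + x) := by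
        rw [lintegral_add_left measurable_const]
        congr 1
        · simp
        · rw [gaussianReal_of_var_ne_zero _ hv0, lintegral_withDensity_eq_lintegral_mul _
            (measurable_gaussianPDF 0 v) hfi']
          rfl
    _ ≤ 1 + ∫⁻ x, ENNReal.ofReal (√(2 * Real.pi * v₀))⁻¹ *
          (Set.Icc (-1 : ℝ) 1).indicator f (h + x) := by
        gcongr with x
        refine ENNReal.ofReal_le_ofReal ?_
        rw [gaussianPDFReal]
        have h1 : Real.exp (-(x - 0) ^ 2 / (2 * v)) ≤ 1 := by
          rw [Real.exp_le_one_iff]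
          exact div_nonpos_of_nonpos_of_nonneg (by nlinarith [sq_nonneg (x - 0)]) (by positivity)
        have h2 : (√(2 * Real.pi * v))⁻¹ ≤ (√(2 * Real.pi * v₀))⁻¹ := by
          have := Real.pi_pos
          gcongr
        calc _ ≤ (√(2 * Real.pi * v))⁻¹ * 1 := by gcongr
          _ ≤ _ := by simpa using h2
    _ = negMomentBound v₀ := by
        rw [lintegral_const_mul _ hfi',
          lintegral_add_left_eq_self (fun x => (Set.Icc (-1 : ℝ) 1).indicator f x) h,
          lintegral_indicator measurableSet_Icc]
        rfl

lemma IsGaussianSpace.lintegral_neg_moment_le (hH : IsGaussianSpace H) {v₀ : ℝ} (hv₀ : 0 < v₀)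
    {X : Lp ℝ 2 P} (hX : X ∈ H) (hv : v₀ ≤ ‖X‖ ^ 2) (h : ℝ) :
    ∫⁻ ω, (‖h + X ω‖ₑ⁻¹) ^ (1 / 2 : ℝ) ∂P ≤ negMomentBound v₀ := by
  have h1 := lintegral_gaussianReal_neg_moment_le hv₀ (v := ‖X‖₊ ^ 2) (by simpa using hv) h
  rw [← hH X hX, lintegral_map (by fun_prop) (measurable_Lp X)] at h1
  exact h1

/-- The last factor is peeled off. Given the earlier `Y b'` and the remainder `Y B - G B`, the
variable `Y B` is a constant plus the independent Gaussian `G B` of variance at least `v₀`, so its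
conditional negative moment has a bound that does not depend on the constant. -/
lemma IsGaussianSpace.lintegral_prod_neg_moment_le (hH : IsGaussianSpace H) {v₀ : ℝ}
    (hv₀ : 0 < v₀) {Y G : ℕ → Lp ℝ 2 P} (hY : ∀ b, Y b ∈ H) (hG : ∀ b, G b ∈ H)
    (hv : ∀ b, v₀ ≤ ‖G b‖ ^ 2) (hself : ∀ b, inner ℝ (Y b - G b) (G b) = 0)
    (hpast : ∀ b, ∀ b' < b, inner ℝ (Y b') (G b) = 0) (B : ℕ) :
    ∫⁻ ω, ∏ b ∈ Finset.range B, (‖Y b ω‖ₑ⁻¹) ^ (1 / 2 : ℝ) ∂P ≤ negMomentBound v₀ ^ B := by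
  induction B with
  | zero => simp
  | succ B ih =>
    -- Everything that is held fixed while integrating over `G B`.
    let X : Fin (B + 1) → Lp ℝ 2 P := fun i => if (i : ℕ) < B then Y i else Y B - G B
    have hX : ∀ i, X i ∈ H := fun i => by
      simp only [X]; split_ifs
      exacts [hY _, H.sub_mem (hY _) (hG _)]
    have hind := hH.indepFun (X := X) (Y := fun _ : Unit => G B) hX (fun _ => hG B) (by
      intro i _
      simp only [X]; split_ifs with h
      exacts [hpast B i h, hself B])
    let F : (Fin (B + 1) → ℝ) × (Unit → ℝ) → ℝ≥0∞ := fun q =>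
      (∏ b : Fin B, (‖q.1 b.castSucc‖ₑ⁻¹) ^ (1 / 2 : ℝ)) *
        (‖q.1 (Fin.last B) + q.2 ()‖ₑ⁻¹) ^ (1 / 2 : ℝ)
    have hF : Measurable F := by fun_prop
    have hXl : X (Fin.last B) = Y B - G B := if_neg (by simp)
    have hXc : ∀ b : Fin B, X b.castSucc = Y b := fun b => if_pos (by simp)
    have h1 : ∀ᵐ ω ∂P, ∏ b ∈ Finset.range (B + 1), (‖Y b ω‖ₑ⁻¹) ^ (1 / 2 : ℝ) =
        F (fun i => X i ω, fun _ => G B ω) := by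
      filter_upwards [Lp.coeFn_sub (Y B) (G B)] with ω hω
      rw [Finset.prod_range_succ, Finset.prod_range]
      simp only [F, hXc]
      rw [hXl, hω, Pi.sub_apply, sub_add_cancel]
    have h2 : ∀ ω ω', F (fun i => X i ω, fun _ => G B ω') =
        (∏ b ∈ Finset.range B, (‖Y b ω‖ₑ⁻¹) ^ (1 / 2 : ℝ)) *
          (‖X (Fin.last B) ω + G B ω'‖ₑ⁻¹) ^ (1 / 2 : ℝ) := by
      intro ω ω'
      rw [Finset.prod_range]
      simp only [F, hXc]
    rw [lintegral_congr_ae h1, lintegral_of_indepFun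
      (measurable_pi_lambda _ fun i => measurable_Lp _)
      (measurable_pi_lambda _ fun i => measurable_Lp _) hind hF]
    calc ∫⁻ ω, ∫⁻ ω', F (fun i => X i ω, fun _ => G B ω') ∂P ∂P
        ≤ ∫⁻ ω, (∏ b ∈ Finset.range B, (‖Y b ω‖ₑ⁻¹) ^ (1 / 2 : ℝ)) * negMomentBound v₀ ∂P := by
          refine lintegral_mono fun ω => ?_
          simp_rw [h2]
          rw [lintegral_const_mul]
          · gcongr
            exact hH.lintegral_neg_moment_le hv₀ (hG B) (hv B) _
          · have := measurable_Lp (G B)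
            fun_prop
      _ ≤ negMomentBound v₀ ^ (B + 1) := by
          have : Measurable fun ω => ∏ b ∈ Finset.range B, (‖Y b ω‖ₑ⁻¹) ^ (1 / 2 : ℝ) := by
            have := fun b => measurable_Lp (Y b)
            fun_prop
          rw [lintegral_mul_const _ this, pow_succ]
          gcongr

/-- Split the power `q` of the inverse sum into `4q` factors of exponent `1/4` and in the `b`-th one
keep only `y b ^ 2`. The resulting singularities `|y|^(-1/2)` are integrable. -/
lemma inv_ofReal_sum_sq_pow_le {q : ℕ} (y : ℕ → ℝ) :
    (ENNReal.ofReal (∑ b ∈ Finset.range (4 * q), y b ^ 2))⁻¹ ^ q ≤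
      ∏ b ∈ Finset.range (4 * q), (‖y b‖ₑ⁻¹) ^ (1 / 2 : ℝ) := by
  set S := ENNReal.ofReal (∑ b ∈ Finset.range (4 * q), y b ^ 2) with hS
  have h1 : ∀ b ∈ Finset.range (4 * q), (S⁻¹) ^ (1 / 4 : ℝ) ≤ (‖y b‖ₑ⁻¹) ^ (1 / 2 : ℝ) := by
    intro b hb
    have h2 : ‖y b‖ₑ ^ 2 ≤ S := by
      rw [← ofReal_norm, ← ENNReal.ofReal_pow (norm_nonneg _), Real.norm_eq_abs, sq_abs]
      exact ENNReal.ofReal_le_ofReal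
        (Finset.single_le_sum (f := fun b => y b ^ 2) (fun i _ => sq_nonneg _) hb)
    have h3 : (‖y b‖ₑ⁻¹) ^ (1 / 2 : ℝ) = ((‖y b‖ₑ ^ 2)⁻¹) ^ (1 / 4 : ℝ) := by
      rw [ENNReal.inv_rpow, ENNReal.inv_rpow, ← ENNReal.rpow_natCast, ← ENNReal.rpow_mul]
      norm_num
    rw [h3]
    gcongr
  calc S⁻¹ ^ q = ∏ b ∈ Finset.range (4 * q), (S⁻¹) ^ (1 / 4 : ℝ) := by
        rw [Finset.prod_const, Finset.card_range, ← ENNReal.rpow_natCast, ← ENNReal.rpow_natCast,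
          ← ENNReal.rpow_mul]
        congr 1
        push_cast; ring
    _ ≤ _ := Finset.prod_le_prod' h1

/-- Jensen's inequality for `x ↦ x⁻¹ ^ q`. -/
lemma inv_ofReal_mean_pow_le {ι : Type*} (s : Finset ι) (hs : s.Nonempty) {x : ι → ℝ}
    (hx : ∀ i ∈ s, 0 ≤ x i) (q : ℕ) :
    (ENNReal.ofReal ((∑ i ∈ s, x i) / s.card))⁻¹ ^ q ≤
      (s.card : ℝ≥0∞)⁻¹ * ∑ i ∈ s, (ENNReal.ofReal (x i))⁻¹ ^ q := by
  have hc : 0 < (s.card : ℝ) := by exact_mod_cast hs.card_pos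
  rcases Nat.eq_zero_or_pos q with rfl | hq
  · simp only [pow_zero, Finset.sum_const, nsmul_eq_mul, mul_one]
    rw [ENNReal.inv_mul_cancel (by exact_mod_cast hs.card_pos.ne') (by simp)]
  -- A vanishing term makes the right side infinite; otherwise convexity of `x ↦ x^(-q)` on the
  -- positive reals applies.
  by_cases h0 : ∃ i ∈ s, x i = 0
  · obtain ⟨i, hi, h⟩ := h0
    have h1 : ∑ i ∈ s, (ENNReal.ofReal (x i))⁻¹ ^ q = ∞ := by
      rw [ENNReal.sum_eq_top]
      exact ⟨i, hi, by simp [h, hq.ne']⟩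
    rw [h1, ENNReal.mul_top]
    · exact le_top
    · simp
  · push Not at h0
    have hpos : ∀ i ∈ s, 0 < x i := fun i hi => lt_of_le_of_ne (hx i hi) (h0 i hi).symm
    have hmean : 0 < (∑ i ∈ s, x i) / s.card := div_pos (Finset.sum_pos hpos hs) hc
    have key : ((∑ i ∈ s, x i) / s.card)⁻¹ ^ q ≤ (s.card : ℝ)⁻¹ * ∑ i ∈ s, (x i)⁻¹ ^ q := by
      have h := (convexOn_zpow (𝕜 := ℝ) (-(q : ℤ))).map_sum_le (t := s)
        (w := fun _ => (s.card : ℝ)⁻¹) (p := x) (fun i _ => by positivity)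
        (by rw [Finset.sum_const, nsmul_eq_mul, mul_inv_cancel₀ hc.ne']) hpos
      simp only [smul_eq_mul, zpow_neg, zpow_natCast, ← Finset.mul_sum] at h
      simp only [inv_pow]
      rwa [div_eq_inv_mul]
    have e1 : ∀ y : ℝ, 0 < y → (ENNReal.ofReal y)⁻¹ ^ q = ENNReal.ofReal (y⁻¹ ^ q) := fun y hy => by
      rw [← ENNReal.ofReal_inv_of_pos hy, ENNReal.ofReal_pow (by positivity)]
    rw [e1 _ hmean, Finset.sum_congr rfl fun i hi => e1 _ (hpos i hi),
      ← ENNReal.ofReal_sum_of_nonneg fun i hi => by have := hpos i hi; positivity,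
      show (s.card : ℝ≥0∞) = ENNReal.ofReal s.card by simp, ← ENNReal.ofReal_inv_of_pos hc,
      ← ENNReal.ofReal_mul (by positivity)]
    exact ENNReal.ofReal_le_ofReal key

end GaussianSpace


/-! ### Least squares for Gaussian autoregressions -/

section Autoregression

set_option linter.unusedSectionVars false

open scoped ENNReal NNReal

/-- The quadratic form of the normal equations of a vector autoregression. -/
noncomputable def quadForm {n p : ℕ} (x : Fin n → ℤ → ℝ) (N : ℕ) (u : Fin p → ℝ) : ℝ :=
  ∑ t ∈ Finset.Icc 1 N, ∑ m, (∑ j : Fin p, u j * x m ((t : ℤ) + p - ((j : ℤ) + 1))) ^ 2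

/-- The trace of the quadratic form of the normal equations. -/
noncomputable def energy {n : ℕ} (p : ℕ) (x : Fin n → ℤ → ℝ) (N : ℕ) : ℝ :=
  ∑ t ∈ Finset.Icc 1 N, ∑ m, ∑ j : Fin p, x m ((t : ℤ) + p - ((j : ℤ) + 1)) ^ 2

/-- The cross products of the regressors with the noise. -/
noncomputable def crossVec {n p : ℕ} (x y : Fin n → ℤ → ℝ) (N : ℕ) (j : Fin p) : ℝ :=
  ∑ t ∈ Finset.Icc 1 N, ∑ m, y m ((t : ℤ) + p) * x m ((t : ℤ) + p - ((j : ℤ) + 1))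

variable {Ω : Type*} [MeasurableSpace Ω] {P : Measure Ω} [IsProbabilityMeasure P]

/-- `n` Gaussian sequences `a m`, which are moving averages with coefficients `ψ` of orthonormal
sequences `z m`, where `ψ` is the impulse response of the autoregression with coefficients `φ`. -/
structure IsARFamily (H : Submodule ℝ (Lp ℝ 2 P)) {n p : ℕ} (φ : Fin p → ℝ) (ψ : ℤ → ℝ) (K₀ : ℝ)
    (a z : Fin n → ℤ → Lp ℝ 2 P) : Prop where
  gaussian : IsGaussianSpace H
  a_mem : ∀ m s, a m s ∈ H
  z_mem : ∀ m s, z m s ∈ H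
  inner_z : ∀ m m' s s', inner ℝ (z m s) (z m' s') = if m = m' ∧ s = s' then 1 else 0
  inner_az : ∀ m m' s s', inner ℝ (a m s) (z m' s') = if m = m' then ψ (s - s') else 0
  psi_neg : ∀ k < 0, ψ k = 0
  psi_rec : ∀ k, ψ k = (if k = 0 then 1 else 0) + ∑ j : Fin p, φ j * ψ (k - ((j : ℤ) + 1))
  norm_a : ∀ m s, ‖a m s‖ ^ 2 ≤ K₀
  phi_le : ∑ j, |φ j| ≤ K₀

variable {H : Submodule ℝ (Lp ℝ 2 P)} {n p : ℕ} {φ : Fin p → ℝ} {ψ : ℤ → ℝ} {K₀ : ℝ}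
  {a z : Fin n → ℤ → Lp ℝ 2 P}

/-- Convolution with `ψ` inverts the autoregressive filter, so `u` is recovered from `w = u * ψ` by
`u r = w r - ∑ φ_j w(r-j-1)`, which involves `w` only at indices below `p`. If all these values were
below `‖u‖/(1+K₀)`, then `‖u‖ < ‖u‖`. The value `w r` is the coefficient of an innovation in a
combination of `p` consecutive terms. -/
lemma exists_innovation_coeff_ge (hp : 0 < p) (hneg : ∀ k < 0, ψ k = 0)
    (hrec : ∀ k, ψ k = (if k = 0 then 1 else 0) + ∑ j : Fin p, φ j * ψ (k - ((j : ℤ) + 1)))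
    (hφ : ∑ j, |φ j| ≤ K₀) (u : Fin p → ℝ) :
    ∃ r : Fin p, ‖u‖ / (1 + K₀) ≤ |∑ i : Fin p, u i * ψ ((r : ℤ) - i)| := by
  have hK : 0 ≤ K₀ := (Finset.sum_nonneg fun j _ => abs_nonneg _).trans hφ
  have : Nonempty (Fin p) := ⟨⟨0, hp⟩⟩
  set w : ℤ → ℝ := fun k => ∑ i : Fin p, u i * ψ (k - i) with hw
  by_contra hcon
  push Not at hcon
  have hc : 0 < ‖u‖ / (1 + K₀) := (abs_nonneg _).trans_lt (hcon (Classical.arbitrary _))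
  have hwneg : ∀ k < 0, w k = 0 := fun k hk =>
    Finset.sum_eq_zero fun i _ => by rw [hneg _ (by omega), mul_zero]
  have hwlt : ∀ k < (p : ℤ), |w k| < ‖u‖ / (1 + K₀) := by
    intro k hk
    rcases lt_or_ge k 0 with h | h
    · rw [hwneg k h, abs_zero]; exact hc
    · lift k to ℕ using h
      exact hcon ⟨k, by exact_mod_cast hk⟩
  have hwrec : ∀ r : Fin p, u r = w r - ∑ j : Fin p, φ j * w (r - ((j : ℤ) + 1)) := by
    intro r
    have h1 : w r = ∑ i : Fin p, (u i * (if r = i then 1 else 0) +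
        ∑ j : Fin p, φ j * (u i * ψ ((r : ℤ) - ((j : ℤ) + 1) - i))) := by
      simp only [hw]
      refine Finset.sum_congr rfl fun i _ => ?_
      rw [hrec, mul_add, Finset.mul_sum]
      congr 1
      · congr 1
        refine if_congr ?_ rfl rfl
        rw [sub_eq_zero, Fin.ext_iff]; norm_cast
      · refine Finset.sum_congr rfl fun j _ => ?_
        rw [show (r : ℤ) - i - (j + 1) = r - (j + 1) - i by ring]; ring
    rw [h1, Finset.sum_add_distrib, Finset.sum_comm (γ := Fin p)]
    simp only [hw, Finset.mul_sum]
    simp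
  have hlt : ∀ r, ‖u r‖ < ‖u‖ := by
    intro r
    rw [Real.norm_eq_abs, hwrec r]
    calc _ ≤ |w r| + |∑ j : Fin p, φ j * w (r - ((j : ℤ) + 1))| := abs_sub _ _
      _ ≤ |w r| + ∑ j : Fin p, |φ j| * (‖u‖ / (1 + K₀)) := by
          gcongr
          refine (Finset.abs_sum_le_sum_abs _ _).trans (Finset.sum_le_sum fun j _ => ?_)
          rw [abs_mul]
          gcongr
          exact (hwlt _ (by omega)).le
      _ < ‖u‖ / (1 + K₀) + K₀ * (‖u‖ / (1 + K₀)) := by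
          rw [← Finset.sum_mul]
          exact add_lt_add_of_lt_of_le (hwlt _ (by omega)) (by gcongr)
      _ = ‖u‖ := by field_simp
  have hpos : 0 < ‖u‖ := (norm_nonneg _).trans_lt (hlt (Classical.arbitrary _))
  exact lt_irrefl _ ((pi_norm_lt_iff hpos).mpr hlt)

/-- Consecutive combinations are `p` steps apart. Since `r < p`, the selected innovation of block
`b` is later than every variable of the blocks before it, hence orthogonal to them. -/
lemma IsARFamily.lintegral_inv_blocks_le (h : IsARFamily H φ ψ K₀ a z) (hp : 0 < p)
    {u : Fin p → ℝ} (hu : 1 / 2 ≤ ‖u‖) (m : Fin n) (s : ℤ) (q : ℕ) :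
    ∫⁻ ω, (ENNReal.ofReal (∑ b ∈ Finset.range (4 * q),
      (∑ j : Fin p, u j * a m (s + b * p - ((j : ℤ) + 1)) ω) ^ 2))⁻¹ ^ q ∂P ≤
      negMomentBound ((1 / 2 / (1 + K₀)) ^ 2) ^ (4 * q) := by
  have hK : 0 ≤ K₀ := (Finset.sum_nonneg fun j _ => abs_nonneg _).trans h.phi_le
  obtain ⟨r, hr⟩ := exists_innovation_coeff_ge hp h.psi_neg h.psi_rec h.phi_le u
  set w := ∑ i : Fin p, u i * ψ ((r : ℤ) - i) with hw
  let Y : ℕ → Lp ℝ 2 P := fun b => ∑ j : Fin p, u j • a m (s + b * p - ((j : ℤ) + 1))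
  -- The part of `Y b` carried by the innovation with the large coefficient; the remainder is
  -- orthogonal to it.
  let G : ℕ → Lp ℝ 2 P := fun b => w • z m (s + b * p - ((r : ℤ) + 1))
  have hYz : ∀ b s', inner ℝ (Y b) (z m s') =
      ∑ j : Fin p, u j * ψ (s + b * p - ((j : ℤ) + 1) - s') := by
    intro b s'
    simp only [Y, sum_inner, real_inner_smul_left, h.inner_az, if_true]
  have hGG : ∀ b, inner ℝ (G b) (G b) = w ^ 2 := by
    intro b
    simp only [G, real_inner_smul_left, real_inner_smul_right, h.inner_z]
    simp; ring
  have key := h.gaussian.lintegral_prod_neg_moment_le (v₀ := (1 / 2 / (1 + K₀)) ^ 2)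
    (by positivity) (Y := Y) (G := G)
    (fun b => Submodule.sum_mem _ fun j _ => H.smul_mem _ (h.a_mem _ _))
    (fun b => H.smul_mem _ (h.z_mem _ _)) ?_ ?_ ?_ (4 * q)
  · refine le_trans (lintegral_mono_ae ?_) key
    have h1 : ∀ b : ℕ, ∀ᵐ ω ∂P, Y b ω =
        ∑ j : Fin p, u j * a m (s + b * p - ((j : ℤ) + 1)) ω := by
      intro b
      have hsum : (Y b : Ω → ℝ) =ᵐ[P]
          ∑ j : Fin p, (u j • a m (s + b * p - ((j : ℤ) + 1)) : Lp ℝ 2 P) :=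
        Lp.coeFn_finsetSum _ _
      filter_upwards [hsum, ae_all_iff.mpr fun j : Fin p =>
        Lp.coeFn_smul (u j) (a m (s + b * p - ((j : ℤ) + 1)))] with ω h1 h2
      rw [h1, Finset.sum_apply]
      exact Finset.sum_congr rfl fun j _ => by rw [h2, Pi.smul_apply, smul_eq_mul]
    filter_upwards [ae_all_iff.mpr h1] with ω hω
    simp_rw [← hω]
    exact inv_ofReal_sum_sq_pow_le fun b => Y b ω
  · intro b
    rw [← real_inner_self_eq_norm_sq, hGG, ← sq_abs w]
    gcongr
    refine le_trans ?_ hr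
    gcongr
  · intro b
    rw [inner_sub_left, hGG]
    simp only [G, real_inner_smul_right]
    rw [hYz]
    have : ∀ j : Fin p, s + b * p - ((j : ℤ) + 1) - (s + b * p - ((r : ℤ) + 1)) = r - j :=
      fun j => by ring
    simp_rw [this]
    rw [← hw]; ring
  · intro b b' hb
    simp only [G, real_inner_smul_right]
    rw [hYz]
    rw [Finset.sum_eq_zero, mul_zero]
    intro j _
    rw [h.psi_neg, mul_zero]
    have h1 : ((b' : ℤ) + 1) * p ≤ b * p := by gcongr; exact_mod_cast hb
    have h2 := r.2
    have : (r : ℤ) < p := by exact_mod_cast h2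
    have : (0 : ℤ) ≤ j := by positivity
    linarith

/-- The negative moments of the normalised quadratic form are bounded, uniformly in the number of
sequences and in the sample size. -/
lemma IsARFamily.lintegral_inv_quadForm_le (h : IsARFamily H φ ψ K₀ a z) (hp : 0 < p)
    (hn : 0 < n) {q N : ℕ} (hq : 0 < q) (hN : p * (4 * q) ≤ N) {u : Fin p → ℝ} (hu : 1 / 2 ≤ ‖u‖) :
    ∫⁻ ω, (ENNReal.ofReal (quadForm (fun m s => a m s ω) N u / (n * N)))⁻¹ ^ q ∂P ≤
      ENNReal.ofReal (2 * (p * (4 * q))) ^ q *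
        negMomentBound ((1 / 2 / (1 + K₀)) ^ 2) ^ (4 * q) := by
  set B := 4 * q with hB
  have hpB : 0 < p * B := by positivity
  -- The sample contains `g` groups of `B` disjoint blocks of length `p`. As `g ≥ 1`, dropping the
  -- leftover times costs at most a factor `2`.
  set g := N / (p * B) with hg
  have hg1 : 0 < g := Nat.div_pos hN hpB
  have hgN : g * (p * B) ≤ N := Nat.div_mul_le_self _ _
  have hNg : (N : ℝ) ≤ 2 * (p * B) * g := by
    have h1 := Nat.lt_div_mul_add hpB (a := N)
    rw [← hg] at h1
    have h2 : p * B ≤ g * (p * B) := Nat.le_mul_of_pos_left _ hg1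
    have : N ≤ 2 * (p * B) * g := by nlinarith
    exact_mod_cast this
  have hn' : (0 : ℝ) < n := by exact_mod_cast hn
  have hN' : (0 : ℝ) < N := by exact_mod_cast hpB.trans_le hN
  have hg' : (0 : ℝ) < g := by exact_mod_cast hg1
  let s : ℕ → ℤ := fun γ => 1 + γ * B * p + p
  let x : Ω → Fin n × ℕ → ℝ := fun ω i => ∑ b ∈ Finset.range B,
      (∑ j : Fin p, u j * a i.1 (s i.2 + b * p - ((j : ℤ) + 1)) ω) ^ 2
  have hx0 : ∀ ω i, 0 ≤ x ω i := fun ω i => Finset.sum_nonneg fun _ _ => sq_nonneg _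
  let S : Finset (Fin n × ℕ) := Finset.univ ×ˢ Finset.range g
  have hcard : (S.card : ℝ) = n * g := by simp [S]
  have hSne : S.Nonempty := by
    rw [← Finset.card_pos]; simp only [S, Finset.card_product, Finset.card_univ, Fintype.card_fin,
      Finset.card_range]; positivity
  -- Only the times `t = 1 + (γB + b)p` are kept, at which the sets of regressors do not overlap;
  -- the omitted terms are squares.
  have hle : ∀ ω, ∑ i ∈ S, x ω i ≤ quadForm (fun m s => a m s ω) N u := by
    intro ω
    have hinj : Set.InjOn (fun i : ℕ × ℕ => 1 + (i.1 * B + i.2) * p)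
        (Finset.range g ×ˢ Finset.range B : Finset (ℕ × ℕ)) := by
      rintro ⟨i, j⟩ hij ⟨i', j'⟩ hij' heq
      simp only [Finset.coe_product, Finset.coe_range, Set.mem_prod, Set.mem_Iio] at hij hij'
      have h1 : i * B + j = i' * B + j' :=
        Nat.eq_of_mul_eq_mul_right hp (Nat.add_left_cancel heq)
      have hBpos : 0 < B := by omega
      have h2 : i = i' := by
        have := congrArg (· / B) h1
        simpa [Nat.mul_comm _ B, Nat.mul_add_div hBpos, Nat.div_eq_of_lt hij.2,
          Nat.div_eq_of_lt hij'.2] using this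
      subst h2
      simp at h1
      simp [h1]
    have hsub : (Finset.range g ×ˢ Finset.range B).image
        (fun i : ℕ × ℕ => 1 + (i.1 * B + i.2) * p) ⊆ Finset.Icc 1 N := by
      intro t ht
      simp only [Finset.mem_image, Finset.mem_product, Finset.mem_range] at ht
      obtain ⟨⟨i, j⟩, ⟨hi, hj⟩, rfl⟩ := ht
      simp only [Finset.mem_Icc]
      refine ⟨by omega, ?_⟩
      have h1 : (i * B + j + 1) ≤ g * B := by nlinarith
      have h2 : (i * B + j + 1) * p ≤ g * B * p := Nat.mul_le_mul_right p h1
      nlinarith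
    calc ∑ i ∈ S, x ω i = ∑ i ∈ Finset.range g ×ˢ Finset.range B, ∑ m,
          (∑ j : Fin p, u j * a m (((1 + (i.1 * B + i.2) * p : ℕ) : ℤ) + p - ((j : ℤ) + 1)) ω) ^ 2
            := by
          simp only [S, x]
          rw [Finset.sum_product, Finset.sum_product, Finset.sum_comm]
          refine Finset.sum_congr rfl fun γ _ => ?_
          rw [Finset.sum_comm]
          refine Finset.sum_congr rfl fun b _ => Finset.sum_congr rfl fun m _ => ?_
          congr 1
          refine Finset.sum_congr rfl fun j _ => ?_
          rw [show s γ + b * p - ((j : ℤ) + 1) =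
            ((1 + (γ * B + b) * p : ℕ) : ℤ) + p - ((j : ℤ) + 1) by simp only [s]; push_cast; ring]
      _ = ∑ t ∈ (Finset.range g ×ˢ Finset.range B).image
          (fun i : ℕ × ℕ => 1 + (i.1 * B + i.2) * p), ∑ m,
          (∑ j : Fin p, u j * a m ((t : ℤ) + p - ((j : ℤ) + 1)) ω) ^ 2 := by
          rw [Finset.sum_image hinj]
      _ ≤ _ := Finset.sum_le_sum_of_subset_of_nonneg hsub
          fun t _ _ => Finset.sum_nonneg fun m _ => sq_nonneg _
  have hpt : ∀ ω, (ENNReal.ofReal (quadForm (fun m s => a m s ω) N u / (n * N)))⁻¹ ^ q ≤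
      ENNReal.ofReal (2 * (p * B)) ^ q *
        ((S.card : ℝ≥0∞)⁻¹ * ∑ i ∈ S, (ENNReal.ofReal (x ω i))⁻¹ ^ q) := by
    intro ω
    refine le_trans ?_ (mul_le_mul_right (inv_ofReal_mean_pow_le S hSne (fun i _ => hx0 ω i) q) _)
    rw [← mul_pow]
    gcongr
    have hc : (0 : ℝ) < 2 * (p * B) := by exact_mod_cast (by omega : 0 < 2 * (p * B))
    have h1 : (∑ i ∈ S, x ω i) / S.card ≤
        (2 * (p * B)) * (quadForm (fun m s => a m s ω) N u / (n * N)) := by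
      have h0 : 0 ≤ ∑ i ∈ S, x ω i := Finset.sum_nonneg fun i _ => hx0 ω i
      rw [hcard, div_le_iff₀ (by positivity), mul_div_assoc', div_mul_eq_mul_div,
        le_div_iff₀ (by positivity)]
      calc (∑ i ∈ S, x ω i) * (n * N) ≤ quadForm (fun m s => a m s ω) N u *
            (n * (2 * (p * B) * g)) := by
            gcongr
            · exact h0.trans (hle ω)
            · exact hle ω
        _ = _ := by ring
    have h2 := ENNReal.ofReal_le_ofReal h1
    rw [ENNReal.ofReal_mul hc.le] at h2
    have hc0 : ENNReal.ofReal (2 * (p * B)) ≠ 0 := (ENNReal.ofReal_pos.mpr hc).ne'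
    refine le_trans ?_ (mul_le_mul_right (ENNReal.inv_le_inv.mpr h2) _)
    rw [ENNReal.mul_inv (Or.inl hc0) (Or.inl ENNReal.ofReal_ne_top), ← mul_assoc,
      ENNReal.mul_inv_cancel hc0 ENNReal.ofReal_ne_top, one_mul]
  have hxm : ∀ i, Measurable fun ω => (ENNReal.ofReal (x ω i))⁻¹ ^ q := by
    intro i
    have := fun s => measurable_Lp (a i.1 s)
    fun_prop
  have hcardE : (S.card : ℝ≥0∞) ≠ 0 := by exact_mod_cast hSne.card_pos.ne'
  calc _ ≤ ∫⁻ ω, ENNReal.ofReal (2 * (p * B)) ^ q *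
        ((S.card : ℝ≥0∞)⁻¹ * ∑ i ∈ S, (ENNReal.ofReal (x ω i))⁻¹ ^ q) ∂P := lintegral_mono hpt
    _ = ENNReal.ofReal (2 * (p * B)) ^ q * ((S.card : ℝ≥0∞)⁻¹ *
        ∑ i ∈ S, ∫⁻ ω, (ENNReal.ofReal (x ω i))⁻¹ ^ q ∂P) := by
        rw [lintegral_const_mul, lintegral_const_mul, lintegral_finsetSum _ fun i _ => hxm i] <;>
        fun_prop
    _ ≤ ENNReal.ofReal (2 * (p * B)) ^ q * ((S.card : ℝ≥0∞)⁻¹ *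
        ∑ i ∈ S, negMomentBound ((1 / 2 / (1 + K₀)) ^ 2) ^ B) := by
        gcongr with i
        exact h.lintegral_inv_blocks_le hp hu i.1 (s i.2) q
    _ = _ := by
        rw [Finset.sum_const, nsmul_eq_mul, ← mul_assoc (S.card : ℝ≥0∞)⁻¹,
          ENNReal.inv_mul_cancel hcardE (by simp), one_mul]
        simp [hB]

end Autoregression


/-! ### Moments of the cross products and of the trace -/

section Moments

set_option linter.unusedSectionVars false

open scoped ENNReal NNReal

variable {Ω : Type*} [MeasurableSpace Ω] {P : Measure Ω} [IsProbabilityMeasure P]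

/-- The absolute moments of the standard Gaussian distribution. -/
noncomputable def gaussMoment (k : ℕ) : ℝ≥0∞ := ∫⁻ x, ‖x‖ₑ ^ k ∂(gaussianReal 0 1)

lemma gaussMoment_lt_top (k : ℕ) : gaussMoment k < ∞ := by
  rcases Nat.eq_zero_or_pos k with rfl | hk
  · simp [gaussMoment]
  · have h := (memLp_id_gaussianReal (μ := 0) (v := 1) k).eLpNorm_lt_top
    rw [eLpNorm_lt_top_iff_lintegral_rpow_enorm_lt_top (by exact_mod_cast hk.ne') (by simp)] at h
    simpa [gaussMoment] using h

variable {H : Submodule ℝ (Lp ℝ 2 P)} {n p : ℕ} {φ : Fin p → ℝ} {ψ : ℤ → ℝ} {K₀ : ℝ}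
  {a z : Fin n → ℤ → Lp ℝ 2 P}

lemma IsGaussianSpace.lintegral_enorm_pow (hH : IsGaussianSpace H) {X : Lp ℝ 2 P} (hX : X ∈ H)
    (k : ℕ) : ∫⁻ ω, ‖X ω‖ₑ ^ k ∂P = ‖X‖ₑ ^ k * gaussMoment k := by
  have h1 : P.map X = (gaussianReal 0 1).map (‖X‖ * ·) := by
    rw [hH X hX, gaussianReal_map_const_mul]
    congr 1
    · simp
    · ext; simp
  calc ∫⁻ ω, ‖X ω‖ₑ ^ k ∂P = ∫⁻ x, ‖x‖ₑ ^ k ∂(P.map X) := by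
        rw [lintegral_map (by fun_prop) (measurable_Lp X)]
    _ = ∫⁻ x, ‖X‖ₑ ^ k * ‖x‖ₑ ^ k ∂(gaussianReal 0 1) := by
        rw [h1, lintegral_map (by fun_prop) (by fun_prop)]
        refine lintegral_congr fun x => ?_
        rw [enorm_mul, mul_pow, enorm_norm]
    _ = _ := by rw [lintegral_const_mul _ (by fun_prop), gaussMoment]

lemma lintegral_mul_le_sqrt {α : Type*} [MeasurableSpace α] {μ : Measure α} {f g : α → ℝ≥0∞}
    (hf : AEMeasurable f μ) (hg : AEMeasurable g μ) :
    ∫⁻ x, f x * g x ∂μ ≤ (∫⁻ x, f x ^ 2 ∂μ) ^ (1 / 2 : ℝ) * (∫⁻ x, g x ^ 2 ∂μ) ^ (1 / 2 : ℝ) := by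
  have h := ENNReal.lintegral_mul_le_Lp_mul_Lq μ (Real.HolderConjugate.two_two) hf hg
  simpa using h

/-- Symmetrising in `y` removes the odd powers, so that the expansion has nonnegative terms and
makes sense in `ℝ≥0∞`. -/
lemma enorm_add_pow_four_add (c y : ℝ) : ‖c + y‖ₑ ^ 4 + ‖c + -y‖ₑ ^ 4 =
    2 * (‖c‖ₑ ^ 4 + 6 * (‖c‖ₑ ^ 2 * ‖y‖ₑ ^ 2) + ‖y‖ₑ ^ 4) := by
  have e : ∀ x : ℝ, ‖x‖ₑ ^ 4 = ENNReal.ofReal (x ^ 4) := fun x => by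
    rw [← ofReal_norm, ← ENNReal.ofReal_pow (norm_nonneg _), Real.norm_eq_abs,
      Even.pow_abs (by decide)]
  have e2 : ∀ x : ℝ, ‖x‖ₑ ^ 2 = ENNReal.ofReal (x ^ 2) := fun x => by
    rw [← ofReal_norm, ← ENNReal.ofReal_pow (norm_nonneg _), Real.norm_eq_abs, sq_abs]
  have e3 : (6 : ℝ≥0∞) = ENNReal.ofReal 6 := by simp
  have e4 : (2 : ℝ≥0∞) = ENNReal.ofReal 2 := by simp
  rw [e, e, e, e, e2, e2, e3, e4, ← ENNReal.ofReal_mul (by positivity),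
    ← ENNReal.ofReal_mul (by positivity), ← ENNReal.ofReal_add (by positivity) (by positivity),
    ← ENNReal.ofReal_add (by positivity) (by positivity),
    ← ENNReal.ofReal_add (by positivity) (by positivity), ← ENNReal.ofReal_mul (by positivity)]
  congr 1; ring

lemma IsGaussianSpace.lintegral_add_pow_four (hH : IsGaussianSpace H) {Y : Lp ℝ 2 P} (hY : Y ∈ H)
    (c : ℝ) : ∫⁻ ω, ‖c + Y ω‖ₑ ^ 4 ∂P = ‖c‖ₑ ^ 4 + 6 * gaussMoment 2 * (‖c‖ₑ ^ 2 * ‖Y‖ₑ ^ 2) +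
      gaussMoment 4 * ‖Y‖ₑ ^ 4 := by
  have hYm := measurable_Lp Y
  have hsymm : ∫⁻ ω, ‖c + -Y ω‖ₑ ^ 4 ∂P = ∫⁻ ω, ‖c + Y ω‖ₑ ^ 4 ∂P := by
    have h1 : ∫⁻ ω, ‖c + -Y ω‖ₑ ^ 4 ∂P = ∫⁻ x, ‖c + -x‖ₑ ^ 4 ∂(P.map Y) := by
      rw [lintegral_map (by fun_prop) hYm]
    have h2 : ∫⁻ ω, ‖c + Y ω‖ₑ ^ 4 ∂P = ∫⁻ x, ‖c + x‖ₑ ^ 4 ∂(P.map Y) := by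
      rw [lintegral_map (by fun_prop) hYm]
    rw [h1, h2, hH Y hY]
    conv_rhs => rw [← neg_zero, ← gaussianReal_map_neg, lintegral_map (by fun_prop) (by fun_prop)]
  have h2 : (2 : ℝ≥0∞) * ∫⁻ ω, ‖c + Y ω‖ₑ ^ 4 ∂P = 2 * (‖c‖ₑ ^ 4 +
      6 * gaussMoment 2 * (‖c‖ₑ ^ 2 * ‖Y‖ₑ ^ 2) + gaussMoment 4 * ‖Y‖ₑ ^ 4) := by
    calc (2 : ℝ≥0∞) * ∫⁻ ω, ‖c + Y ω‖ₑ ^ 4 ∂P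
        = ∫⁻ ω, ‖c + Y ω‖ₑ ^ 4 ∂P + ∫⁻ ω, ‖c + -Y ω‖ₑ ^ 4 ∂P := by rw [hsymm, two_mul]
      _ = ∫⁻ ω, 2 * (‖c‖ₑ ^ 4 + 6 * (‖c‖ₑ ^ 2 * ‖Y ω‖ₑ ^ 2) + ‖Y ω‖ₑ ^ 4) ∂P := by
          rw [← lintegral_add_left (by fun_prop)]
          exact lintegral_congr fun ω => enorm_add_pow_four_add c (Y ω)
      _ = 2 * (‖c‖ₑ ^ 4 + 6 * (‖c‖ₑ ^ 2 * (‖Y‖ₑ ^ 2 * gaussMoment 2)) +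
          ‖Y‖ₑ ^ 4 * gaussMoment 4) := by
          rw [lintegral_const_mul _ (by fun_prop), lintegral_add_left (by fun_prop),
            lintegral_add_left (by fun_prop), lintegral_const_mul _ (by fun_prop),
            lintegral_const_mul _ (by fun_prop), hH.lintegral_enorm_pow hY,
            hH.lintegral_enorm_pow hY]
          simp
      _ = _ := by ring
  exact (ENNReal.mul_right_inj two_ne_zero ENNReal.ofNat_ne_top).mp h2

/-- The growth constant of the fourth moments of the cross products. -/
noncomputable def crossBound (K₀ : ℝ) : ℝ≥0∞ :=
  (1 + 3 * gaussMoment 2) * (1 + gaussMoment 4) * (ENNReal.ofReal K₀ * (1 + gaussMoment 4))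

lemma crossBound_lt_top (K₀ : ℝ) : crossBound K₀ < ∞ := by
  have h2 := gaussMoment_lt_top 2
  have h4 := gaussMoment_lt_top 4
  unfold crossBound
  finiteness

lemma IsARFamily.enorm_a_pow_four_le (h : IsARFamily H φ ψ K₀ a z) (m : Fin n) (s : ℤ) :
    ‖a m s‖ₑ ^ 2 ≤ ENNReal.ofReal K₀ := by
  rw [← ofReal_norm, ← ENNReal.ofReal_pow (norm_nonneg _)]
  exact ENNReal.ofReal_le_ofReal (h.norm_a m s)

lemma IsARFamily.lintegral_a_pow_le (h : IsARFamily H φ ψ K₀ a z) (m : Fin n) (s : ℤ) (k : ℕ) :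
    ∫⁻ ω, ‖a m s ω‖ₑ ^ (2 * k) ∂P ≤ ENNReal.ofReal K₀ ^ k * gaussMoment (2 * k) := by
  rw [h.gaussian.lintegral_enorm_pow (h.a_mem m s), pow_mul]
  gcongr
  exact h.enorm_a_pow_four_le m s

lemma enorm_sq_eq (x : ℝ) : ‖x‖ₑ ^ 2 = ENNReal.ofReal (x ^ 2) := by
  rw [← ofReal_norm, ← ENNReal.ofReal_pow (norm_nonneg _), Real.norm_eq_abs, sq_abs]

lemma sum_sq_le_card_mul {ι : Type*} (s : Finset ι) (f : ι → ℝ≥0∞) :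
    (∑ i ∈ s, f i) ^ 2 ≤ s.card * ∑ i ∈ s, f i ^ 2 := by
  have h := ENNReal.inner_le_Lp_mul_Lq s (fun _ => 1) f Real.HolderConjugate.two_two
  have h2 := pow_le_pow_left₀ (zero_le) h 2
  rw [mul_pow, ← ENNReal.rpow_natCast, ← ENNReal.rpow_natCast, ← ENNReal.rpow_natCast,
    ← ENNReal.rpow_mul, ← ENNReal.rpow_mul] at h2
  simpa using h2

/-- Induction on `N`. Given the past, the new increment is centred Gaussian with variance `A = ∑
a_m²`, so the conditional fourth moment is `S⁴ + 6κ₂ S² A + κ₄ A²`. The mixed term is handled by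
Cauchy–Schwarz and the induction hypothesis. -/
lemma IsARFamily.lintegral_crossVec_le (h : IsARFamily H φ ψ K₀ a z) (j : Fin p) (N : ℕ) :
    ∫⁻ ω, ‖crossVec (fun m s => a m s ω) (fun m s => z m s ω) N j‖ₑ ^ 4 ∂P ≤
      (crossBound K₀ * (n * N)) ^ 2 := by
  induction N with
  | zero => simp [crossVec]
  | succ N ih =>
    set T : ℤ := ((N + 1 : ℕ) : ℤ) + p with hT
    set κ₂ := gaussMoment 2
    set κ₄ := gaussMoment 4
    set e := ENNReal.ofReal K₀ * (1 + κ₄) with he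
    set R := crossBound K₀ with hR
    have hR' : R = (1 + 3 * κ₂) * (1 + κ₄) * e := rfl
    have ham := fun m s => measurable_Lp (a m s)
    have hzm := fun m s => measurable_Lp (z m s)
    let S : Ω → ℝ := fun ω => crossVec (fun m s => a m s ω) (fun m s => z m s ω) N j
    have hSm : Measurable S := by
      simp only [S, crossVec]
      fun_prop
    -- All variables before time `T`, with later ones replaced by `0`: a family orthogonal to the
    -- innovations at time `T`.
    let X : Bool × Fin n × ℤ → Lp ℝ 2 P := fun i =>
      if i.2.2 < T then (if i.1 then z i.2.1 i.2.2 else a i.2.1 i.2.2) else 0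
    have hXt : ∀ m s, s < T → X (true, m, s) = z m s := fun m s hs => by simp [X, hs]
    have hXf : ∀ m s, s < T → X (false, m, s) = a m s := fun m s hs => by simp [X, hs]
    have hXH : ∀ i, X i ∈ H := fun i => by
      simp only [X]
      split_ifs
      exacts [h.z_mem _ _, h.a_mem _ _, H.zero_mem]
    have hind := h.gaussian.indepFun (X := X) (Y := fun m => z m T) hXH (fun m => h.z_mem m T) (by
      rintro ⟨b, m', s⟩ m
      simp only [X]
      split_ifs with h1 h2
      · rw [h.inner_z, if_neg (fun hh => h1.ne hh.2)]
      · rw [h.inner_az, h.psi_neg _ (by omega)]; simp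
      · exact inner_zero_left _)
    let f₁ : (Bool × Fin n × ℤ → ℝ) → ℝ × (Fin n → ℝ) := fun x =>
      (∑ t ∈ Finset.Icc 1 N, ∑ m, x (true, m, (t : ℤ) + p) *
        x (false, m, (t : ℤ) + p - ((j : ℤ) + 1)), fun m => x (false, m, T - ((j : ℤ) + 1)))
    have hf₁ : Measurable f₁ := by fun_prop
    have hind2 := hind.comp hf₁ measurable_id
    have hcomp : (f₁ ∘ fun ω i => X i ω) = fun ω => (S ω, fun m => a m (T - ((j : ℤ) + 1)) ω) := by
      funext ω
      simp only [Function.comp_apply, f₁, S, crossVec, Prod.mk.injEq]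
      constructor
      · refine Finset.sum_congr rfl fun t ht => Finset.sum_congr rfl fun m _ => ?_
        have : (t : ℤ) ≤ N := by exact_mod_cast (Finset.mem_Icc.mp ht).2
        rw [hXt _ _ (by omega), hXf _ _ (by omega)]
      · funext m
        rw [hXf _ _ (by omega)]
    rw [hcomp, Function.id_comp] at hind2
    let F : (ℝ × (Fin n → ℝ)) × (Fin n → ℝ) → ℝ≥0∞ := fun q =>
      ‖q.1.1 + ∑ m, q.1.2 m * q.2 m‖ₑ ^ 4
    have hF : Measurable F := by fun_prop
    have hstep : ∀ ω, ‖crossVec (fun m s => a m s ω) (fun m s => z m s ω) (N + 1) j‖ₑ ^ 4 =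
        F ((S ω, fun m => a m (T - ((j : ℤ) + 1)) ω), fun m => z m T ω) := by
      intro ω
      simp only [F, S, crossVec]
      rw [Finset.sum_Icc_succ_top (by omega)]
      congr 4
      exact funext fun m => mul_comm _ _
    have hinner : ∀ ω, ∫⁻ ω', F ((S ω, fun m => a m (T - ((j : ℤ) + 1)) ω), fun m => z m T ω') ∂P =
        ‖S ω‖ₑ ^ 4 + 6 * κ₂ * (‖S ω‖ₑ ^ 2 * ∑ m, ‖a m (T - ((j : ℤ) + 1)) ω‖ₑ ^ 2) +
          κ₄ * (∑ m, ‖a m (T - ((j : ℤ) + 1)) ω‖ₑ ^ 2) ^ 2 := by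
      intro ω
      set α : Fin n → ℝ := fun m => a m (T - ((j : ℤ) + 1)) ω with hα
      let Y : Lp ℝ 2 P := ∑ m, α m • z m T
      have hYH : Y ∈ H := Submodule.sum_mem _ fun m _ => H.smul_mem _ (h.z_mem _ _)
      have hYn : ‖Y‖ₑ ^ 2 = ∑ m, ‖α m‖ₑ ^ 2 := by
        have h1 : ‖Y‖ ^ 2 = ∑ m, α m ^ 2 := by
          rw [← real_inner_self_eq_norm_sq]
          simp only [Y, sum_inner, inner_sum, real_inner_smul_left, real_inner_smul_right,
            h.inner_z]
          simp [sq]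
        rw [← ofReal_norm, ← ENNReal.ofReal_pow (norm_nonneg _), h1,
          ENNReal.ofReal_sum_of_nonneg fun _ _ => sq_nonneg _]
        exact Finset.sum_congr rfl fun m _ => (enorm_sq_eq _).symm
      have hYae : ∀ᵐ ω' ∂P, Y ω' = ∑ m, α m * z m T ω' := by
        have hsum : (Y : Ω → ℝ) =ᵐ[P] ∑ m, (α m • z m T : Lp ℝ 2 P) := Lp.coeFn_finsetSum _ _
        filter_upwards [hsum, ae_all_iff.mpr fun m => Lp.coeFn_smul (α m) (z m T)] with ω' h1 h2
        rw [h1, Finset.sum_apply]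
        exact Finset.sum_congr rfl fun m _ => by rw [h2, Pi.smul_apply, smul_eq_mul]
      have h4 := h.gaussian.lintegral_add_pow_four hYH (S ω)
      rw [show ‖Y‖ₑ ^ 4 = (‖Y‖ₑ ^ 2) ^ 2 by rw [← pow_mul], hYn] at h4
      rw [← h4]
      refine lintegral_congr_ae ?_
      filter_upwards [hYae] with ω' hω'
      rw [hω']
    simp_rw [hstep]
    have hαm : Measurable fun ω => fun m => a m (T - ((j : ℤ) + 1)) ω :=
      measurable_pi_lambda _ fun m => ham _ _
    rw [lintegral_of_indepFun (hSm.prodMk hαm) (measurable_pi_lambda _ fun m => hzm _ _) hind2 hF]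
    simp_rw [hinner]
    set A : Ω → ℝ≥0∞ := fun ω => ∑ m, ‖a m (T - ((j : ℤ) + 1)) ω‖ₑ ^ 2 with hA
    have hAm : Measurable A := by simp only [hA]; fun_prop
    have hA2 : ∫⁻ ω, A ω ^ 2 ∂P ≤ (n * e) ^ 2 := by
      calc ∫⁻ ω, A ω ^ 2 ∂P
          ≤ ∫⁻ ω, n * ∑ m, ‖a m (T - ((j : ℤ) + 1)) ω‖ₑ ^ (2 * 2) ∂P := by
            refine lintegral_mono fun ω => (sum_sq_le_card_mul _ _).trans ?_
            simp [← pow_mul]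
        _ = n * ∑ m, ∫⁻ ω, ‖a m (T - ((j : ℤ) + 1)) ω‖ₑ ^ (2 * 2) ∂P := by
            rw [lintegral_const_mul _ (by fun_prop), lintegral_finsetSum _ (fun m _ => by fun_prop)]
        _ ≤ n * ∑ _m : Fin n, ENNReal.ofReal K₀ ^ 2 * κ₄ := by
            gcongr with m
            exact h.lintegral_a_pow_le m _ 2
        _ = n ^ 2 * ENNReal.ofReal K₀ ^ 2 * κ₄ := by simp; ring
        _ ≤ n ^ 2 * ENNReal.ofReal K₀ ^ 2 * (1 + κ₄) ^ 2 := by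
            gcongr
            calc κ₄ ≤ 1 + κ₄ := le_add_self
              _ ≤ (1 + κ₄) ^ 2 := le_self_pow₀ (le_add_right (le_refl _)) (by norm_num)
        _ = (n * e) ^ 2 := by rw [he]; ring
    have hsqrt : ∀ x : ℝ≥0∞, (x ^ 2) ^ (1 / 2 : ℝ) = x := fun x => by
      rw [← ENNReal.rpow_natCast, ← ENNReal.rpow_mul]; norm_num
    have hSA : ∫⁻ ω, ‖S ω‖ₑ ^ 2 * A ω ∂P ≤ (R * (n * N)) * (n * e) := by
      refine (lintegral_mul_le_sqrt (by fun_prop) hAm.aemeasurable).trans ?_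
      gcongr
      · rw [← hsqrt (R * (n * N))]
        refine ENNReal.rpow_le_rpow ?_ (by norm_num)
        simpa [← pow_mul] using ih
      · rw [← hsqrt (n * e)]
        exact ENNReal.rpow_le_rpow hA2 (by norm_num)
    rw [lintegral_add_left (by fun_prop), lintegral_add_left (by fun_prop),
      lintegral_const_mul _ (by fun_prop), lintegral_const_mul _ (by fun_prop)]
    have hRe : 3 * κ₂ * e ≤ R := by
      rw [hR']
      refine mul_le_mul' ?_ (le_refl _)
      calc 3 * κ₂ ≤ 1 + 3 * κ₂ := le_add_self
        _ ≤ (1 + 3 * κ₂) * (1 + κ₄) := le_mul_of_one_le_right' (le_add_right (le_refl _))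
    have hRe2 : κ₄ * e ^ 2 ≤ R ^ 2 := by
      rw [show R ^ 2 = ((1 + 3 * κ₂) * (1 + κ₄)) ^ 2 * e ^ 2 by rw [hR', mul_pow]]
      refine mul_le_mul' ?_ (le_refl _)
      calc κ₄ ≤ 1 + κ₄ := le_add_self
        _ ≤ (1 + 3 * κ₂) * (1 + κ₄) := le_mul_of_one_le_left' (le_add_right (le_refl _))
        _ ≤ ((1 + 3 * κ₂) * (1 + κ₄)) ^ 2 :=
            le_self_pow₀ (one_le_mul (le_add_right (le_refl _)) (le_add_right (le_refl _))) (by norm_num)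
    -- The constant `R` dominates `3κ₂e`, and its square dominates `κ₄e²`, so the right side
    -- completes to the square of `R n (N+1)`.
    calc _ ≤ (R * (n * N)) ^ 2 + 6 * κ₂ * ((R * (n * N)) * (n * e)) + κ₄ * (n * e) ^ 2 := by
          gcongr
      _ = (R * (n * N)) ^ 2 + 2 * (R * n ^ 2 * N) * (3 * κ₂ * e) + n ^ 2 * (κ₄ * e ^ 2) := by ring
      _ ≤ (R * (n * N)) ^ 2 + 2 * (R * n ^ 2 * N) * R + n ^ 2 * R ^ 2 := by gcongr
      _ = _ := by push_cast; ring

/-- The moments of the normalised trace are bounded. -/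
lemma IsARFamily.lintegral_energy_pow_le (h : IsARFamily H φ ψ K₀ a z) (hp : 0 < p)
    (hn : 0 < n) {N : ℕ} (hN : 0 < N) (k : ℕ) :
    ∫⁻ ω, ENNReal.ofReal (energy p (fun m s => a m s ω) N / (n * N)) ^ k ∂P ≤
      (p : ℝ≥0∞) ^ k * (ENNReal.ofReal K₀ ^ k * gaussMoment (2 * k)) := by
  let I : Finset (ℕ × Fin n × Fin p) := Finset.Icc 1 N ×ˢ Finset.univ
  have hcard : (I.card : ℝ) = N * (n * p) := by simp [I]
  have hp' : (0 : ℝ) < p := by exact_mod_cast hp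
  have hn' : (0 : ℝ) < n := by exact_mod_cast hn
  have hN' : (0 : ℝ) < N := by exact_mod_cast hN
  have hc : (0 : ℝ) < I.card := by rw [hcard]; positivity
  let x : Ω → ℕ × Fin n × Fin p → ℝ := fun ω i => a i.2.1 ((i.1 : ℤ) + p - ((i.2.2 : ℤ) + 1)) ω
  have hE : ∀ ω, energy p (fun m s => a m s ω) N / (n * N) =
      p * ∑ i ∈ I, (I.card : ℝ)⁻¹ * x ω i ^ 2 := by
    intro ω
    rw [← Finset.mul_sum, hcard]
    have : energy p (fun m s => a m s ω) N = ∑ i ∈ I, x ω i ^ 2 := by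
      simp only [energy, I, x]
      rw [Finset.sum_product]
      refine Finset.sum_congr rfl fun t _ => ?_
      rw [← Finset.univ_product_univ, Finset.sum_product]
    rw [this]
    field_simp
  have hpt : ∀ ω, ENNReal.ofReal (energy p (fun m s => a m s ω) N / (n * N)) ^ k ≤
      (p : ℝ≥0∞) ^ k * ((I.card : ℝ≥0∞)⁻¹ * ∑ i ∈ I, ‖x ω i‖ₑ ^ (2 * k)) := by
    intro ω
    have h1 : (∑ i ∈ I, (I.card : ℝ)⁻¹ * x ω i ^ 2) ^ k ≤
        ∑ i ∈ I, (I.card : ℝ)⁻¹ * (x ω i ^ 2) ^ k :=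
      Real.pow_arith_mean_le_arith_mean_pow I _ _ (fun i _ => by positivity)
        (by rw [Finset.sum_const, nsmul_eq_mul, mul_inv_cancel₀ hc.ne'])
        (fun i _ => sq_nonneg _) k
    have h2 : ENNReal.ofReal (∑ i ∈ I, (I.card : ℝ)⁻¹ * (x ω i ^ 2) ^ k) =
        (I.card : ℝ≥0∞)⁻¹ * ∑ i ∈ I, ‖x ω i‖ₑ ^ (2 * k) := by
      rw [← Finset.mul_sum, ENNReal.ofReal_mul (by positivity), ENNReal.ofReal_inv_of_pos hc,
        ENNReal.ofReal_natCast, ENNReal.ofReal_sum_of_nonneg fun i _ => by positivity]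
      congr 1
      refine Finset.sum_congr rfl fun i _ => ?_
      rw [pow_mul, enorm_sq_eq, ENNReal.ofReal_pow (sq_nonneg _)]
    rw [hE, ENNReal.ofReal_mul hp'.le, mul_pow, ENNReal.ofReal_natCast, ← h2]
    gcongr
    rw [← ENNReal.ofReal_pow]
    · exact ENNReal.ofReal_le_ofReal h1
    · exact Finset.sum_nonneg fun i _ => by positivity
  have hxm : ∀ i, Measurable fun ω => ‖x ω i‖ₑ ^ (2 * k) := by
    intro i
    have := fun m s => measurable_Lp (a m s)
    fun_prop
  have hcE : (I.card : ℝ≥0∞) ≠ 0 := by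
    have : I.card ≠ 0 := by exact_mod_cast hc.ne'
    exact_mod_cast this
  calc _ ≤ ∫⁻ ω, (p : ℝ≥0∞) ^ k * ((I.card : ℝ≥0∞)⁻¹ * ∑ i ∈ I, ‖x ω i‖ₑ ^ (2 * k)) ∂P :=
        lintegral_mono hpt
    _ = (p : ℝ≥0∞) ^ k * ((I.card : ℝ≥0∞)⁻¹ * ∑ i ∈ I, ∫⁻ ω, ‖x ω i‖ₑ ^ (2 * k) ∂P) := by
        rw [lintegral_const_mul _ (by fun_prop), lintegral_const_mul _ (by fun_prop),
          lintegral_finsetSum _ fun i _ => hxm i]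
    _ ≤ (p : ℝ≥0∞) ^ k * ((I.card : ℝ≥0∞)⁻¹ *
          ∑ _i ∈ I, ENNReal.ofReal K₀ ^ k * gaussMoment (2 * k)) := by
        gcongr with i
        exact h.lintegral_a_pow_le _ _ k
    _ = _ := by
        rw [Finset.sum_const, nsmul_eq_mul, ← mul_assoc (I.card : ℝ≥0∞)⁻¹,
          ENNReal.inv_mul_cancel hcE (by simp), one_mul]

end Moments


/-! ### From the normal equations to the mean square error -/

section LeastSquaresBound

set_option linter.unusedSectionVars false

open scoped ENNReal NNReal

/-- The shell of vectors of norm about `1`. -/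
def shell (p : ℕ) : Set (Fin p → ℝ) := {u | 1 / 2 ≤ ‖u‖ ∧ ‖u‖ ≤ 3 / 2}

lemma measurableSet_shell (p : ℕ) : MeasurableSet (shell p) :=
  (measurableSet_le measurable_const measurable_norm).inter
    (measurableSet_le measurable_norm measurable_const)

lemma volume_shell_lt_top (p : ℕ) : volume (shell p) < ∞ :=
  (measure_mono fun u hu => by simpa using hu.2).trans_lt
    (measure_closedBall_lt_top (x := (0 : Fin p → ℝ)) (r := 3 / 2))

lemma quadForm_nonneg {n p : ℕ} (x : Fin n → ℤ → ℝ) (N : ℕ) (u : Fin p → ℝ) :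
    0 ≤ quadForm x N u :=
  Finset.sum_nonneg fun _ _ => Finset.sum_nonneg fun _ _ => sq_nonneg _

lemma energy_nonneg {n p : ℕ} (x : Fin n → ℤ → ℝ) (N : ℕ) : 0 ≤ energy p x N :=
  Finset.sum_nonneg fun _ _ => Finset.sum_nonneg fun _ _ => Finset.sum_nonneg fun _ _ => sq_nonneg _

lemma quadForm_smul {n p : ℕ} (x : Fin n → ℤ → ℝ) (N : ℕ) (c : ℝ) (u : Fin p → ℝ) :
    quadForm x N (c • u) = c ^ 2 * quadForm x N u := by
  simp only [quadForm, Finset.mul_sum, Pi.smul_apply, smul_eq_mul]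
  refine Finset.sum_congr rfl fun t _ => Finset.sum_congr rfl fun m _ => ?_
  rw [← mul_pow, Finset.mul_sum]
  congr 1
  exact Finset.sum_congr rfl fun j _ => by ring

lemma quadForm_add_le {n p : ℕ} (x : Fin n → ℤ → ℝ) (N : ℕ) (u v : Fin p → ℝ) :
    quadForm x N (u + v) ≤ 2 * quadForm x N u + 2 * quadForm x N v := by
  simp only [quadForm, Finset.mul_sum, ← Finset.sum_add_distrib]
  refine Finset.sum_le_sum fun t _ => Finset.sum_le_sum fun m _ => ?_
  simp only [Pi.add_apply, add_mul, Finset.sum_add_distrib]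
  nlinarith [sq_nonneg (∑ j, u j * x m ((t : ℤ) + p - ((j : ℤ) + 1)) -
    ∑ j, v j * x m ((t : ℤ) + p - ((j : ℤ) + 1)))]

lemma quadForm_le {n p : ℕ} (x : Fin n → ℤ → ℝ) (N : ℕ) (u : Fin p → ℝ) :
    quadForm x N u ≤ ‖u‖ ^ 2 * (p * energy p x N) := by
  simp only [quadForm, energy, Finset.mul_sum]
  refine Finset.sum_le_sum fun t _ => Finset.sum_le_sum fun m _ => ?_
  have h1 := sq_sum_le_card_mul_sum_sq (s := Finset.univ)
    (f := fun j : Fin p => u j * x m ((t : ℤ) + p - ((j : ℤ) + 1)))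
  rw [Finset.card_univ, Fintype.card_fin, Finset.mul_sum] at h1
  refine h1.trans (Finset.sum_le_sum fun j _ => ?_)
  have h2 : u j ^ 2 ≤ ‖u‖ ^ 2 := by
    rw [← sq_abs (u j), ← Real.norm_eq_abs]
    gcongr
    exact norm_le_pi_norm u j
  calc _ = u j ^ 2 * (p * x m ((t : ℤ) + p - ((j : ℤ) + 1)) ^ 2) := by ring
    _ ≤ _ := by gcongr

/-- The integral of the inverse quadratic form over the shell. -/
noncomputable def shellIntegral {n p : ℕ} (x : Fin n → ℤ → ℝ) (N : ℕ) (M : ℝ) : ℝ≥0∞ :=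
  ∫⁻ u in shell p, (ENNReal.ofReal (quadForm x N u / M))⁻¹ ^ (p + 2)

/-- The normalised form is at most `τ‖·‖²`, so a value at most `lam` at `u₀` remains at most `4 lam`
on the ball of radius `lam/(2τ)`, which lies in the shell and has volume `(lam/τ)^p`. With the
exponent `p + 2` the volume is compensated and a factor `lam⁻²` is left over. -/
lemma le_shellIntegral {n p N : ℕ} {x : Fin n → ℤ → ℝ} {M : ℝ} (hM : 0 < M)
    {u₀ : Fin p → ℝ} (hu₀ : ‖u₀‖ = 1) {lam τ : ℝ} (hlam : 0 < lam) (hlt : lam ≤ τ)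
    (hτ : p * energy p x N / M ≤ τ) (hQ : quadForm x N u₀ / M ≤ lam) :
    ENNReal.ofReal ((lam / τ) ^ p * (4 * lam)⁻¹ ^ (p + 2)) ≤ shellIntegral (p := p) x N M := by
  have hτ0 : 0 < τ := hlam.trans_le hlt
  set r := lam / τ / 2 with hr
  have hr0 : 0 < r := by positivity
  have hr1 : r ≤ 1 / 2 := by
    rw [hr]; gcongr; exact (div_le_one hτ0).mpr hlt
  have hsub : Metric.closedBall u₀ r ⊆ shell p := by
    intro u hu
    rw [Metric.mem_closedBall, dist_eq_norm] at hu
    have h1 := norm_sub_norm_le u u₀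
    have h2 := norm_sub_norm_le u₀ u
    rw [norm_sub_rev] at h2
    constructor <;> linarith
  have hle : ∀ u ∈ Metric.closedBall u₀ r, ENNReal.ofReal ((4 * lam)⁻¹ ^ (p + 2)) ≤
      (ENNReal.ofReal (quadForm x N u / M))⁻¹ ^ (p + 2) := by
    intro u hu
    rw [Metric.mem_closedBall, dist_eq_norm] at hu
    rw [ENNReal.ofReal_pow (by positivity), ENNReal.ofReal_inv_of_pos (by positivity)]
    gcongr
    have h1 := quadForm_add_le x N u₀ (u - u₀)
    rw [add_sub_cancel] at h1
    have h2 := quadForm_le x N (u - u₀)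
    have h3 : quadForm x N (u - u₀) / M ≤ r ^ 2 * τ := by
      calc _ ≤ (‖u - u₀‖ ^ 2 * (p * energy p x N)) / M := by gcongr
        _ = ‖u - u₀‖ ^ 2 * (p * energy p x N / M) := by ring
        _ ≤ _ := by
          have : 0 ≤ p * energy p x N / M := by
            have := energy_nonneg (p := p) x N
            positivity
          gcongr
    have h4 : r ^ 2 * τ ≤ lam := by
      have e : r ^ 2 * τ = r * (lam / 2) := by rw [hr]; field_simp
      rw [e]; nlinarith
    calc quadForm x N u / M ≤ (2 * quadForm x N u₀ + 2 * quadForm x N (u - u₀)) / M := by gcongr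
      _ = 2 * (quadForm x N u₀ / M) + 2 * (quadForm x N (u - u₀) / M) := by ring
      _ ≤ 4 * lam := by linarith
  calc ENNReal.ofReal ((lam / τ) ^ p * (4 * lam)⁻¹ ^ (p + 2))
      = ENNReal.ofReal ((4 * lam)⁻¹ ^ (p + 2)) * volume (Metric.closedBall u₀ r) := by
        rw [Real.volume_pi_closedBall _ hr0.le, ← ENNReal.ofReal_mul (by positivity), mul_comm]
        congr 2
        rw [Fintype.card_fin, hr]; congr 1; ring
    _ = ∫⁻ _u in Metric.closedBall u₀ r, ENNReal.ofReal ((4 * lam)⁻¹ ^ (p + 2)) := by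
        rw [setLIntegral_const]
    _ ≤ ∫⁻ u in Metric.closedBall u₀ r, (ENNReal.ofReal (quadForm x N u / M))⁻¹ ^ (p + 2) :=
        setLIntegral_mono' measurableSet_closedBall hle
    _ ≤ _ := lintegral_mono_set hsub

/-- A deterministic bound for the error of least squares. -/
lemma sq_norm_le_of_quadForm_le {n p N : ℕ} (hp : 0 < p) {x y : Fin n → ℤ → ℝ} {M : ℝ} (hM : 0 < M)
    {e : Fin p → ℝ} (he : quadForm x N e ≤ 2 * ∑ j, e j * crossVec x y N j)
    (hG : shellIntegral (p := p) x N M < ∞) :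
    ENNReal.ofReal (‖e‖ ^ 2) ≤ ENNReal.ofReal (4 * p * 4 ^ (p + 2) * p ^ p) *
      ((∑ j : Fin p, ‖crossVec x y N j‖ₑ ^ 2) * ENNReal.ofReal (M ^ 2)⁻¹ *
        ENNReal.ofReal (energy p x N / M) ^ p * shellIntegral (p := p) x N M) := by
  rcases eq_or_ne e 0 with rfl | he0
  · simp
  have hen : 0 < ‖e‖ := norm_pos_iff.mpr he0
  have hp' : (0 : ℝ) < p := by exact_mod_cast hp
  set u₀ : Fin p → ℝ := ‖e‖⁻¹ • e with hu₀
  have hu₀n : ‖u₀‖ = 1 := by rw [hu₀, norm_smul, norm_inv, norm_norm, inv_mul_cancel₀ hen.ne']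
  set G := shellIntegral (p := p) x N M with hGdef
  set g := G.toReal with hg
  have hGg : G = ENNReal.ofReal g := (ENNReal.ofReal_toReal hG.ne).symm
  have hg0 : 0 ≤ g := ENNReal.toReal_nonneg
  have hE0 := energy_nonneg (p := p) x N
  set τ := p * energy p x N / M with hτ
  have hτ0' : 0 ≤ τ := by positivity
  set lam := quadForm x N u₀ / M with hlam
  have hlam0 : 0 ≤ lam := div_nonneg (quadForm_nonneg _ _ _) hM.le
  have hlamτ : lam ≤ τ := by
    have := quadForm_le x N u₀
    rw [hu₀n, one_pow, one_mul] at this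
    rw [hlam, hτ]; gcongr
  -- Stated for majorants `l'`, `τ'` so that it can also be used when `lam` vanishes.
  have key : ∀ l' τ' : ℝ, 0 < l' → l' ≤ τ' → τ ≤ τ' → lam ≤ l' →
      1 ≤ 4 ^ (p + 2) * τ' ^ p * g * l' ^ 2 := by
    intro l' τ' h1 h2 h3 h4
    have h5 := le_shellIntegral hM hu₀n h1 h2 h3 h4
    rw [← hGdef, hGg, ENNReal.ofReal_le_ofReal_iff hg0] at h5
    have h6 : (l' / τ') ^ p * (4 * l')⁻¹ ^ (p + 2) * (4 ^ (p + 2) * τ' ^ p * l' ^ 2) = 1 := by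
      have : 0 < τ' := h1.trans_le h2
      rw [div_pow, inv_pow, mul_pow, pow_add l' p 2]
      field_simp
    rw [← h6]
    have : 0 < τ' := h1.trans_le h2
    calc _ ≤ g * (4 ^ (p + 2) * τ' ^ p * l' ^ 2) := by gcongr
      _ = _ := by ring
  -- A degenerate direction would allow arbitrarily small `l'` in `key`, against finiteness of the
  -- shell integral; `1/(c+1)` is small enough.
  have hlampos : 0 < lam := by
    by_contra hcon
    have hl0 : lam = 0 := le_antisymm (not_lt.mp hcon) hlam0
    set c := 4 ^ (p + 2) * (τ + 1) ^ p * g with hc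
    have hc0 : 0 ≤ c := by positivity
    have h1 := key (1 / (c + 1)) (τ + 1) (by positivity)
      (by
        have : 1 / (c + 1) ≤ 1 := by rw [div_le_one (by positivity)]; linarith
        linarith) (by linarith) (by rw [hl0]; positivity)
    rw [← hc, div_pow, one_pow, mul_one_div, le_div_iff₀ (by positivity)] at h1
    nlinarith
  have hkey := key lam τ hlampos hlamτ le_rfl le_rfl
  set V := ∑ j : Fin p, crossVec x y N j ^ 2 with hV
  have hQe : quadForm x N e / M = ‖e‖ ^ 2 * lam := by
    have : e = ‖e‖ • u₀ := by rw [hu₀, smul_smul, mul_inv_cancel₀ hen.ne', one_smul]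
    conv_lhs => rw [this, quadForm_smul]
    rw [hlam]; ring
  have hcs : (∑ j, e j * crossVec x y N j) ^ 2 ≤ (p * ‖e‖ ^ 2) * V := by
    refine (Finset.sum_mul_sq_le_sq_mul_sq _ _ _).trans ?_
    gcongr
    calc ∑ i, e i ^ 2 ≤ ∑ _i : Fin p, ‖e‖ ^ 2 := by
          refine Finset.sum_le_sum fun j _ => ?_
          rw [← sq_abs (e j), ← Real.norm_eq_abs]
          gcongr
          exact norm_le_pi_norm e j
      _ = _ := by simp
  -- With `Q(e) = M ‖e‖² lam`, squaring the basic inequality and Cauchy–Schwarz bound `‖e‖² lam²`;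
  -- `hkey` then replaces `lam⁻²` by the shell integral.
  have h1 : (‖e‖ ^ 2 * lam) ^ 2 ≤ 4 * (p * ‖e‖ ^ 2) * V / M ^ 2 := by
    rw [← hQe, div_pow]
    gcongr
    calc quadForm x N e ^ 2 ≤ (2 * ∑ j, e j * crossVec x y N j) ^ 2 := by
          have := quadForm_nonneg x N e
          gcongr
      _ = 4 * (∑ j, e j * crossVec x y N j) ^ 2 := by ring
      _ ≤ 4 * ((p * ‖e‖ ^ 2) * V) := by gcongr
      _ = _ := by ring
  have h2 : ‖e‖ ^ 2 * lam ^ 2 ≤ 4 * p * V / M ^ 2 := by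
    have : 0 < ‖e‖ ^ 2 := by positivity
    refine le_of_mul_le_mul_left ?_ this
    calc _ = (‖e‖ ^ 2 * lam) ^ 2 := by ring
      _ ≤ _ := h1
      _ = _ := by ring
  have h3 : ‖e‖ ^ 2 ≤ 4 * p * 4 ^ (p + 2) * p ^ p *
      (V * (M ^ 2)⁻¹ * (energy p x N / M) ^ p * g) := by
    calc ‖e‖ ^ 2 = ‖e‖ ^ 2 * 1 := by ring
      _ ≤ ‖e‖ ^ 2 * (4 ^ (p + 2) * τ ^ p * g * lam ^ 2) := by gcongr
      _ = (‖e‖ ^ 2 * lam ^ 2) * (4 ^ (p + 2) * τ ^ p * g) := by ring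
      _ ≤ (4 * p * V / M ^ 2) * (4 ^ (p + 2) * τ ^ p * g) := by gcongr
      _ = _ := by
        rw [hτ, mul_div_assoc (p : ℝ), mul_pow]; ring
  have hVE : ∑ j : Fin p, ‖crossVec x y N j‖ₑ ^ 2 = ENNReal.ofReal V := by
    rw [hV, ENNReal.ofReal_sum_of_nonneg fun _ _ => sq_nonneg _]
    exact Finset.sum_congr rfl fun j _ => enorm_sq_eq _
  have hV0 : 0 ≤ V := Finset.sum_nonneg fun _ _ => sq_nonneg _
  rw [hVE, hGg, ← ENNReal.ofReal_pow (by positivity), ← ENNReal.ofReal_mul hV0,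
    ← ENNReal.ofReal_mul (by positivity), ← ENNReal.ofReal_mul (by positivity),
    ← ENNReal.ofReal_mul (by positivity)]
  exact ENNReal.ofReal_le_ofReal h3

/-- A bound for the moments of the normalised trace. -/
noncomputable def traceMomentBound (p : ℕ) (K₀ : ℝ) : ℝ≥0∞ :=
  (p : ℝ≥0∞) ^ (4 * p) * (ENNReal.ofReal K₀ ^ (4 * p) * gaussMoment (2 * (4 * p)))

/-- A bound for the negative moments of the normalised quadratic form. -/
noncomputable def inverseMomentBound (p : ℕ) (K₀ : ℝ) : ℝ≥0∞ :=
  ENNReal.ofReal (2 * (p * (4 * (4 * (p + 2))))) ^ (4 * (p + 2)) *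
    negMomentBound ((1 / 2 / (1 + K₀)) ^ 2) ^ (4 * (4 * (p + 2)))

lemma traceMomentBound_lt_top (p : ℕ) (K₀ : ℝ) : traceMomentBound p K₀ < ∞ := by
  have h2 := gaussMoment_lt_top (2 * (4 * p))
  unfold traceMomentBound
  finiteness

lemma inverseMomentBound_lt_top (p : ℕ) (K₀ : ℝ) : inverseMomentBound p K₀ < ∞ := by
  have h3 := negMomentBound_lt_top ((1 / 2 / (1 + K₀)) ^ 2)
  unfold inverseMomentBound
  finiteness

/-- The constant in the mean square error bound for least squares. -/
noncomputable def lseBound (p : ℕ) (K₀ : ℝ) : ℝ≥0∞ :=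
  ENNReal.ofReal (4 * p * 4 ^ (p + 2) * p ^ p) * (p * crossBound K₀) *
    (traceMomentBound p K₀ ^ (1 / 2 : ℝ) * inverseMomentBound p K₀ ^ (1 / 2 : ℝ)) ^ (1 / 2 : ℝ) *
    volume (shell p)

lemma lseBound_lt_top (p : ℕ) (K₀ : ℝ) : lseBound p K₀ < ∞ := by
  have h1 := crossBound_lt_top K₀
  have h4 := volume_shell_lt_top p
  unfold lseBound
  refine ENNReal.mul_lt_top (ENNReal.mul_lt_top (by finiteness) ?_) h4
  refine ENNReal.rpow_lt_top_of_nonneg (by norm_num) (ENNReal.mul_lt_top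
    (ENNReal.rpow_lt_top_of_nonneg (by norm_num) (traceMomentBound_lt_top p K₀).ne)
    (ENNReal.rpow_lt_top_of_nonneg (by norm_num) (inverseMomentBound_lt_top p K₀).ne)).ne

variable {Ω : Type*} [MeasurableSpace Ω] {P : Measure Ω} [IsProbabilityMeasure P]
  {H : Submodule ℝ (Lp ℝ 2 P)} {n p : ℕ} {φ : Fin p → ℝ} {ψ : ℤ → ℝ} {K₀ : ℝ}
  {a z : Fin n → ℤ → Lp ℝ 2 P}

lemma measurable_quadForm {α : Type*} [MeasurableSpace α] {x : Fin n → ℤ → α → ℝ}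
    (hx : ∀ m s, Measurable (x m s)) (N : ℕ) :
    Measurable fun q : α × (Fin p → ℝ) => quadForm (fun m s => x m s q.1) N q.2 := by
  unfold quadForm
  refine Finset.measurable_sum _ fun t _ => Finset.measurable_sum _ fun m _ =>
    Measurable.pow_const (Finset.measurable_sum _ fun j _ => ?_) _
  exact ((measurable_pi_apply j).comp measurable_snd).mul ((hx _ _).comp measurable_fst)

lemma measurable_energy {α : Type*} [MeasurableSpace α] {x : Fin n → ℤ → α → ℝ}
    (hx : ∀ m s, Measurable (x m s)) (p N : ℕ) :
    Measurable fun q : α => energy p (fun m s => x m s q) N := by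
  unfold energy
  fun_prop

lemma measurable_crossVec {α : Type*} [MeasurableSpace α] {x y : Fin n → ℤ → α → ℝ}
    (hx : ∀ m s, Measurable (x m s)) (hy : ∀ m s, Measurable (y m s)) (N : ℕ) (j : Fin p) :
    Measurable fun q : α => crossVec (fun m s => x m s q) (fun m s => y m s q) N j := by
  unfold crossVec
  fun_prop

/-- A form of Hölder's inequality, with an average over a parameter. -/
lemma lintegral_mul_setLIntegral_le {E : Type*} [MeasurableSpace E] {ν : Measure E} [SFinite ν]
    {V τ : Ω → ℝ≥0∞} {f : Ω → E → ℝ≥0∞} {S : Set E} {cV cτ cf : ℝ≥0∞} (hS : MeasurableSet S)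
    (hV : Measurable V) (hτ : Measurable τ) (hf : Measurable (Function.uncurry f))
    (hV2 : (∫⁻ ω, V ω ^ 2 ∂P) ^ (1 / 2 : ℝ) ≤ cV) (hτ4 : ∫⁻ ω, τ ω ^ 4 ∂P ≤ cτ)
    (hf4 : ∀ u ∈ S, ∫⁻ ω, f ω u ^ 4 ∂P ≤ cf) :
    ∫⁻ ω, V ω * τ ω * ∫⁻ u in S, f ω u ∂ν ∂P ≤
      cV * (cτ ^ (1 / 2 : ℝ) * cf ^ (1 / 2 : ℝ)) ^ (1 / 2 : ℝ) * ν S := by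
  have hfu : ∀ u, Measurable fun ω => f ω u := fun u => hf.comp measurable_prodMk_right
  have hfω : ∀ ω, Measurable fun u => f ω u := fun ω => hf.comp measurable_prodMk_left
  have hm : Measurable fun q : Ω × E => V q.1 * (τ q.1 * f q.1 q.2) :=
    (hV.comp measurable_fst).mul ((hτ.comp measurable_fst).mul hf)
  have hbound : ∀ u ∈ S, ∫⁻ ω, V ω * (τ ω * f ω u) ∂P ≤
      cV * (cτ ^ (1 / 2 : ℝ) * cf ^ (1 / 2 : ℝ)) ^ (1 / 2 : ℝ) := by
    intro u hu
    refine (lintegral_mul_le_sqrt hV.aemeasurable (hτ.mul (hfu u)).aemeasurable).trans ?_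
    refine mul_le_mul' hV2 (ENNReal.rpow_le_rpow ?_ (by norm_num))
    simp_rw [Pi.mul_apply, mul_pow]
    refine (lintegral_mul_le_sqrt (hτ.pow_const 2).aemeasurable
      ((hfu u).pow_const 2).aemeasurable).trans ?_
    refine mul_le_mul' (ENNReal.rpow_le_rpow ?_ (by norm_num))
      (ENNReal.rpow_le_rpow ?_ (by norm_num))
    · refine le_trans (le_of_eq ?_) hτ4
      exact lintegral_congr fun ω => by rw [← pow_mul]
    · refine le_trans (le_of_eq ?_) (hf4 u hu)
      exact lintegral_congr fun ω => by rw [← pow_mul]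
  calc _ = ∫⁻ ω, ∫⁻ u in S, V ω * (τ ω * f ω u) ∂ν ∂P := by
        refine lintegral_congr fun ω => ?_
        rw [lintegral_const_mul _ ((hfω ω).const_mul _), lintegral_const_mul _ (hfω ω), mul_assoc]
    _ = ∫⁻ u in S, ∫⁻ ω, V ω * (τ ω * f ω u) ∂P ∂ν := lintegral_lintegral_swap hm.aemeasurable
    _ ≤ ∫⁻ _u in S, cV * (cτ ^ (1 / 2 : ℝ) * cf ^ (1 / 2 : ℝ)) ^ (1 / 2 : ℝ) ∂ν :=
        setLIntegral_mono' hS hbound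
    _ = _ := setLIntegral_const _ _

/-- Tonelli together with `x ≤ 1 + x⁴`. It excludes degenerate Gram forms almost surely. -/
lemma ae_setLIntegral_lt_top {E : Type*} [MeasurableSpace E] {ν : Measure E} [SFinite ν]
    {f : Ω → E → ℝ≥0∞} {S : Set E} {cf : ℝ≥0∞} (hS : MeasurableSet S) (hνS : ν S < ∞)
    (hf : Measurable (Function.uncurry f)) (hcf : cf < ∞)
    (hf4 : ∀ u ∈ S, ∫⁻ ω, f ω u ^ 4 ∂P ≤ cf) : ∀ᵐ ω ∂P, ∫⁻ u in S, f ω u ∂ν < ∞ := by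
  refine ae_lt_top hf.lintegral_prod_right' ?_
  rw [lintegral_lintegral_swap hf.aemeasurable]
  refine ne_top_of_le_ne_top ?_ (setLIntegral_mono' hS (g := fun _ => 1 + cf) fun u hu => ?_)
  · rw [setLIntegral_const]
    exact (ENNReal.mul_lt_top (ENNReal.add_lt_top.mpr ⟨ENNReal.one_lt_top, hcf⟩) hνS).ne
  · calc ∫⁻ ω, f ω u ∂P ≤ ∫⁻ ω, (1 + f ω u ^ 4) ∂P := by
          refine lintegral_mono fun ω => ?_
          rcases le_total (f ω u) 1 with h1 | h1
          · exact h1.trans (le_add_right le_rfl)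
          · exact (le_self_pow₀ h1 (by norm_num)).trans le_add_self
      _ = 1 + ∫⁻ ω, f ω u ^ 4 ∂P := by
          rw [lintegral_add_left measurable_const]; simp
      _ ≤ _ := by gcongr; exact hf4 u hu

lemma IsARFamily.lintegral_sum_crossVec_le (h : IsARFamily H φ ψ K₀ a z) (N : ℕ) :
    (∫⁻ ω, (∑ j : Fin p, ‖crossVec (fun m s => a m s ω) (fun m s => z m s ω) N j‖ₑ ^ 2) ^ 2 ∂P) ^
      (1 / 2 : ℝ) ≤ p * (crossBound K₀ * (n * N)) := by
  have hcm := measurable_crossVec (p := p) (fun m s => measurable_Lp (a m s))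
    (fun m s => measurable_Lp (z m s)) N
  have hsqrt : ∀ x : ℝ≥0∞, (x ^ 2) ^ (1 / 2 : ℝ) = x := fun x => by
    rw [← ENNReal.rpow_natCast, ← ENNReal.rpow_mul]; norm_num
  rw [← hsqrt (p * (crossBound K₀ * (n * N)))]
  refine ENNReal.rpow_le_rpow ?_ (by norm_num)
  calc _ ≤ ∫⁻ ω, p * ∑ j : Fin p,
        ‖crossVec (fun m s => a m s ω) (fun m s => z m s ω) N j‖ₑ ^ 4 ∂P := by
        refine lintegral_mono fun ω => (sum_sq_le_card_mul _ _).trans ?_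
        simp [← pow_mul]
    _ = p * ∑ j : Fin p, ∫⁻ ω,
        ‖crossVec (fun m s => a m s ω) (fun m s => z m s ω) N j‖ₑ ^ 4 ∂P := by
        rw [lintegral_const_mul _
          (Finset.measurable_sum _ fun j _ => (hcm j).enorm.pow_const _),
          lintegral_finsetSum _ (fun j _ => (hcm j).enorm.pow_const _)]
    _ ≤ p * ∑ _j : Fin p, (crossBound K₀ * (n * N)) ^ 2 := by
        gcongr with j
        exact h.lintegral_crossVec_le j N
    _ = _ := by simp; ring

/-- The mean square error of least squares in Gaussian autoregressions is of the order of the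
inverse of the number of observations. -/
theorem IsARFamily.exists_error_bound (h : IsARFamily H φ ψ K₀ a z) (hp : 0 < p) (hn : 0 < n)
    {N : ℕ} (hN : p * (4 * (4 * (p + 2))) ≤ N) :
    ∃ B : Ω → ℝ≥0∞, Measurable B ∧ ∫⁻ ω, B ω ∂P ≤ lseBound p K₀ * ENNReal.ofReal ((n : ℝ) * N)⁻¹ ∧
      ∀ᵐ ω ∂P, ∀ e : Fin p → ℝ, quadForm (fun m s => a m s ω) N e ≤
        2 * ∑ j, e j * crossVec (fun m s => a m s ω) (fun m s => z m s ω) N j →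
        ENNReal.ofReal (‖e‖ ^ 2) ≤ B ω := by
  have hNpos : 0 < N := lt_of_lt_of_le (by positivity) hN
  have hn' : (0 : ℝ) < n := by exact_mod_cast hn
  have hN' : (0 : ℝ) < N := by exact_mod_cast hNpos
  have hM0 : 0 < (n : ℝ) * N := mul_pos hn' hN'
  have hf : Measurable (Function.uncurry fun (ω : Ω) (u : Fin p → ℝ) =>
      (ENNReal.ofReal (quadForm (fun m s => a m s ω) N u / ((n : ℝ) * N)))⁻¹ ^ (p + 2)) :=
    (((measurable_quadForm (p := p) (fun m s => measurable_Lp (a m s)) N).div_const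
    ((n : ℝ) * N)).ennreal_ofReal.inv.pow_const (p + 2))
  have hτ := (((measurable_energy (fun m s => measurable_Lp (a m s)) p N).div_const
    ((n : ℝ) * N)).ennreal_ofReal.pow_const p)
  have hV : Measurable fun ω =>
      ∑ j : Fin p, ‖crossVec (fun m s => a m s ω) (fun m s => z m s ω) N j‖ₑ ^ 2 :=
    Finset.measurable_sum _ fun j _ => (measurable_crossVec (fun m s => measurable_Lp (a m s))
      (fun m s => measurable_Lp (z m s)) N j).enorm.pow_const _
  have hf4 : ∀ u ∈ shell p, ∫⁻ ω, ((ENNReal.ofReal (quadForm (fun m s => a m s ω) N u /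
      ((n : ℝ) * N)))⁻¹ ^ (p + 2)) ^ 4 ∂P ≤ inverseMomentBound p K₀ := by
    intro u hu
    have := h.lintegral_inv_quadForm_le hp hn (q := 4 * (p + 2)) (by positivity) hN hu.1
    simp only [← pow_mul]
    rw [mul_comm (p + 2) 4]
    refine this.trans (le_of_eq ?_)
    rw [inverseMomentBound]
    push_cast
    rfl
  have hτ4 : ∫⁻ ω, (ENNReal.ofReal (energy p (fun m s => a m s ω) N / ((n : ℝ) * N)) ^ p) ^ 4 ∂P ≤
      traceMomentBound p K₀ := by
    simp_rw [← pow_mul, mul_comm p 4]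
    exact h.lintegral_energy_pow_le hp hn hNpos (4 * p)
  have hG := hf.lintegral_prod_right' (ν := volume.restrict (shell p))
  have key := lintegral_mul_setLIntegral_le (ν := volume) (measurableSet_shell p) hV hτ hf
    (h.lintegral_sum_crossVec_le N) hτ4 hf4
  have hfin := ae_setLIntegral_lt_top (ν := volume) (measurableSet_shell p)
    (volume_shell_lt_top p) hf (inverseMomentBound_lt_top p K₀) hf4
  refine ⟨_, ((hV.mul hτ).mul hG).const_mul
    (ENNReal.ofReal (4 * p * 4 ^ (p + 2) * p ^ p) * ENNReal.ofReal (((n : ℝ) * N) ^ 2)⁻¹), ?_, ?_⟩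
  · rw [lintegral_const_mul _ ((hV.mul hτ).mul hG)]
    refine (mul_le_mul_right key _).trans (le_of_eq ?_)
    -- The squared cross products are of order `nN` and are divided by `(nN)²`, which leaves the
    -- rate `1/(nN)`.
    have hMM : ENNReal.ofReal (((n : ℝ) * N) ^ 2)⁻¹ * (n * N) =
        ENNReal.ofReal ((n : ℝ) * N)⁻¹ := by
      have : (n : ℝ≥0∞) * N = ENNReal.ofReal ((n : ℝ) * N) := by
        rw [ENNReal.ofReal_mul hn'.le]; simp
      rw [this, ← ENNReal.ofReal_mul (by positivity)]
      congr 1; field_simp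
    rw [← hMM, lseBound]
    ring
  · filter_upwards [hfin] with ω hω e he
    refine (sq_norm_le_of_quadForm_le hp hM0 he hω).trans (le_of_eq ?_)
    simp only [shellIntegral, Pi.mul_apply, Function.uncurry_apply_pair]
    ring

end LeastSquaresBound


/-! ### Gaussian spaces spanned by Gaussian fields -/

section GaussianSpan

set_option linter.unusedSectionVars false

open scoped ENNReal NNReal Topology

variable {Ω : Type*} [MeasurableSpace Ω] {P : Measure Ω} [IsProbabilityMeasure P]

/-- An `L²`-convergent sequence has an almost surely convergent subsequence, so its characteristic
functions converge by domination; the Gaussian ones converge with the norm. -/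
lemma isClosed_setOf_map_eq_gaussianReal :
    IsClosed {X : Lp ℝ 2 P | P.map X = gaussianReal 0 (‖X‖₊ ^ 2)} := by
  refine IsSeqClosed.isClosed fun X Y hX hY => ?_
  obtain ⟨ns, hns, hae⟩ := (tendstoInMeasure_of_tendsto_Lp hY).exists_seq_tendsto_ae
  have hmap := fun X : Lp ℝ 2 P => Measure.isProbabilityMeasure_map (aemeasurable_Lp X)
  have := hmap Y
  refine Measure.ext_of_charFun (funext fun t => ?_)
  have h1 : Tendsto (fun n => charFun (P.map (X (ns n))) t) atTop (𝓝 (charFun (P.map Y) t)) := by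
    simp only [charFun_apply_real]
    have hm : ∀ X : Lp ℝ 2 P, ∫ x, Complex.exp (t * x * Complex.I) ∂(P.map X) =
        ∫ ω, Complex.exp (t * X ω * Complex.I) ∂P := fun X =>
      integral_map (aemeasurable_Lp X) (by fun_prop)
    simp only [hm]
    refine tendsto_integral_of_dominated_convergence (fun _ => 1) (fun n => ?_)
      (integrable_const _) (fun n => ?_) ?_
    · have := measurable_Lp (X (ns n))
      exact Measurable.aestronglyMeasurable (by fun_prop)
    · refine .of_forall fun ω => le_of_eq ?_
      rw [← Complex.ofReal_mul, Complex.norm_exp_ofReal_mul_I]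
    · filter_upwards [hae] with ω hω
      have hc : Continuous fun x : ℝ => Complex.exp (t * x * Complex.I) := by fun_prop
      exact (hc.tendsto _).comp hω
  have h2 : Tendsto (fun n => charFun (P.map (X (ns n))) t) atTop
      (𝓝 (charFun (gaussianReal 0 (‖Y‖₊ ^ 2)) t)) := by
    have h3 : ∀ n, charFun (P.map (X (ns n))) t =
        charFun (gaussianReal 0 (‖X (ns n)‖₊ ^ 2)) t := fun n => by rw [hX (ns n)]
    simp only [h3, charFun_gaussianReal]
    have h4 : Tendsto (fun n => ‖X (ns n)‖) atTop (𝓝 ‖Y‖) :=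
      (hY.comp hns.tendsto_atTop).norm
    have hc : Continuous fun x : ℝ =>
      Complex.exp (t * (0 : ℝ) * Complex.I - (x ^ 2 : ℝ) * t ^ 2 / 2) := by fun_prop
    simpa [Function.comp_def] using (hc.tendsto _).comp h4
  exact tendsto_nhds_unique h1 h2

lemma IsGaussianSpace.topologicalClosure {H : Submodule ℝ (Lp ℝ 2 P)} (hH : IsGaussianSpace H) :
    IsGaussianSpace H.topologicalClosure := fun _ hX =>
  closure_minimal (fun Y hY => hH Y hY) isClosed_setOf_map_eq_gaussianReal hX

/-- The span of a family of centred Gaussian processes, independent of each other, is a Gaussian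
space. -/
lemma isGaussianSpace_span {S τ : Type*} {Z : S → τ → Ω → ℝ}
    (hZ : ∀ t, IsGaussianProcess (fun x => Z x t) P) (hmean : ∀ x t, ∫ ω, Z x t ω ∂P = 0)
    (hind : iIndepFun (fun (t : τ) (ω : Ω) (x : S) => Z x t ω) P) {Y : S × τ → Lp ℝ 2 P}
    (hY : ∀ q, Y q =ᵐ[P] Z q.1 q.2) : IsGaussianSpace (Submodule.span ℝ (Set.range Y)) := by
  classical
  intro X hX
  obtain ⟨c, rfl⟩ := (Finsupp.mem_span_range_iff_exists_finsupp).mp hX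
  set xs := c.support.image Prod.fst
  set ts := c.support.image Prod.snd
  set X : Lp ℝ 2 P := c.sum fun i a => a • Y i with hXdef
  have hae : (X : Ω → ℝ) =ᵐ[P] fun ω => ∑ t : ts, ∑ x ∈ xs, c (x, (t : τ)) * Z x t ω := by
    have h1 : X = ∑ t ∈ ts, ∑ x ∈ xs, c (x, t) • Y (x, t) := by
      rw [← Finset.sum_product_right' xs ts (fun x t => c (x, t) • Y (x, t)), hXdef, Finsupp.sum]
      refine Finset.sum_subset (fun q hq => ?_) fun q _ hq => ?_
      · exact Finset.mem_product.mpr ⟨Finset.mem_image_of_mem _ hq, Finset.mem_image_of_mem _ hq⟩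
      · rw [Finsupp.notMem_support_iff.mp hq, zero_smul]
    have h2 := fun t => Lp.coeFn_finsetSum xs fun x => c (x, t) • Y (x, t)
    have h3 := Lp.coeFn_finsetSum ts fun t => ∑ x ∈ xs, c (x, t) • Y (x, t)
    rw [← h1] at h3
    have h4 : ∀ᵐ ω ∂P, ∀ t ∈ ts, (∑ x ∈ xs, c (x, t) • Y (x, t) : Lp ℝ 2 P) ω =
        ∑ x ∈ xs, (c (x, t) • Y (x, t) : Lp ℝ 2 P) ω := by
      refine (ae_ball_iff ts.countable_toSet).mpr fun t _ => ?_
      filter_upwards [h2 t] with ω hω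
      rw [hω, Finset.sum_apply]
    have h5 : ∀ᵐ ω ∂P, ∀ t ∈ ts, ∀ x ∈ xs, (c (x, t) • Y (x, t) : Lp ℝ 2 P) ω =
        c (x, t) * Z x t ω := by
      refine (ae_ball_iff ts.countable_toSet).mpr fun t _ =>
        (ae_ball_iff xs.countable_toSet).mpr fun x _ => ?_
      filter_upwards [Lp.coeFn_smul (c (x, t)) (Y (x, t)), hY (x, t)] with ω h6 h7
      rw [h6, Pi.smul_apply, h7, smul_eq_mul]
    filter_upwards [h3, h4, h5] with ω h6 h7 h8
    rw [h6, Finset.sum_apply, Finset.sum_coe_sort ts (fun t => ∑ x ∈ xs, c (x, t) * Z x t ω)]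
    refine Finset.sum_congr rfl fun t ht => ?_
    rw [h7 t ht]
    exact Finset.sum_congr rfl fun x hx => h8 t ht x hx
  -- For each time the inner sum is Gaussian as a combination of values of one Gaussian process;
  -- over distinct times these sums are independent.
  have hlaw : HasGaussianLaw X P := by
    refine HasGaussianLaw.congr ?_ hae.symm
    refine iIndepFun.hasGaussianLaw_fun_sum
      (X := fun (t : ts) ω => ∑ x ∈ xs, c (x, (t : τ)) * Z x t ω) (fun t => ?_) ?_
    · exact ((hZ t).smul fun x => c (x, (t : τ))).hasGaussianLaw_fun_sum (I := xs)
    · exact (hind.comp (fun t (f : S → ℝ) => ∑ x ∈ xs, c (x, t) * f x)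
        (fun t => by fun_prop)).precomp Subtype.val_injective
  have hmean' : ∫ ω, X ω ∂P = 0 := by
    have hint : ∀ x t, Integrable (Z x t) P := fun x t =>
      ((hZ t).hasGaussianLaw_eval x).integrable
    rw [integral_congr_ae hae, integral_finsetSum _ fun (t : ts) _ =>
      integrable_finsetSum _ fun x _ => (hint x (t : τ)).const_mul (c (x, (t : τ)))]
    refine Finset.sum_eq_zero fun t _ => ?_
    rw [integral_finsetSum _ fun x _ => (hint x t).const_mul _]
    refine Finset.sum_eq_zero fun x _ => ?_
    rw [integral_const_mul, hmean, mul_zero]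
  rw [hlaw.map_eq_gaussianReal, hmean']
  congr 1
  rw [variance_of_integral_eq_zero (aemeasurable_Lp X) hmean']
  have : ∫ ω, X ω ^ 2 ∂P = ‖X‖ ^ 2 := by
    rw [← real_inner_self_eq_norm_sq, inner_eq_integral]
    simp [sq]
  rw [this]
  ext
  simp [Real.toNNReal_of_nonneg (sq_nonneg ‖X‖)]

end GaussianSpan


/-! ### Harmonic coefficients -/

section HarmonicCoefficients

set_option linter.unusedSectionVars false

open scoped ENNReal NNReal Topology

/-- An orthonormal basis of the spherical harmonics of degree `l`. -/
structure IsHarmonicBasis (l : ℕ) (e : Fin (2 * l + 1) → S2 → ℝ) : Prop where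
  continuous : ∀ m, Continuous (e m)
  orthonormal : ∀ m m', ∫ x, e m x * e m' x ∂surf = if m = m' then 1 else 0
  addition : ∀ x y, zonal l (dot x y) = ∑ m, e m x * e m y

variable {l : ℕ} {e : Fin (2 * l + 1) → S2 → ℝ} {k : ℝ → ℝ}

lemma continuousOn_integrableOn {f : ℝ → ℝ} (hf : Continuous f) :
    IntegrableOn f (Set.Icc (-1 : ℝ) 1) :=
  hf.continuousOn.integrableOn_Icc

lemma memLp_one_of_two (hk : MemLp k 2 (volume.restrict (Set.Icc (-1 : ℝ) 1))) :
    IntegrableOn k (Set.Icc (-1 : ℝ) 1) := hk.integrable (by norm_num)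

/-- The harmonics of degree `l` are eigenfunctions of isotropic kernel operators. -/
lemma IsHarmonicBasis.integral_kernel_mul (he : IsHarmonicBasis l e)
    (hk : MemLp k 2 (volume.restrict (Set.Icc (-1 : ℝ) 1))) (m : Fin (2 * l + 1)) (x : S2) :
    ∫ y, k (dot x y) * e m y ∂surf = coeff k l * e m x := by
  have hi : ∀ m', Integrable (fun y => k (dot x y) * e m' y) surf := fun m' =>
    (memLp_comp_dot hk x).integrable_mul (memLp_of_continuous (he.continuous m') 2)
  -- Funk–Hecke and the addition formula give this identity of functions of `w`; pairing it with `e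
  -- m` separates the coefficients.
  have h1 : ∀ w, ∑ m', (∫ y, k (dot x y) * e m' y ∂surf) * e m' w =
      coeff k l * ∑ m', e m' x * e m' w := by
    intro w
    rw [← he.addition, ← integral_mul_zonal (memLp_one_of_two hk)]
    simp_rw [← integral_mul_const]
    rw [← integral_finsetSum _ fun m' _ => (hi m').mul_const _]
    refine integral_congr_ae (.of_forall fun y => ?_)
    simp only [he.addition y w, Finset.mul_sum, mul_assoc]
  have h2 : ∀ c : Fin (2 * l + 1) → ℝ, ∫ w, (∑ m', c m' * e m' w) * e m w ∂surf = c m := by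
    intro c
    simp_rw [Finset.sum_mul, mul_assoc]
    have hi : ∀ m', Integrable (fun w => e m' w * e m w) surf := fun m' =>
      integrable_of_continuous ((he.continuous m').mul (he.continuous m))
    rw [integral_finsetSum _ fun m' _ => (hi m').const_mul (c m')]
    simp_rw [integral_const_mul, he.orthonormal]
    simp
  have h3 := h2 fun m' => ∫ y, k (dot x y) * e m' y ∂surf
  rw [← h3]
  simp_rw [h1]
  have h4 := h2 fun m' => coeff k l * e m' x
  rw [← h4]
  simp_rw [Finset.mul_sum, mul_assoc]

lemma IsHarmonicBasis.kernelOp_zonal (he : IsHarmonicBasis l e) {f : S2 → ℝ} (hf : MemLp f 2 surf)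
    (x : S2) : kernelOp (zonal l) f x = ∑ m, (∫ y, e m y * f y ∂surf) * e m x := by
  unfold kernelOp
  simp_rw [he.addition, Finset.sum_mul, ← integral_mul_const]
  rw [integral_finsetSum]
  · exact Finset.sum_congr rfl fun m _ => integral_congr_ae (.of_forall fun y => by ring)
  · intro m _
    simp_rw [mul_assoc]
    exact ((memLp_of_continuous (he.continuous m) 2).integrable_mul hf).const_mul _

lemma kernelOp_congr {k k' : ℝ → ℝ} (h : k =ᵐ[volume.restrict (Set.Icc (-1 : ℝ) 1)] k')
    (f : S2 → ℝ) (x : S2) : kernelOp k f x = kernelOp k' f x := by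
  refine integral_congr_ae ?_
  filter_upwards [(quasiMeasurePreserving_dot x).ae_eq h] with y hy
  have : k (dot x y) = k' (dot x y) := hy
  rw [this]

lemma aestronglyMeasurable_kernel
    (hk : AEStronglyMeasurable k (volume.restrict (Set.Icc (-1 : ℝ) 1))) :
    AEStronglyMeasurable (fun q : S2 × S2 => k (dot q.1 q.2)) (surf.prod surf) :=
  hk.comp_quasiMeasurePreserving (QuasiMeasurePreserving.prod_of_right
    continuous_dot.measurable (.of_forall fun x => quasiMeasurePreserving_dot x))

variable {f : S2 → ℝ}

/-- Cauchy–Schwarz, the norm of `y ↦ k(⟨x,y⟩)` being independent of `x` by Archimedes' theorem. -/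
lemma exists_integral_kernel_le (hk : MemLp k 2 (volume.restrict (Set.Icc (-1 : ℝ) 1)))
    (hf : MemLp f 2 surf) : ∃ c, ∀ x, ∫ y, ‖k (dot x y) * f y‖ ∂surf ≤ c := by
  refine ⟨(eLpNorm k 2 (ENNReal.ofReal (2 * Real.pi) •
    volume.restrict (Set.Icc (-1 : ℝ) 1))).toReal * ‖hf.norm.toLp‖, fun x => ?_⟩
  have hkx := (memLp_comp_dot hk x).norm
  have h1 := real_inner_le_norm (hkx.toLp) (hf.norm.toLp)
  rw [inner_toLp] at h1
  simp only [norm_mul]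
  refine h1.trans (le_of_eq ?_)
  rw [Lp.norm_toLp, eLpNorm_norm, ← map_dot_surf x, eLpNorm_map_measure]
  · rfl
  · rw [map_dot_surf]; exact hk.1.smul_measure _
  · exact (continuous_dot_right x).aemeasurable

lemma integrable_kernel_mul (hk : MemLp k 2 (volume.restrict (Set.Icc (-1 : ℝ) 1)))
    (hf : MemLp f 2 surf) :
    Integrable (fun q : S2 × S2 => k (dot q.1 q.2) * f q.2) (surf.prod surf) := by
  have hm : AEStronglyMeasurable (fun q : S2 × S2 => k (dot q.1 q.2) * f q.2) (surf.prod surf) :=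
    (aestronglyMeasurable_kernel hk.1).mul hf.1.comp_snd
  obtain ⟨c, hc⟩ := exists_integral_kernel_le hk hf
  refine (integrable_prod_iff hm).mpr
    ⟨.of_forall fun x => (memLp_comp_dot hk x).integrable_mul hf, ?_⟩
  refine Integrable.of_bound hm.norm.integral_prod_right' c (.of_forall fun x => ?_)
  rw [Real.norm_of_nonneg (integral_nonneg fun y => norm_nonneg _)]
  exact hc x

lemma memLp_kernelOp (hk : MemLp k 2 (volume.restrict (Set.Icc (-1 : ℝ) 1)))
    (hf : MemLp f 2 surf) : MemLp (kernelOp k f) 2 surf := by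
  obtain ⟨c, hc⟩ := exists_integral_kernel_le hk hf
  refine MemLp.of_bound (integrable_kernel_mul hk hf).1.integral_prod_right' c
    (.of_forall fun x => ?_)
  exact (norm_integral_le_integral_norm _).trans (hc x)

lemma IsHarmonicBasis.integral_mul_kernelOp (he : IsHarmonicBasis l e)
    (hk : MemLp k 2 (volume.restrict (Set.Icc (-1 : ℝ) 1))) (hf : MemLp f 2 surf)
    (m : Fin (2 * l + 1)) :
    ∫ x, e m x * kernelOp k f x ∂surf = coeff k l * ∫ x, e m x * f x ∂surf := by
  obtain ⟨c, hc⟩ := (isCompact_univ (X := S2)).exists_bound_of_continuousOn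
    (he.continuous m).continuousOn
  have hi : Integrable (fun q : S2 × S2 => e m q.1 * (k (dot q.1 q.2) * f q.2))
      (surf.prod surf) :=
    (integrable_kernel_mul hk hf).bdd_mul (c := c)
      ((he.continuous m).comp continuous_fst).aestronglyMeasurable
      (.of_forall fun q => hc _ (Set.mem_univ _))
  simp only [kernelOp, ← integral_const_mul]
  rw [integral_integral_swap hi]
  refine integral_congr_ae (.of_forall fun y => ?_)
  simp only
  rw [← mul_assoc, ← he.integral_kernel_mul hk m y, ← integral_mul_const]
  refine integral_congr_ae (.of_forall fun x => ?_)
  simp only [dot_comm x y]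
  ring

/-! ### Random fields with bounded second moments -/

variable {Ω : Type*} [MeasurableSpace Ω] {P : Measure Ω} [IsProbabilityMeasure P]
  {W : S2 → Ω → ℝ} {c : ℝ≥0∞} {g : S2 → ℝ}

/-- A jointly measurable random field on the sphere with second moments at most `c`. -/
structure IsSecondOrderField (P : Measure Ω) (W : S2 → Ω → ℝ) (c : ℝ≥0∞) : Prop where
  measurable : Measurable fun q : Ω × S2 => W q.2 q.1
  bound : ∀ x, ∫⁻ ω, ‖W x ω‖ₑ ^ 2 ∂P ≤ c
  lt_top : c < ∞

lemma memLp_two_iff_lintegral {α : Type*} [MeasurableSpace α] {μ : Measure α} {f : α → ℝ} :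
    MemLp f 2 μ ↔ AEStronglyMeasurable f μ ∧ ∫⁻ x, ‖f x‖ₑ ^ 2 ∂μ < ∞ := by
  rw [MemLp, eLpNorm_lt_top_iff_lintegral_rpow_enorm_lt_top (by norm_num) (by norm_num)]
  simp

namespace IsSecondOrderField

lemma measurable_left (h : IsSecondOrderField P W c) (x : S2) : Measurable (W x) :=
  h.measurable.comp measurable_prodMk_right

lemma measurable_right (h : IsSecondOrderField P W c) (ω : Ω) : Measurable fun x => W x ω :=
  h.measurable.comp measurable_prodMk_left

lemma memLp (h : IsSecondOrderField P W c) (x : S2) : MemLp (W x) 2 P :=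
  memLp_two_iff_lintegral.mpr ⟨(h.measurable_left x).aestronglyMeasurable,
    (h.bound x).trans_lt h.lt_top⟩

lemma measurable_sq (h : IsSecondOrderField P W c) :
    Measurable (Function.uncurry fun (ω : Ω) (x : S2) => ‖W x ω‖ₑ ^ 2) :=
  h.measurable.enorm.pow_const 2

lemma lintegral_le (h : IsSecondOrderField P W c) :
    ∫⁻ ω, ∫⁻ x, ‖W x ω‖ₑ ^ 2 ∂surf ∂P ≤ c * surf Set.univ := by
  rw [lintegral_lintegral_swap h.measurable_sq.aemeasurable, ← lintegral_const]
  exact lintegral_mono h.bound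

lemma ae_memLp (h : IsSecondOrderField P W c) : ∀ᵐ ω ∂P, MemLp (fun x => W x ω) 2 surf := by
  have h1 := ae_lt_top (μ := P) (h.measurable_sq.lintegral_prod_right' (ν := surf))
    (h.lintegral_le.trans_lt (ENNReal.mul_lt_top h.lt_top (measure_lt_top _ _))).ne
  filter_upwards [h1] with ω hω
  exact memLp_two_iff_lintegral.mpr ⟨(h.measurable_right ω).aestronglyMeasurable, hω⟩

end IsSecondOrderField

/-- The coefficient of a random field with respect to a function on the sphere. -/
noncomputable def harmonicCoeff (g : S2 → ℝ) (W : S2 → Ω → ℝ) (ω : Ω) : ℝ :=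
  ∫ x, g x * W x ω ∂surf

namespace IsSecondOrderField

lemma measurable_harmonicCoeff (h : IsSecondOrderField P W c) (hg : Continuous g) :
    Measurable (harmonicCoeff g W) := by
  have : StronglyMeasurable fun q : Ω × S2 => g q.2 * W q.2 q.1 :=
    ((hg.measurable.comp measurable_snd).mul h.measurable).stronglyMeasurable
  exact this.integral_prod_right'.measurable

lemma lintegral_harmonicCoeff_le (h : IsSecondOrderField P W c) (hg : Continuous g) :
    ∫⁻ ω, ‖harmonicCoeff g W ω‖ₑ ^ 2 ∂P ≤
      (∫⁻ x, ‖g x‖ₑ ^ 2 ∂surf) * (c * surf Set.univ) := by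
  have h1 : ∀ ω, ‖harmonicCoeff g W ω‖ₑ ^ 2 ≤
      (∫⁻ x, ‖g x‖ₑ ^ 2 ∂surf) * ∫⁻ x, ‖W x ω‖ₑ ^ 2 ∂surf := by
    intro ω
    have h2 : ‖harmonicCoeff g W ω‖ₑ ≤ ∫⁻ x, ‖g x‖ₑ * ‖W x ω‖ₑ ∂surf := by
      refine (enorm_integral_le_lintegral_enorm _).trans (le_of_eq ?_)
      simp only [enorm_mul]
    refine (pow_le_pow_left' (h2.trans (lintegral_mul_le_sqrt hg.measurable.enorm.aemeasurable
      (h.measurable_right ω).enorm.aemeasurable)) 2).trans (le_of_eq ?_)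
    rw [mul_pow]
    congr 1 <;> rw [← ENNReal.rpow_natCast, ← ENNReal.rpow_mul] <;> norm_num
  refine (lintegral_mono h1).trans ?_
  have hm : Measurable fun ω => ∫⁻ x, ‖W x ω‖ₑ ^ 2 ∂surf := h.measurable_sq.lintegral_prod_right'
  rw [lintegral_const_mul _ hm]
  exact mul_le_mul_right h.lintegral_le _

lemma lintegral_enorm_sq_lt_top (hg : Continuous g) : ∫⁻ x, ‖g x‖ₑ ^ 2 ∂surf < ∞ :=
  (memLp_two_iff_lintegral.mp (memLp_of_continuous hg 2)).2

lemma memLp_harmonicCoeff (h : IsSecondOrderField P W c) (hg : Continuous g) :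
    MemLp (harmonicCoeff g W) 2 P :=
  memLp_two_iff_lintegral.mpr ⟨(h.measurable_harmonicCoeff hg).aestronglyMeasurable,
    (h.lintegral_harmonicCoeff_le hg).trans_lt (ENNReal.mul_lt_top (lintegral_enorm_sq_lt_top hg)
      (ENNReal.mul_lt_top h.lt_top (measure_lt_top _ _)))⟩

lemma integral_harmonicCoeff_mul (h : IsSecondOrderField P W c) (hg : Continuous g) {Y : Ω → ℝ}
    (hY : MemLp Y 2 P) : ∫ ω, harmonicCoeff g W ω * Y ω ∂P =
      ∫ x, g x * ∫ ω, W x ω * Y ω ∂P ∂surf := by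
  have hm : AEStronglyMeasurable (fun q : Ω × S2 => g q.2 * W q.2 q.1 * Y q.1) (P.prod surf) :=
    ((hg.measurable.comp measurable_snd).mul h.measurable).aestronglyMeasurable.mul hY.1.comp_fst
  have hi : Integrable (fun q : Ω × S2 => g q.2 * W q.2 q.1 * Y q.1) (P.prod surf) := by
    obtain ⟨b, hb⟩ := (isCompact_univ (X := S2)).exists_bound_of_continuousOn hg.continuousOn
    refine (integrable_prod_iff' hm).mpr ⟨.of_forall fun x => ?_, ?_⟩
    · simp only [mul_assoc]
      exact ((h.memLp x).integrable_mul hY).const_mul _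
    · refine Integrable.of_bound hm.prod_swap.norm.integral_prod_right'
        (b * (c.toReal ^ (1 / 2 : ℝ) * ‖hY.norm.toLp‖)) (.of_forall fun x => ?_)
      rw [Real.norm_of_nonneg (integral_nonneg fun y => norm_nonneg _)]
      simp only [mul_assoc, norm_mul, integral_const_mul]
      have h1 := real_inner_le_norm ((h.memLp x).norm.toLp) (hY.norm.toLp)
      rw [inner_toLp] at h1
      have h0 : ‖(h.memLp x).norm.toLp‖ ≤ c.toReal ^ (1 / 2 : ℝ) := by
        rw [Lp.norm_toLp, eLpNorm_norm,
          eLpNorm_eq_lintegral_rpow_enorm_toReal (by norm_num) (by norm_num),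
          ← ENNReal.toReal_rpow]
        simp only [ENNReal.toReal_ofNat, ENNReal.rpow_ofNat]
        exact Real.rpow_le_rpow ENNReal.toReal_nonneg
          (ENNReal.toReal_mono h.lt_top.ne (h.bound x)) (by norm_num)
      refine mul_le_mul (hb x (Set.mem_univ _)) (h1.trans ?_)
        (integral_nonneg fun ω => by positivity) ((norm_nonneg _).trans (hb x (Set.mem_univ _)))
      exact mul_le_mul_of_nonneg_right h0 (norm_nonneg _)
  simp only [harmonicCoeff, ← integral_mul_const]
  rw [integral_integral_swap hi]
  refine integral_congr_ae (.of_forall fun x => ?_)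
  simp only [mul_assoc, integral_const_mul]

/-- By Fubini, a variable orthogonal to every value of the field is orthogonal to the coefficient.
The double orthogonal complement is the closure, so no approximation by Riemann sums is needed. -/
lemma harmonicCoeff_mem_closure (h : IsSecondOrderField P W c) (hg : Continuous g)
    {H : Submodule ℝ (Lp ℝ 2 P)} (hH : ∀ x, (h.memLp x).toLp ∈ H) :
    (h.memLp_harmonicCoeff hg).toLp ∈ H.topologicalClosure := by
  rw [← Submodule.orthogonal_orthogonal_eq_closure, Submodule.mem_orthogonal']
  intro Y hY
  have hY' := (Submodule.mem_orthogonal' _ _).mp hY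
  have h1 : ∀ x, ∫ ω, W x ω * Y ω ∂P = 0 := by
    intro x
    rw [← hY' _ (hH x), inner_eq_integral]
    refine integral_congr_ae ?_
    filter_upwards [(h.memLp x).coeFn_toLp] with ω hω
    rw [hω, mul_comm]
  rw [inner_eq_integral]
  have h2 := h.integral_harmonicCoeff_mul hg (Lp.memLp Y)
  simp only [h1, mul_zero, integral_zero] at h2
  rw [← h2]
  refine integral_congr_ae ?_
  filter_upwards [(h.memLp_harmonicCoeff hg).coeFn_toLp] with ω hω
  rw [hω]

end IsSecondOrderField

end HarmonicCoefficients


/-! ### Legendre series -/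

section LegendreSeries

set_option linter.unusedSectionVars false

open scoped ENNReal NNReal Topology

variable {c : ℕ → ℝ} {R : ℝ → ℝ}

lemma norm_mul_zonal_le (c : ℕ → ℝ) (l : ℕ) {z : ℝ} (hz : z ∈ Set.Icc (-1 : ℝ) 1) :
    ‖c l * zonal l z‖ ≤ (2 * (l : ℝ) + 1) / (4 * Real.pi) * |c l| := by
  rw [norm_mul, Real.norm_eq_abs, Real.norm_eq_abs, mul_comm]
  exact mul_le_mul_of_nonneg_right (abs_zonal_le l hz) (abs_nonneg _)

lemma continuousOn_of_hasSum_zonal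
    (hc : Summable fun l : ℕ => (2 * (l : ℝ) + 1) / (4 * Real.pi) * |c l|)
    (hR : ∀ z ∈ Set.Icc (-1 : ℝ) 1, HasSum (fun l => c l * zonal l z) (R z)) :
    ContinuousOn R (Set.Icc (-1 : ℝ) 1) := by
  have h := continuousOn_tsum (f := fun l z => c l * zonal l z) (s := Set.Icc (-1 : ℝ) 1)
    (fun l => (continuous_const.mul (continuous_zonal l)).continuousOn) hc
    fun l z hz => norm_mul_zonal_le c l hz
  exact h.congr fun z hz => (hR z hz).tsum_eq.symm

lemma memLp_Icc_of_continuousOn (hR : ContinuousOn R (Set.Icc (-1 : ℝ) 1)) (p : ℝ≥0∞) :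
    MemLp R p (volume.restrict (Set.Icc (-1 : ℝ) 1)) := by
  obtain ⟨b, hb⟩ := isCompact_Icc.exists_bound_of_continuousOn hR
  exact MemLp.of_bound (hR.aestronglyMeasurable measurableSet_Icc) b
    ((ae_restrict_iff' measurableSet_Icc).mpr (.of_forall hb))

lemma abs_legendre_eval_le {z : ℝ} (hz : z ∈ Set.Icc (-1 : ℝ) 1) (l : ℕ) :
    |(legendre l).eval z| ≤ 1 := by
  have h := abs_zonal_le l hz
  have h0 : (0 : ℝ) < (2 * (l : ℝ) + 1) / (4 * Real.pi) := by positivity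
  rw [zonal, abs_mul, abs_of_pos h0] at h
  exact le_of_mul_le_mul_left (h.trans (mul_one _).symm.le) h0

lemma coeff_of_hasSum (hc : Summable fun l : ℕ => (2 * (l : ℝ) + 1) / (4 * Real.pi) * |c l|)
    (hR : ∀ z ∈ Set.Icc (-1 : ℝ) 1, HasSum (fun l => c l * zonal l z) (R z)) (l : ℕ) :
    coeff R l = c l := by
  have h : HasSum (fun n => ∫ z in Set.Icc (-1 : ℝ) 1, c n * zonal n z * (legendre l).eval z)
      (∫ z in Set.Icc (-1 : ℝ) 1, R z * (legendre l).eval z) := by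
    refine hasSum_integral_of_dominated_convergence
      (fun n _ => (2 * (n : ℝ) + 1) / (4 * Real.pi) * |c n|) (fun n => ?_) (fun n => ?_)
      (.of_forall fun z => hc) (integrable_const _) ?_
    · exact ((continuous_const.mul (continuous_zonal n)).mul
        (legendre l).continuous).aestronglyMeasurable
    · refine (ae_restrict_iff' measurableSet_Icc).mpr (.of_forall fun z hz => ?_)
      rw [norm_mul]
      exact (mul_le_of_le_one_right (norm_nonneg _) (abs_legendre_eval_le hz l)).trans
        (norm_mul_zonal_le c n hz)
    · exact (ae_restrict_iff' measurableSet_Icc).mpr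
        (.of_forall fun z hz => (hR z hz).mul_right _)
  have h2 := h.mul_left (2 * Real.pi)
  have h3 : (fun n => 2 * Real.pi *
      ∫ z in Set.Icc (-1 : ℝ) 1, c n * zonal n z * (legendre l).eval z) =
      fun n => if n = l then c l else 0 := by
    ext n
    have := coeff_zonal n l
    unfold coeff at this
    simp_rw [mul_assoc (c n), integral_const_mul]
    rw [mul_left_comm, this]
    split_ifs with hn <;> simp [hn]
  rw [h3] at h2
  exact h2.unique (hasSum_ite_eq l (c l))

end LegendreSeries

/-! ### The harmonic coefficients of a spherical autoregression -/

section FieldCoefficients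

set_option linter.unusedSectionVars false

open scoped ENNReal NNReal Topology

variable {Ω : Type*} [MeasurableSpace Ω] {P : Measure Ω} [IsProbabilityMeasure P]
  {T Z : S2 → ℤ → Ω → ℝ} {C : ℕ → ℝ} {l : ℕ} {e : Fin (2 * l + 1) → S2 → ℝ}

lemma lintegral_enorm_sq_eq {X : Ω → ℝ} (hX : MemLp X 2 P) :
    ∫⁻ ω, ‖X ω‖ₑ ^ 2 ∂P = ENNReal.ofReal (∫ ω, X ω * X ω ∂P) := by
  have hi : Integrable (fun ω => X ω * X ω) P := hX.integrable_mul hX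
  rw [ofReal_integral_eq_lintegral_ofReal hi (.of_forall fun ω => mul_self_nonneg _)]
  refine lintegral_congr fun ω => ?_
  rw [enorm_sq_eq, sq]

lemma IsGaussianIsotropicStationary.exists_isSecondOrderField
    (hT : IsGaussianIsotropicStationary P T) :
    ∃ c, ∀ t, IsSecondOrderField P (fun x => T x t) c := by
  obtain ⟨Γ, hΓ⟩ := hT.covariance
  refine ⟨ENNReal.ofReal (Γ 1 0), fun t => ⟨?_, fun x => ?_, ENNReal.ofReal_lt_top⟩⟩
  · exact hT.measurable.comp
      (by fun_prop : Measurable fun q : Ω × S2 => (q.1, q.2, t))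
  · rw [lintegral_enorm_sq_eq (hT.gaussian.hasGaussianLaw_eval (x, t)).memLp_two, hΓ, dot_self,
      sub_self]

namespace IsSphericalWhiteNoise

lemma memLp (hZ : IsSphericalWhiteNoise P Z C) (x : S2) (t : ℤ) : MemLp (Z x t) 2 P :=
  ((hZ.gaussian t).hasGaussianLaw_eval x).memLp_two

lemma exists_isSecondOrderField (hZ : IsSphericalWhiteNoise P Z C) :
    ∃ c, ∀ t, IsSecondOrderField P (fun x => Z x t) c := by
  refine ⟨ENNReal.ofReal (∑' l, C l * zonal l 1), fun t => ⟨?_, fun x => ?_,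
    ENNReal.ofReal_lt_top⟩⟩
  · exact hZ.measurable.comp
      (by fun_prop : Measurable fun q : Ω × S2 => (q.1, q.2, t))
  · have h := hZ.covariance t x x
    rw [dot_self] at h
    rw [lintegral_enorm_sq_eq (hZ.memLp x t), h.tsum_eq]

lemma integral_mul_of_ne (hZ : IsSphericalWhiteNoise P Z C) {s t : ℤ} (hst : s ≠ t) (x y : S2) :
    ∫ ω, Z x s ω * Z y t ω ∂P = 0 := by
  have h := (hZ.indep.indepFun hst).comp (measurable_pi_apply x) (measurable_pi_apply y)
  have := h.integral_fun_mul_eq_mul_integral (hZ.memLp x s).1 (hZ.memLp y t).1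
  simp only [Function.comp_def] at this
  rw [this, hZ.mean_zero, zero_mul]

/-- Fubini twice reduces the claim to the covariance operator, an isotropic kernel operator whose
Legendre coefficient of degree `l` is `C l`. -/
lemma integral_harmonicCoeff_mul_harmonicCoeff (hZ : IsSphericalWhiteNoise P Z C)
    (he : IsHarmonicBasis l e) (m m' : Fin (2 * l + 1)) (s t : ℤ) :
    ∫ ω, harmonicCoeff (e m) (fun x => Z x s) ω * harmonicCoeff (e m') (fun x => Z x t) ω ∂P =
      if m = m' ∧ s = t then C l else 0 := by
  obtain ⟨c, hc⟩ := hZ.exists_isSecondOrderField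
  rw [(hc s).integral_harmonicCoeff_mul (he.continuous m)
    ((hc t).memLp_harmonicCoeff (he.continuous m'))]
  have h1 : ∀ x, ∫ ω, Z x s ω * harmonicCoeff (e m') (fun x => Z x t) ω ∂P =
      ∫ y, e m' y * ∫ ω, Z y t ω * Z x s ω ∂P ∂surf := fun x => by
    rw [← (hc t).integral_harmonicCoeff_mul (he.continuous m') (hZ.memLp x s)]
    simp only [mul_comm]
  simp_rw [h1]
  by_cases hst : s = t
  · subst hst
    have hsum : Summable fun l : ℕ => (2 * (l : ℝ) + 1) / (4 * Real.pi) * |C l| := by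
      simpa only [abs_of_nonneg (hZ.spectrum_nonneg _)] using hZ.spectrum_summable
    let R : ℝ → ℝ := fun z => ∑' l, C l * zonal l z
    have hR : ∀ z ∈ Set.Icc (-1 : ℝ) 1, HasSum (fun l => C l * zonal l z) (R z) := fun z hz =>
      (Summable.of_norm_bounded hsum fun l => norm_mul_zonal_le C l hz).hasSum
    have h2 : ∀ x, ∫ y, e m' y * ∫ ω, Z y s ω * Z x s ω ∂P ∂surf = C l * e m' x := fun x => by
      rw [← coeff_of_hasSum hsum hR l, ← he.integral_kernel_mul
        (memLp_Icc_of_continuousOn (continuousOn_of_hasSum_zonal hsum hR) 2)]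
      refine integral_congr_ae (.of_forall fun y => ?_)
      simp only [R]
      rw [dot_comm, ← (hZ.covariance s y x).tsum_eq, mul_comm]
    simp_rw [h2, mul_left_comm _ (C l), integral_const_mul, he.orthonormal]
    simp
  · simp [hZ.integral_mul_of_ne (Ne.symm hst), hst]

end IsSphericalWhiteNoise

/-- The equation, integrated against a harmonic, of which the kernel operators are symmetric with
eigenvalue `coeff (k j) l`. It must first hold almost surely for almost every `x` simultaneously. -/
lemma harmonicCoeff_recursion {p : ℕ} {k : Fin p → ℝ → ℝ} (hT : IsGaussianIsotropicStationary P T)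
    (hZ : IsSphericalWhiteNoise P Z C) (hAR : IsSPHAR P k T Z) (he : IsHarmonicBasis l e)
    (m : Fin (2 * l + 1)) (t : ℤ) : ∀ᵐ ω ∂P, harmonicCoeff (e m) (fun x => T x t) ω =
      ∑ j, coeff (k j) l * harmonicCoeff (e m) (fun x => T x (t - ((j : ℤ) + 1))) ω +
        harmonicCoeff (e m) (fun x => Z x t) ω := by
  obtain ⟨cT, hcT⟩ := hT.exists_isSecondOrderField
  obtain ⟨cZ, hcZ⟩ := hZ.exists_isSecondOrderField
  have h1 : ∀ᵐ ω ∂P, ∀ᵐ x ∂surf, T x t ω =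
      (∑ j : Fin p, kernelOp (k j) (fun y => T y (t - ((j : ℤ) + 1)) ω) x) + Z x t ω := by
    -- Borel versions of the kernels leave the operators unchanged and make the exceptional set
    -- jointly measurable, so that the quantifiers over `ω` and `x` can be exchanged.
    let k' : Fin p → ℝ → ℝ := fun j => (hAR.memLp j).1.mk
    have hk' : ∀ j, Measurable (k' j) := fun j => (hAR.memLp j).1.stronglyMeasurable_mk.measurable
    have hm : ∀ j : Fin p, Measurable fun q : Ω × S2 =>
        kernelOp (k' j) (fun y => T y (t - ((j : ℤ) + 1)) q.1) q.2 := by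
      intro j
      have : StronglyMeasurable fun q : (Ω × S2) × S2 =>
          k' j (dot q.1.2 q.2) * T q.2 (t - ((j : ℤ) + 1)) q.1.1 := by
        refine Measurable.stronglyMeasurable (((hk' j).comp ?_).mul ?_)
        · exact continuous_dot.measurable.comp
            (by fun_prop : Measurable fun q : (Ω × S2) × S2 => (q.1.2, q.2))
        · exact (hcT (t - ((j : ℤ) + 1))).measurable.comp
            (by fun_prop : Measurable fun q : (Ω × S2) × S2 => (q.1.1, q.2))
      exact this.integral_prod_right'.measurable
    have hk : ∀ j f x, kernelOp (k j) f x = kernelOp (k' j) f x := fun j f x =>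
      kernelOp_congr (hAR.memLp j).1.ae_eq_mk f x
    simp_rw [hk]
    refine (Measure.ae_ae_comm ?_).mpr (.of_forall fun x => ?_)
    · exact measurableSet_eq_fun (hcT t).measurable
        ((Finset.measurable_sum _ fun j _ => hm j).add (hcZ t).measurable)
    · filter_upwards [hAR.equation x t] with ω hω
      rw [hω]
      simp_rw [hk]
  have h2 : ∀ᵐ ω ∂P, ∀ s, MemLp (fun x => T x s ω) 2 surf :=
    ae_all_iff.mpr fun s => (hcT s).ae_memLp
  filter_upwards [h1, h2, (hcZ t).ae_memLp] with ω h3 h4 h5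
  have hint : ∀ {f : S2 → ℝ}, MemLp f 2 surf → Integrable (fun x => e m x * f x) surf :=
    fun hf => (memLp_of_continuous (he.continuous m) 2).integrable_mul hf
  calc harmonicCoeff (e m) (fun x => T x t) ω
      = ∫ x, ((∑ j : Fin p, e m x * kernelOp (k j) (fun y => T y (t - ((j : ℤ) + 1)) ω) x) +
          e m x * Z x t ω) ∂surf := by
        refine integral_congr_ae ?_
        filter_upwards [h3] with x hx
        rw [hx, mul_add, Finset.mul_sum]
    _ = _ := by
        rw [integral_add (integrable_finsetSum _ fun j _ =>
          hint (memLp_kernelOp (hAR.memLp j) (h4 _))) (hint h5),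
          integral_finsetSum _ fun j _ => hint (memLp_kernelOp (hAR.memLp j) (h4 _))]
        simp_rw [he.integral_mul_kernelOp (hAR.memLp _) (h4 _)]
        rfl

end FieldCoefficients


/-! ### Impulse responses -/

section ImpulseResponse

set_option linter.unusedSectionVars false

open scoped ENNReal NNReal Topology Real

variable {p : ℕ}

/-- The autoregressive polynomial with coefficients `φ`. -/
noncomputable def arPoly (φ : Fin p → ℝ) (z : ℂ) : ℂ :=
  1 - ∑ j : Fin p, (φ j : ℂ) * z ^ ((j : ℕ) + 1)

lemma differentiable_arPoly (φ : Fin p → ℝ) : Differentiable ℂ (arPoly φ) := by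
  unfold arPoly
  fun_prop

/-- The coefficients of the Laurent expansion of `1 / φ(z)` satisfy the recursion and decay
exponentially. -/
lemma exists_impulseResponse (φ : Fin p → ℝ) {ρ ε : ℝ} (hρ : 0 < ρ) (hε : 0 < ε)
    (hne : ∀ z : ℂ, ‖z‖ ≤ ρ → arPoly φ z ≠ 0) (hlow : ∀ z : ℂ, ‖z‖ = ρ → ε ≤ ‖arPoly φ z‖) :
    ∃ ψ : ℤ → ℝ, (∀ k < 0, ψ k = 0) ∧
      (∀ k, ψ k = (if k = 0 then 1 else 0) + ∑ j : Fin p, φ j * ψ (k - ((j : ℤ) + 1))) ∧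
      ∀ k, |ψ k| ≤ ε⁻¹ * ρ ^ (-k) := by
  have hd := differentiable_arPoly φ
  have hz0 : ∀ z ∈ Metric.sphere (0 : ℂ) ρ, z ≠ 0 := fun z hz h => by simp [h] at hz; linarith
  have hzρ : ∀ z ∈ Metric.sphere (0 : ℂ) ρ, ‖z‖ = ρ := fun z hz => by simpa using hz
  have hint : ∀ n : ℤ, CircleIntegrable (fun z : ℂ => (arPoly φ z)⁻¹ * z ^ n) 0 ρ := fun n => by
    refine ContinuousOn.circleIntegrable hρ.le (ContinuousOn.mul ?_ ?_)
    · exact hd.continuous.continuousOn.inv₀ fun z hz => hne z (hzρ z hz).le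
    · exact fun z hz => (continuousAt_zpow₀ z n (.inl (hz0 z hz))).continuousWithinAt
  have hint' : ∀ (r : ℝ) (n : ℤ),
      CircleIntegrable (fun z : ℂ => (r : ℂ) * ((arPoly φ z)⁻¹ * z ^ n)) 0 ρ :=
    fun r n => (hint n).const_smul
  -- Cauchy's formula for the Taylor coefficients of `1/φ`, written for all integers `k`.
  let c : ℤ → ℂ := fun k =>
    (2 * π * Complex.I : ℂ)⁻¹ • ∮ z in C(0, ρ), (arPoly φ z)⁻¹ * z ^ (-k - 1)
  have hrec : ∀ k, c k = (if k = 0 then 1 else 0) +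
      ∑ j : Fin p, (φ j : ℂ) * c (k - ((j : ℤ) + 1)) := by
    intro k
    have h1 : ∑ j : Fin p, (φ j : ℂ) * c (k - ((j : ℤ) + 1)) = (2 * π * Complex.I : ℂ)⁻¹ •
        ∮ z in C(0, ρ), ∑ j : Fin p, (φ j : ℂ) *
          ((arPoly φ z)⁻¹ * z ^ (-(k - ((j : ℤ) + 1)) - 1)) := by
      rw [circleIntegral.integral_fun_sum fun j _ => hint' (φ j) _, Finset.smul_sum]
      refine Finset.sum_congr rfl fun j _ => ?_
      rw [circleIntegral.integral_const_mul, smul_eq_mul, mul_left_comm, ← smul_eq_mul (a := _⁻¹)]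
    -- The combination integrates `φ(z)⁻¹ φ(z) z^(-k-1)`, so only the residue of a power of `z` is
    -- left.
    have h2 : c k - ∑ j : Fin p, (φ j : ℂ) * c (k - ((j : ℤ) + 1)) =
        (2 * π * Complex.I : ℂ)⁻¹ • ∮ z in C(0, ρ), z ^ (-k - 1) := by
      rw [h1, ← smul_sub, ← circleIntegral.integral_sub (hint _)]
      · congr 1
        refine circleIntegral.integral_congr hρ.le fun z hz => ?_
        have hq := hne z (hzρ z hz).le
        have h3 : ∀ j : Fin p, (φ j : ℂ) * ((arPoly φ z)⁻¹ * z ^ (-(k - ((j : ℤ) + 1)) - 1)) =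
            (arPoly φ z)⁻¹ * z ^ (-k - 1) * (φ j * z ^ ((j : ℕ) + 1)) := fun j => by
          have : z ^ (-(k - ((j : ℤ) + 1)) - 1) = z ^ (-k - 1) * z ^ ((j : ℕ) + 1) := by
            rw [← zpow_natCast, ← zpow_add₀ (hz0 z hz)]
            congr 1
            push_cast
            ring
          rw [this]
          ring
        simp only [h3]
        rw [← Finset.mul_sum]
        have h4 : ∑ j : Fin p, (φ j : ℂ) * z ^ ((j : ℕ) + 1) = 1 - arPoly φ z := by
          rw [arPoly]; ring
        rw [h4]
        field_simp
        ring
      · exact CircleIntegrable.fun_sum _ fun j _ => hint' (φ j) _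
    have h3 : (2 * π * Complex.I : ℂ)⁻¹ • ∮ z in C(0, ρ), z ^ (-k - 1) =
        if k = 0 then 1 else 0 := by
      split_ifs with hk
      · have h4 := circleIntegral.integral_sub_center_inv 0 hρ.ne'
        simp only [sub_zero] at h4
        simp only [hk, neg_zero, zero_sub, zpow_neg_one]
        rw [h4, smul_eq_mul, inv_mul_cancel₀ Complex.two_pi_I_ne_zero]
      · have h4 := circleIntegral.integral_sub_zpow_of_ne (n := -k - 1) (by omega) 0 0 ρ
        simp only [sub_zero] at h4
        rw [h4, smul_zero]
    rw [← h3, ← h2]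
    ring
  -- As the `φ j` are real, real parts satisfy the same recursion. For `k < 0` the integrand is
  -- holomorphic in the disk; the decay is the trivial bound on the circle.
  refine ⟨fun k => (c k).re, fun k hk => ?_, fun k => ?_, fun k => ?_⟩
  · have h1 : ∮ z in C(0, ρ), (arPoly φ z)⁻¹ * z ^ (-k - 1) = 0 := by
      refine DiffContOnCl.circleIntegral_eq_zero hρ.le (DifferentiableOn.diffContOnCl ?_)
      rw [closure_ball _ hρ.ne']
      obtain ⟨n, hn⟩ : ∃ n : ℕ, -k - 1 = n := ⟨(-k - 1).toNat, by omega⟩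
      simp only [hn, zpow_natCast]
      refine DifferentiableOn.mul (hd.differentiableOn.inv fun z hz => hne z (by simpa using hz)) ?_
      fun_prop
    simp [c, h1]
  · simp only
    rw [hrec k, Complex.add_re, Complex.re_sum]
    congr 1
    · split_ifs <;> simp
    · simp
  · refine (Complex.abs_re_le_norm _).trans ?_
    refine (circleIntegral.norm_two_pi_i_inv_smul_integral_le_of_norm_le_const hρ.le
      (C := ε⁻¹ * ρ ^ (-k - 1)) fun z hz => ?_).trans (le_of_eq ?_)
    · rw [norm_mul, norm_inv, norm_zpow, hzρ z hz]
      gcongr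
      exact hlow z (hzρ z hz)
    · rw [zpow_sub_one₀ hρ.ne']
      field_simp

lemma hasSum_abs_impulseResponse_le {ψ : ℤ → ℝ} {ρ M : ℝ} (hρ : 1 < ρ) (hneg : ∀ k < 0, ψ k = 0)
    (hM : ∀ k, |ψ k| ≤ M * ρ ^ (-k)) :
    Summable (fun k => |ψ k|) ∧ ∑' k, |ψ k| ≤ M * (1 - ρ⁻¹)⁻¹ := by
  have hg : HasSum (fun n : ℕ => M * ρ⁻¹ ^ n) (M * (1 - ρ⁻¹)⁻¹) :=
    (hasSum_geometric_of_lt_one (by positivity) (inv_lt_one_of_one_lt₀ hρ)).mul_left M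
  have hle : ∀ n : ℕ, |ψ n| ≤ M * ρ⁻¹ ^ n := fun n => by
    simpa [zpow_neg, inv_pow] using hM n
  have hsupp : ∀ k ∉ Set.range (Nat.cast : ℕ → ℤ), |ψ k| = 0 := fun k hk => by
    rw [hneg k, abs_zero]
    by_contra h
    exact hk ⟨k.toNat, by omega⟩
  have hs : Summable fun n : ℕ => |ψ n| :=
    Summable.of_nonneg_of_le (fun n => abs_nonneg _) hle hg.summable
  have hinj : Function.Injective (Nat.cast : ℕ → ℤ) := Nat.cast_injective
  refine ⟨(hinj.summable_iff hsupp).mp hs, ?_⟩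
  rw [← hinj.tsum_eq (f := fun k => |ψ k|)]
  · exact hs.tsum_le_of_sum_le fun s => (Finset.sum_le_sum fun n _ => hle n).trans
      (sum_le_hasSum s (fun n _ => (abs_nonneg _).trans (hle n)) hg)
  · intro k hk
    by_contra h
    exact hk (hsupp k h)

/-- A bounded solution of an autoregression is the moving average of the noise. -/
lemma hasSum_of_recursion {E : Type*} [NormedAddCommGroup E] [NormedSpace ℝ E] [CompleteSpace E]
    {a z : ℤ → E} {φ : Fin p → ℝ} {ψ : ℤ → ℝ} {b : ℝ} (hb : ∀ t, ‖a t‖ ≤ b)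
    (ha : ∀ t, a t = ∑ j, φ j • a (t - ((j : ℤ) + 1)) + z t) (hψ : Summable fun k => |ψ k|)
    (hrec : ∀ k, ψ k = (if k = 0 then 1 else 0) + ∑ j : Fin p, φ j * ψ (k - ((j : ℤ) + 1)))
    (t : ℤ) : HasSum (fun k => ψ k • z (t - k)) (a t) := by
  have hs : ∀ s, Summable fun k => ψ k • a (s - k) := fun s => by
    refine Summable.of_norm_bounded (g := fun k => |ψ k| * b) (hψ.mul_right b) fun k => ?_
    rw [norm_smul, Real.norm_eq_abs]
    exact mul_le_mul_of_nonneg_left (hb _) (abs_nonneg _)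
  have hA := (hs t).hasSum
  have hB : ∀ j : Fin p, HasSum (fun k => φ j • ψ k • a (t - ((j : ℤ) + 1) - k))
      (φ j • ∑' k, ψ k • a (t - ((j : ℤ) + 1) - k)) := fun j =>
    (hs (t - ((j : ℤ) + 1))).hasSum.const_smul _
  have hB' : ∀ j : Fin p, HasSum (fun k => (φ j * ψ (k - ((j : ℤ) + 1))) • a (t - k))
      (φ j • ∑' k, ψ k • a (t - ((j : ℤ) + 1) - k)) := fun j => by
    refine ((Equiv.subRight ((j : ℤ) + 1)).hasSum_iff.mpr (hB j)).congr_fun fun k => ?_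
    simp only [Function.comp_apply, Equiv.subRight_apply, smul_smul]
    congr 2
    ring
  -- Substitute the recursion for `z`. In `h2` the same sum is reindexed, and the recursion for `ψ`
  -- collapses the coefficients of `a` to the indicator of `k = 0`.
  have h1 : HasSum (fun k => ψ k • z (t - k))
      (∑' k, ψ k • a (t - k) - ∑ j : Fin p, φ j • ∑' k, ψ k • a (t - ((j : ℤ) + 1) - k)) := by
    refine (hA.sub (hasSum_sum fun j _ => hB j)).congr_fun fun k => ?_
    have : z (t - k) = a (t - k) - ∑ j, φ j • a (t - k - ((j : ℤ) + 1)) := by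
      rw [ha (t - k)]; abel
    rw [this, smul_sub, Finset.smul_sum]
    congr 1
    refine Finset.sum_congr rfl fun j _ => ?_
    rw [smul_comm, sub_right_comm]
  have h2 : HasSum (fun k => (if k = 0 then (1 : ℝ) else 0) • a (t - k))
      (∑' k, ψ k • a (t - k) - ∑ j : Fin p, φ j • ∑' k, ψ k • a (t - ((j : ℤ) + 1) - k)) := by
    refine (hA.sub (hasSum_sum fun j _ => hB' j)).congr_fun fun k => ?_
    rw [← Finset.sum_smul, ← sub_smul]
    congr 1
    rw [hrec k]
    ring
  have h3 : HasSum (fun k => (if k = 0 then (1 : ℝ) else 0) • a (t - k)) (a t) := by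
    convert hasSum_ite_eq (0 : ℤ) (a t) using 2 with k
    split_ifs with hk <;> simp [hk]
  rwa [h2.unique h3] at h1

end ImpulseResponse


/-! ### The autoregressions of the harmonic coefficients -/

section HarmonicAutoregression

set_option linter.unusedSectionVars false

open scoped ENNReal NNReal Topology

variable {Ω : Type*} [MeasurableSpace Ω] {P : Measure Ω} [IsProbabilityMeasure P]
  {T Z : S2 → ℤ → Ω → ℝ} {C : ℕ → ℝ} {p : ℕ} {k : Fin p → ℝ → ℝ}

/-- For large `l` the coefficients are so small that the polynomial differs from `1` by at most
`1/2` on the circle; for the finitely many other degrees compactness and nonvanishing suffice. -/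
lemma exists_uniform_lower_bound (hstat : StationarityCondition k)
    (hcoeff : ∀ j, Tendsto (fun l => coeff (k j) l) atTop (𝓝 0)) :
    ∃ ρ ε : ℝ, 1 < ρ ∧ 0 < ε ∧ ∀ l,
      (∀ z : ℂ, ‖z‖ ≤ ρ → arPoly (fun j => coeff (k j) l) z ≠ 0) ∧
      ∀ z : ℂ, ‖z‖ = ρ → ε ≤ ‖arPoly (fun j => coeff (k j) l) z‖ := by
  obtain ⟨δ, hδ, hne⟩ := hstat
  have hρ : 0 ≤ 1 + δ := by linarith
  have hS : Tendsto (fun l => ∑ j, |coeff (k j) l| * (1 + δ) ^ ((j : ℕ) + 1)) atTop (𝓝 0) := by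
    have := tendsto_finsetSum (Finset.univ : Finset (Fin p)) fun j _ =>
      ((hcoeff j).abs.mul_const ((1 + δ) ^ ((j : ℕ) + 1)))
    simpa using this
  obtain ⟨l₀, hl₀⟩ := eventually_atTop.mp (hS.eventually_le_const (by norm_num : (0 : ℝ) < 1 / 2))
  have hlarge : ∀ l ≥ l₀, ∀ z : ℂ, ‖z‖ = 1 + δ →
      1 / 2 ≤ ‖arPoly (fun j => coeff (k j) l) z‖ := by
    intro l hl z hz
    have h1 : ‖∑ j : Fin p, (coeff (k j) l : ℂ) * z ^ ((j : ℕ) + 1)‖ ≤ 1 / 2 := by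
      refine (norm_sum_le _ _).trans (le_trans (le_of_eq ?_) (hl₀ l hl))
      refine Finset.sum_congr rfl fun j _ => ?_
      rw [norm_mul, norm_pow, hz, Complex.norm_real, Real.norm_eq_abs]
    have h2 := norm_sub_norm_le (1 : ℂ) (∑ j : Fin p, (coeff (k j) l : ℂ) * z ^ ((j : ℕ) + 1))
    rw [norm_one] at h2
    rw [arPoly]
    linarith
  have hsmall : ∀ n : ℕ, ∃ ε : ℝ, 0 < ε ∧ ∀ l < n, ∀ z : ℂ, ‖z‖ = 1 + δ →
      ε ≤ ‖arPoly (fun j => coeff (k j) l) z‖ := by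
    intro n
    induction n with
    | zero => exact ⟨1, one_pos, fun l hl => absurd hl (Nat.not_lt_zero l)⟩
    | succ n ih =>
      obtain ⟨ε, hε, h⟩ := ih
      obtain ⟨w, hw, hmin⟩ := (isCompact_sphere (0 : ℂ) (1 + δ)).exists_isMinOn
        (NormedSpace.sphere_nonempty.mpr hρ)
        (differentiable_arPoly fun j => coeff (k j) n).continuous.norm.continuousOn
      refine ⟨min ε ‖arPoly (fun j => coeff (k j) n) w‖, lt_min hε (norm_pos_iff.mpr
        (hne n w (by simpa using hw.le))), fun l hl z hz => ?_⟩
      rcases Nat.lt_succ_iff_lt_or_eq.mp hl with hl | rfl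
      · exact (min_le_left _ _).trans (h l hl z hz)
      · exact (min_le_right _ _).trans (hmin (by simpa using hz))
  obtain ⟨ε, hε, h⟩ := hsmall l₀
  refine ⟨1 + δ, min ε (1 / 2), by linarith, lt_min hε (by norm_num), fun l =>
    ⟨fun z hz => hne l z hz, fun z hz => ?_⟩⟩
  rcases lt_or_ge l l₀ with hl | hl
  · exact (min_le_left _ _).trans (h l hl z hz)
  · exact (min_le_right _ _).trans (hlarge l hl z hz)

lemma exists_sum_abs_coeff_le (hcoeff : ∀ j, Tendsto (fun l => coeff (k j) l) atTop (𝓝 0)) :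
    ∃ b : ℝ, ∀ l, ∑ j, |coeff (k j) l| ≤ b := by
  have h := tendsto_finsetSum (Finset.univ : Finset (Fin p)) fun j _ => (hcoeff j).abs
  obtain ⟨b, hb⟩ := h.bddAbove_range
  exact ⟨b, fun l => hb ⟨l, rfl⟩⟩

lemma norm_sq_toLp {X : Ω → ℝ} (hX : MemLp X 2 P) {b : ℝ≥0∞} (hb : b < ∞)
    (h : ∫⁻ ω, ‖X ω‖ₑ ^ 2 ∂P ≤ b) : ‖hX.toLp‖ ^ 2 ≤ b.toReal := by
  rw [← real_inner_self_eq_norm_sq, inner_toLp]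
  rw [lintegral_enorm_sq_eq hX] at h
  exact (ENNReal.ofReal_le_iff_le_toReal hb.ne).mp h

/-- The normalised harmonic coefficients of a given degree form a family of Gaussian
autoregressions, with bounds which are uniform in the degree. -/
theorem exists_isARFamily (hT : IsGaussianIsotropicStationary P T)
    (hZ : IsSphericalWhiteNoise P Z C) (hAR : IsSPHAR P k T Z) (hstat : StationarityCondition k)
    (hident : ∀ l, 0 < C l) (hcoeff : ∀ j, Tendsto (fun l => coeff (k j) l) atTop (𝓝 0)) :
    ∃ (H : Submodule ℝ (Lp ℝ 2 P)) (K₀ : ℝ), ∀ l (e : Fin (2 * l + 1) → S2 → ℝ),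
      IsHarmonicBasis l e → ∃ (ψ : ℤ → ℝ) (a z : Fin (2 * l + 1) → ℤ → Lp ℝ 2 P),
        IsARFamily H (fun j => coeff (k j) l) ψ K₀ a z ∧
        (∀ m s, a m s =ᵐ[P] fun ω => (√(C l))⁻¹ * harmonicCoeff (e m) (fun x => T x s) ω) ∧
        ∀ m s, z m s =ᵐ[P] fun ω => (√(C l))⁻¹ * harmonicCoeff (e m) (fun x => Z x s) ω := by
  obtain ⟨cT, hcT⟩ := hT.exists_isSecondOrderField
  obtain ⟨cZ, hcZ⟩ := hZ.exists_isSecondOrderField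
  obtain ⟨ρ, ε, hρ, hε, hpoly⟩ := exists_uniform_lower_bound hstat hcoeff
  obtain ⟨b, hb⟩ := exists_sum_abs_coeff_le hcoeff
  let Y : S2 × ℤ → Lp ℝ 2 P := fun q => (hZ.memLp q.1 q.2).toLp
  have hG : IsGaussianSpace (Submodule.span ℝ (Set.range Y)).topologicalClosure :=
    (isGaussianSpace_span hZ.gaussian hZ.mean_zero hZ.indep
      fun q => (hZ.memLp q.1 q.2).coeFn_toLp).topologicalClosure
  -- The second entry is the square of the bound for `∑ |ψ k|`, which controls the variance of a
  -- moving average of unit noise uniformly in the degree.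
  refine ⟨(Submodule.span ℝ (Set.range Y)).topologicalClosure, max b ((ε⁻¹ * (1 - ρ⁻¹)⁻¹) ^ 2), fun l e he => ?_⟩
  obtain ⟨ψ, hneg, hrec, hψ⟩ := exists_impulseResponse (fun j => coeff (k j) l)
    (by linarith) hε (hpoly l).1 (hpoly l).2
  obtain ⟨hsum, hle⟩ := hasSum_abs_impulseResponse_le hρ hneg hψ
  set A : Fin (2 * l + 1) → ℤ → Lp ℝ 2 P := fun m s =>
    ((hcT s).memLp_harmonicCoeff (he.continuous m)).toLp with hA
  set ζ : Fin (2 * l + 1) → ℤ → Lp ℝ 2 P := fun m s =>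
    ((hcZ s).memLp_harmonicCoeff (he.continuous m)).toLp with hζ
  have hsC : 0 < √(C l) := Real.sqrt_pos.mpr (hident l)
  have hζmem : ∀ m s, ζ m s ∈ (Submodule.span ℝ (Set.range Y)).topologicalClosure := fun m s =>
    (hcZ s).harmonicCoeff_mem_closure (he.continuous m)
      fun x => Submodule.subset_span ⟨(x, s), rfl⟩
  have hrecA : ∀ m t, A m t = ∑ j, coeff (k j) l • A m (t - ((j : ℤ) + 1)) + ζ m t := by
    intro m t
    refine Lp.ext ?_
    have h1 : ∀ᵐ ω ∂P, ∀ s, A m s ω = harmonicCoeff (e m) (fun x => T x s) ω :=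
      ae_all_iff.mpr fun s => ((hcT s).memLp_harmonicCoeff (he.continuous m)).coeFn_toLp
    have h2 : ∀ᵐ ω ∂P, ∀ j : Fin p, (coeff (k j) l • A m (t - ((j : ℤ) + 1)) : Lp ℝ 2 P) ω =
        coeff (k j) l * A m (t - ((j : ℤ) + 1)) ω := ae_all_iff.mpr fun j => by
      filter_upwards [Lp.coeFn_smul (coeff (k j) l) (A m (t - ((j : ℤ) + 1)))] with ω hω
      rw [hω, Pi.smul_apply, smul_eq_mul]
    filter_upwards [h1, h2, ((hcZ t).memLp_harmonicCoeff (he.continuous m)).coeFn_toLp,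
      Lp.coeFn_add (∑ j : Fin p, coeff (k j) l • A m (t - ((j : ℤ) + 1))) (ζ m t),
      Lp.coeFn_finsetSum Finset.univ fun j : Fin p => coeff (k j) l • A m (t - ((j : ℤ) + 1)),
      harmonicCoeff_recursion hT hZ hAR he m t] with ω h3 h4 h5 h6 h7 h8
    rw [h6, Pi.add_apply, h7, Finset.sum_apply, h3, h8, hζ, h5]
    congr 1
    exact Finset.sum_congr rfl fun j _ => by rw [h4, h3]
  set a : Fin (2 * l + 1) → ℤ → Lp ℝ 2 P := fun m s => (√(C l))⁻¹ • A m s with ha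
  set z : Fin (2 * l + 1) → ℤ → Lp ℝ 2 P := fun m s => (√(C l))⁻¹ • ζ m s with hz
  have hzmem : ∀ m s, z m s ∈ (Submodule.span ℝ (Set.range Y)).topologicalClosure := fun m s =>
    Submodule.smul_mem _ _ (hζmem m s)
  have hinner : ∀ m m' s s', inner ℝ (z m s) (z m' s') = if m = m' ∧ s = s' then 1 else 0 := by
    intro m m' s s'
    simp only [hz, inner_smul_left, inner_smul_right, hζ]
    rw [inner_toLp, hZ.integral_harmonicCoeff_mul_harmonicCoeff he]
    split_ifs
    · simp only [conj_trivial]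
      rw [← mul_assoc, ← mul_inv, Real.mul_self_sqrt (hident l).le, inv_mul_cancel₀ (hident l).ne']
    · simp
  have hnormz : ∀ m s, ‖z m s‖ = 1 := fun m s => by
    have h1 := hinner m m s s
    rw [real_inner_self_eq_norm_sq] at h1
    simp only [and_self, if_true] at h1
    exact (pow_eq_one_iff_of_nonneg (norm_nonneg _) two_ne_zero).mp h1
  -- Boundedness in time, from the stationarity of `T`. The bound may depend on `l`: it serves only
  -- to identify `a` with the moving average of `z`.
  have hbound : ∃ B, ∀ m s, ‖a m s‖ ≤ B := by
    have hfin : ∀ m, (∫⁻ x, ‖e m x‖ₑ ^ 2 ∂surf) * (cT * surf Set.univ) < ∞ := fun m =>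
      ENNReal.mul_lt_top (IsSecondOrderField.lintegral_enorm_sq_lt_top (he.continuous m))
        (ENNReal.mul_lt_top (hcT 0).lt_top (measure_lt_top _ _))
    choose β hβ using fun m => (⟨√((∫⁻ x, ‖e m x‖ₑ ^ 2 ∂surf) * (cT * surf Set.univ)).toReal,
      fun s => Real.le_sqrt_of_sq_le (norm_sq_toLp _ (hfin m)
        ((hcT s).lintegral_harmonicCoeff_le (he.continuous m)))⟩ :
      ∃ β, ∀ s, ‖A m s‖ ≤ β)
    refine ⟨(√(C l))⁻¹ * ∑ m, |β m|, fun m s => ?_⟩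
    rw [ha, norm_smul, Real.norm_of_nonneg (by positivity)]
    gcongr
    exact ((hβ m s).trans (le_abs_self _)).trans
      (Finset.single_le_sum (f := fun m => |β m|) (fun i _ => abs_nonneg _) (Finset.mem_univ m))
  obtain ⟨B, hB⟩ := hbound
  have hma : ∀ m s, HasSum (fun i => ψ i • z m (s - i)) (a m s) := fun m s => by
    refine hasSum_of_recursion (hB m) (fun t => ?_) hsum hrec s
    simp only [ha, hz]
    rw [hrecA m t, smul_add, Finset.smul_sum]
    congr 1
    exact Finset.sum_congr rfl fun j _ => smul_comm _ _ _
  refine ⟨ψ, a, z, ⟨hG, fun m s => ?_, hzmem, hinner, fun m m' s s' => ?_, hneg, hrec,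
    fun m s => ?_, (hb l).trans (le_max_left _ _)⟩, fun m s => ?_, fun m s => ?_⟩
  · exact (Submodule.isClosed_topologicalClosure _).mem_of_tendsto (hma m s)
      (.of_forall fun S => Submodule.sum_mem _ fun i _ => Submodule.smul_mem _ _ (hzmem m _))
  · have h1 := (innerSL ℝ (z m' s')).hasSum (hma m s)
    have h2 : (fun i => innerSL ℝ (z m' s') (ψ i • z m (s - i))) =
        fun i => if i = s - s' then (if m = m' then ψ (s - s') else 0) else 0 := by
      ext i
      rw [innerSL_apply_apply, inner_smul_right, hinner]
      have h3 : (m' = m ∧ s' = s - i) ↔ (i = s - s' ∧ m = m') := by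
        constructor <;> rintro ⟨h, h'⟩ <;> constructor <;> omega
      simp only [h3]
      by_cases h4 : i = s - s' <;> by_cases h5 : m = m' <;> simp [h4, h5]
    rw [h2] at h1
    rw [real_inner_comm]
    exact h1.unique (hasSum_ite_eq _ _)
  · refine le_trans (pow_le_pow_left₀ (norm_nonneg _) ?_ 2) (le_max_right _ _)
    rw [← (hma m s).tsum_eq]
    refine (norm_tsum_le_tsum_norm ?_).trans (le_trans (le_of_eq ?_) hle) <;>
      simp only [norm_smul, hnormz, mul_one, Real.norm_eq_abs]
    exact hsum
  · filter_upwards [Lp.coeFn_smul (√(C l))⁻¹ (A m s),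
      ((hcT s).memLp_harmonicCoeff (he.continuous m)).coeFn_toLp] with ω h1 h2
    rw [h1, Pi.smul_apply, hA, h2, smul_eq_mul]
  · filter_upwards [Lp.coeFn_smul (√(C l))⁻¹ (ζ m s),
      ((hcZ s).memLp_harmonicCoeff (he.continuous m)).coeFn_toLp] with ω h1 h2
    rw [h1, Pi.smul_apply, hζ, h2, smul_eq_mul]

end HarmonicAutoregression


/-! ### The least-squares estimator -/

section LeastSquaresEstimator

set_option linter.unusedSectionVars false

open scoped ENNReal NNReal Topology

lemma continuous_of_mem_zonalSpan {L : ℕ} {κ : ℝ → ℝ} (hκ : κ ∈ zonalSpan L) : Continuous κ := by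
  induction hκ using Submodule.span_induction with
  | mem f hf => obtain ⟨l, -, rfl⟩ := hf; exact continuous_zonal l
  | zero => exact continuous_const
  | add f g _ _ hf hg => exact hf.add hg
  | smul c f _ hf => exact continuous_const.mul hf

lemma coeff_add {κ κ' : ℝ → ℝ} (hκ : IntegrableOn κ (Set.Icc (-1 : ℝ) 1))
    (hκ' : IntegrableOn κ' (Set.Icc (-1 : ℝ) 1)) (l : ℕ) :
    coeff (κ + κ') l = coeff κ l + coeff κ' l := by
  have h : ∀ {f : ℝ → ℝ}, IntegrableOn f (Set.Icc (-1 : ℝ) 1) →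
      IntegrableOn (fun z => f z * (legendre l).eval z) (Set.Icc (-1 : ℝ) 1) := fun hf =>
    hf.mul_continuousOn (legendre l).continuous.continuousOn isCompact_Icc
  unfold coeff
  rw [← mul_add, ← integral_add (h hκ) (h hκ')]
  simp only [Pi.add_apply, add_mul]

lemma coeff_smul (c : ℝ) (κ : ℝ → ℝ) (l : ℕ) : coeff (c • κ) l = c * coeff κ l := by
  unfold coeff
  simp only [Pi.smul_apply, smul_eq_mul, mul_assoc, integral_const_mul]
  ring

lemma coeff_zero (l : ℕ) : coeff 0 l = 0 := by simp [coeff]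

/-- A band-limited kernel is the sum of its Legendre expansion. -/
lemma eq_sum_coeff_of_mem_zonalSpan {L : ℕ} {κ : ℝ → ℝ} (hκ : κ ∈ zonalSpan L) :
    (∀ l, L < l → coeff κ l = 0) ∧
      κ = fun z => ∑ l ∈ Finset.range (L + 1), coeff κ l * zonal l z := by
  induction hκ using Submodule.span_induction with
  | mem f hf =>
    obtain ⟨n, hn, rfl⟩ := hf
    refine ⟨fun l hl => by rw [coeff_zonal, if_neg (by omega)], funext fun z => ?_⟩
    simp only [coeff_zonal]
    rw [Finset.sum_eq_single n]
    · simp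
    · intro l _ hl
      simp [hl.symm]
    · intro h
      exact absurd (Finset.mem_range.mpr (by omega)) h
  | zero => exact ⟨fun l _ => coeff_zero l, funext fun z => by simp [coeff_zero]⟩
  | add f g hf hg ihf ihg =>
    have h := coeff_add (continuousOn_integrableOn (continuous_of_mem_zonalSpan hf))
      (continuousOn_integrableOn (continuous_of_mem_zonalSpan hg))
    refine ⟨fun l hl => by rw [h, ihf.1 l hl, ihg.1 l hl, add_zero], funext fun z => ?_⟩
    rw [Pi.add_apply, congrFun ihf.2 z, congrFun ihg.2 z, ← Finset.sum_add_distrib]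
    exact Finset.sum_congr rfl fun l _ => by rw [h, add_mul]
  | smul c f hf ihf =>
    refine ⟨fun l hl => by rw [coeff_smul, ihf.1 l hl, mul_zero], funext fun z => ?_⟩
    rw [Pi.smul_apply, congrFun ihf.2 z, smul_eq_mul, Finset.mul_sum]
    exact Finset.sum_congr rfl fun l _ => by rw [coeff_smul, mul_assoc]

variable {l : ℕ} {e : Fin (2 * l + 1) → S2 → ℝ} {p : ℕ}

lemma kernelOp_add {κ κ' : ℝ → ℝ} (hκ : MemLp κ 2 (volume.restrict (Set.Icc (-1 : ℝ) 1)))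
    (hκ' : MemLp κ' 2 (volume.restrict (Set.Icc (-1 : ℝ) 1))) {f : S2 → ℝ} (hf : MemLp f 2 surf)
    (x : S2) : kernelOp (κ + κ') f x = kernelOp κ f x + kernelOp κ' f x := by
  have h1 : Integrable (fun y => κ (dot x y) * f y) surf := (memLp_comp_dot hκ x).integrable_mul hf
  have h2 : Integrable (fun y => κ' (dot x y) * f y) surf :=
    (memLp_comp_dot hκ' x).integrable_mul hf
  unfold kernelOp
  rw [← integral_add h1 h2]
  simp only [Pi.add_apply, add_mul]

lemma kernelOp_smul (c : ℝ) (κ : ℝ → ℝ) (f : S2 → ℝ) (x : S2) :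
    kernelOp (c • κ) f x = c * kernelOp κ f x := by
  unfold kernelOp
  simp only [Pi.smul_apply, smul_eq_mul, mul_assoc, integral_const_mul]

lemma IsHarmonicBasis.integral_sub_sq (he : IsHarmonicBasis l e) {F : S2 → ℝ}
    (hF : MemLp F 2 surf) (g : Fin (2 * l + 1) → ℝ) :
    ∫ x, (F x - ∑ m, g m * e m x) ^ 2 ∂surf =
      ∫ x, F x ^ 2 ∂surf + ∑ m, (g m ^ 2 - 2 * (g m * ∫ x, e m x * F x ∂surf)) := by
  have hFe : ∀ m, Integrable (fun x => e m x * F x) surf := fun m =>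
    (memLp_of_continuous (he.continuous m) 2).integrable_mul hF
  have hee : ∀ m m', Integrable (fun x => e m x * e m' x) surf := fun m m' =>
    integrable_of_continuous ((he.continuous m).mul (he.continuous m'))
  have hFF : Integrable (fun x => F x ^ 2) surf := by
    simp only [sq]
    exact hF.integrable_mul hF
  have h1 : ∀ x, (F x - ∑ m, g m * e m x) ^ 2 = F x ^ 2 +
      (∑ m, ∑ m', g m * g m' * (e m x * e m' x) - ∑ m, 2 * g m * (e m x * F x)) := by
    intro x
    have h2 : ∑ m, ∑ m', g m * g m' * (e m x * e m' x) = (∑ m, g m * e m x) ^ 2 := by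
      rw [sq, Finset.sum_mul_sum]
      exact Finset.sum_congr rfl fun m _ => Finset.sum_congr rfl fun m' _ => by ring
    have h3 : ∑ m, 2 * g m * (e m x * F x) = 2 * (∑ m, g m * e m x) * F x := by
      rw [Finset.mul_sum, Finset.sum_mul]
      exact Finset.sum_congr rfl fun m _ => by ring
    rw [h2, h3]
    ring
  have i1 : Integrable (fun x => ∑ m, ∑ m', g m * g m' * (e m x * e m' x)) surf :=
    integrable_finsetSum _ fun m _ => integrable_finsetSum _ fun m' _ => (hee m m').const_mul _
  have i2 : Integrable (fun x => ∑ m, 2 * g m * (e m x * F x)) surf :=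
    integrable_finsetSum _ fun m _ => (hFe m).const_mul _
  have i3 : Integrable (fun x => ∑ m, ∑ m', g m * g m' * (e m x * e m' x) -
      ∑ m, 2 * g m * (e m x * F x)) surf := i1.sub i2
  simp_rw [h1]
  rw [integral_add hFF i3, integral_sub i1 i2,
    integral_finsetSum _ fun m _ => integrable_finsetSum _ fun m' _ => (hee m m').const_mul _,
    integral_finsetSum _ fun m _ => (hFe m).const_mul _]
  congr 1
  rw [← Finset.sum_sub_distrib]
  refine Finset.sum_congr rfl fun m _ => ?_
  rw [integral_finsetSum _ fun m' _ => (hee m m').const_mul _]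
  simp_rw [integral_const_mul, he.orthonormal]
  simp
  ring

/-- The basic inequality for the errors of the coefficients of the least-squares estimator. -/
lemma IsLeastSquaresEstimate.quadForm_le {U : S2 → ℤ → ℝ} {N L : ℕ} {κ : Fin p → ℝ → ℝ}
    (h : IsLeastSquaresEstimate U N L κ) (hU : ∀ t, MemLp (fun x => U x t) 2 surf) (hl : l ≤ L)
    (he : IsHarmonicBasis l e) (φ : Fin p → ℝ) {a z : Fin (2 * l + 1) → ℤ → ℝ}
    (ha : ∀ m t, a m t = ∫ x, e m x * U x t ∂surf)
    (hz : ∀ m t, a m t = ∑ j, φ j * a m (t - ((j : ℤ) + 1)) + z m t) :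
    quadForm a N (fun j => coeff (κ j) l - φ j) ≤
      2 * ∑ j, (coeff (κ j) l - φ j) * crossVec a z N j := by
  have hκ : ∀ j, MemLp (κ j) 2 (volume.restrict (Set.Icc (-1 : ℝ) 1)) := fun j =>
    memLp_Icc_of_continuousOn (continuous_of_mem_zonalSpan (h.1 j)).continuousOn 2
  have hζ : MemLp (zonal l) 2 (volume.restrict (Set.Icc (-1 : ℝ) 1)) :=
    memLp_Icc_of_continuousOn (continuous_zonal l).continuousOn 2
  set u : Fin p → ℝ := fun j => coeff (κ j) l - φ j with hu
  -- The competitor has the true coefficients in degree `l` and agrees with the minimizer in all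
  -- other degrees.
  have hmem : ∀ j, κ j + (-u j) • zonal l ∈ zonalSpan L := fun j =>
    Submodule.add_mem _ (h.1 j) (Submodule.smul_mem _ _ (Submodule.subset_span ⟨l, hl, rfl⟩))
  have hmin := h.2 _ hmem
  set g : ℕ → Fin (2 * l + 1) → ℝ := fun t m => ∑ j, u j * a m ((t : ℤ) + p - ((j : ℤ) + 1))
    with hg
  have hterm : ∀ t : ℕ, ∫ x, (U x ((t : ℤ) + p) - ∑ j : Fin p, kernelOp (κ j + (-u j) • zonal l)
      (fun y => U y ((t : ℤ) + p - ((j : ℤ) + 1))) x) ^ 2 ∂surf =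
      ∫ x, (U x ((t : ℤ) + p) - ∑ j : Fin p, kernelOp (κ j)
        (fun y => U y ((t : ℤ) + p - ((j : ℤ) + 1))) x) ^ 2 ∂surf +
        ∑ m, (2 * (g t m * z m ((t : ℤ) + p)) - g t m ^ 2) := by
    intro t
    set F : S2 → ℝ := fun x => U x ((t : ℤ) + p) - ∑ j : Fin p, kernelOp (κ j)
      (fun y => U y ((t : ℤ) + p - ((j : ℤ) + 1))) x with hF
    have hK : ∀ j : Fin p, MemLp (fun x => kernelOp (κ j)
        (fun y => U y ((t : ℤ) + p - ((j : ℤ) + 1))) x) 2 surf := fun j =>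
      memLp_kernelOp (hκ j) (hU _)
    have hFm : MemLp F 2 surf := (hU _).sub (memLp_finsetSum _ fun j _ => hK j)
    have h1 : ∀ x, U x ((t : ℤ) + p) - ∑ j : Fin p, kernelOp (κ j + (-u j) • zonal l)
        (fun y => U y ((t : ℤ) + p - ((j : ℤ) + 1))) x = F x - ∑ m, (-g t m) * e m x := by
      intro x
      have h2 : ∀ j : Fin p, kernelOp (κ j + (-u j) • zonal l)
          (fun y => U y ((t : ℤ) + p - ((j : ℤ) + 1))) x =
          kernelOp (κ j) (fun y => U y ((t : ℤ) + p - ((j : ℤ) + 1))) x +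
            ∑ m, (-(u j * a m ((t : ℤ) + p - ((j : ℤ) + 1)))) * e m x := fun j => by
        rw [kernelOp_add (hκ j) (hζ.const_smul _) (hU _), kernelOp_smul,
          he.kernelOp_zonal (hU _), Finset.mul_sum]
        congr 1
        exact Finset.sum_congr rfl fun m _ => by rw [ha]; ring
      simp_rw [h2]
      rw [Finset.sum_add_distrib, Finset.sum_comm, hF]
      simp only [hg, neg_mul, Finset.sum_neg_distrib, Finset.sum_mul]
      ring
    -- The degree-`l` part of the residual is the noise minus the effect of the error `u`.
    have hFe : ∀ m, ∫ x, e m x * F x ∂surf = z m ((t : ℤ) + p) - g t m := by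
      intro m
      have hint : ∀ {f : S2 → ℝ}, MemLp f 2 surf → Integrable (fun x => e m x * f x) surf :=
        fun hf => (memLp_of_continuous (he.continuous m) 2).integrable_mul hf
      simp only [hF, mul_sub, Finset.mul_sum]
      rw [integral_sub (hint (hU _)) (integrable_finsetSum _ fun j _ => hint (hK j)),
        integral_finsetSum _ fun j _ => hint (hK j)]
      simp_rw [he.integral_mul_kernelOp (hκ _) (hU _), ← ha]
      rw [hz m ((t : ℤ) + p), hg]
      simp only [hu, sub_mul, Finset.sum_sub_distrib]
      ring
    simp_rw [h1]
    rw [he.integral_sub_sq hFm]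
    congr 1
    exact Finset.sum_congr rfl fun m _ => by rw [hFe]; ring
  unfold leastSquares at hmin
  simp_rw [hterm] at hmin
  rw [Finset.sum_add_distrib, le_add_iff_nonneg_right] at hmin
  have h3 : 2 * ∑ j, u j * crossVec a z N j =
      ∑ t ∈ Finset.Icc 1 N, ∑ m, 2 * (g t m * z m ((t : ℤ) + p)) := by
    simp only [crossVec, hg, Finset.mul_sum, Finset.sum_mul]
    rw [Finset.sum_comm]
    refine Finset.sum_congr rfl fun t _ => ?_
    rw [Finset.sum_comm]
    exact Finset.sum_congr rfl fun m _ => Finset.sum_congr rfl fun j _ => by ring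
  rw [h3]
  simp only [Finset.sum_sub_distrib] at hmin
  rw [quadForm]
  simp only [hg] at hmin ⊢
  linarith

/-- The mean square errors of the Legendre coefficients of least-squares estimators. -/
theorem exists_coeff_error_bound {Ω : Type*} [MeasurableSpace Ω] {P : Measure Ω}
    [IsProbabilityMeasure P] {T Z : S2 → ℤ → Ω → ℝ} {C : ℕ → ℝ} {k : Fin p → ℝ → ℝ} (hp : 0 < p)
    (hT : IsGaussianIsotropicStationary P T) (hZ : IsSphericalWhiteNoise P Z C)
    (hAR : IsSPHAR P k T Z) (hstat : StationarityCondition k) (hident : ∀ l, 0 < C l)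
    (hcoeff : ∀ j, Tendsto (fun l => coeff (k j) l) atTop (𝓝 0)) :
    ∃ (K : ℝ) (N₀ : ℕ), 0 ≤ K ∧ ∀ N ≥ N₀, ∀ l : ℕ, ∃ B : Ω → ℝ≥0∞, Measurable B ∧
      ∫⁻ ω, B ω ∂P ≤ ENNReal.ofReal (K / ((2 * (l : ℝ) + 1) * N)) ∧
      ∀ᵐ ω ∂P, ∀ (L : ℕ) (κ : Fin p → ℝ → ℝ), l ≤ L →
        IsLeastSquaresEstimate (fun x t => T x t ω) N L κ →
        ∀ j, ENNReal.ofReal ((coeff (κ j) l - coeff (k j) l) ^ 2) ≤ B ω := by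
  obtain ⟨cT, hcT⟩ := hT.exists_isSecondOrderField
  obtain ⟨H, K₀, hfam⟩ := exists_isARFamily hT hZ hAR hstat hident hcoeff
  refine ⟨(lseBound p K₀).toReal, p * (4 * (4 * (p + 2))), ENNReal.toReal_nonneg,
    fun N hN l => ?_⟩
  obtain ⟨e, he1, he2, he3⟩ := exists_harmonics l
  have he : IsHarmonicBasis l e := ⟨he1, he2, he3⟩
  obtain ⟨ψ, a, z, har, ha, hz⟩ := hfam l e he
  obtain ⟨B, hBm, hB, hBe⟩ := har.exists_error_bound hp (Nat.succ_pos _) hN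
  refine ⟨B, hBm, hB.trans (le_of_eq ?_), ?_⟩
  · rw [div_eq_mul_inv, ENNReal.ofReal_mul ENNReal.toReal_nonneg,
      ENNReal.ofReal_toReal (lseBound_lt_top p K₀).ne]
    push_cast
    rfl
  have h1 : ∀ᵐ ω ∂P, ∀ m s, a m s ω = (√(C l))⁻¹ * harmonicCoeff (e m) (fun x => T x s) ω :=
    ae_all_iff.mpr fun m => ae_all_iff.mpr fun s => ha m s
  have h2 : ∀ᵐ ω ∂P, ∀ m s, z m s ω = (√(C l))⁻¹ * harmonicCoeff (e m) (fun x => Z x s) ω :=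
    ae_all_iff.mpr fun m => ae_all_iff.mpr fun s => hz m s
  have h3 : ∀ᵐ ω ∂P, ∀ m t, harmonicCoeff (e m) (fun x => T x t) ω =
      ∑ j, coeff (k j) l * harmonicCoeff (e m) (fun x => T x (t - ((j : ℤ) + 1))) ω +
        harmonicCoeff (e m) (fun x => Z x t) ω :=
    ae_all_iff.mpr fun m => ae_all_iff.mpr fun t => harmonicCoeff_recursion hT hZ hAR he m t
  have h4 : ∀ᵐ ω ∂P, ∀ s, MemLp (fun x => T x s ω) 2 surf :=
    ae_all_iff.mpr fun s => (hcT s).ae_memLp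
  filter_upwards [h1, h2, h3, h4, hBe] with ω h1 h2 h3 h4 h5 L κ hl hκ j
  have hq := hκ.quadForm_le h4 hl he (fun j => coeff (k j) l)
    (a := fun m s => harmonicCoeff (e m) (fun x => T x s) ω)
    (z := fun m s => harmonicCoeff (e m) (fun x => Z x s) ω) (fun m t => rfl) h3
  -- Both sides of the basic inequality are quadratic in the coefficients, so normalising the noise
  -- multiplies both by `1 / C l`.
  have hc : 0 ≤ (√(C l))⁻¹ ^ 2 := by positivity
  refine le_trans (ENNReal.ofReal_le_ofReal ?_) (h5 (fun j => coeff (κ j) l - coeff (k j) l) ?_)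
  · rw [← sq_abs, ← Real.norm_eq_abs]
    exact pow_le_pow_left₀ (norm_nonneg _)
      (norm_le_pi_norm (fun j => coeff (κ j) l - coeff (k j) l) j) 2
  · have h6 := mul_le_mul_of_nonneg_left hq hc
    refine (le_of_eq ?_).trans (h6.trans (le_of_eq ?_))
    · simp only [h1, quadForm, Finset.mul_sum, ← mul_pow]
      refine Finset.sum_congr rfl fun t _ => Finset.sum_congr rfl fun m _ => ?_
      congr 1
      exact Finset.sum_congr rfl fun j _ => by ring
    · simp only [h1, h2, crossVec, Finset.mul_sum]
      refine Finset.sum_congr rfl fun j _ => Finset.sum_congr rfl fun t _ =>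
        Finset.sum_congr rfl fun m _ => by ring

end LeastSquaresEstimator


/-! ### Completeness of the Legendre polynomials and truncation errors -/

section Truncation

set_option linter.unusedSectionVars false

open scoped ENNReal NNReal Topology

/-- The Legendre polynomials are complete. -/
lemma ae_eq_zero_of_integral_mul_legendre {f : ℝ → ℝ} (hf : IntegrableOn f (Set.Icc (-1 : ℝ) 1))
    (h : ∀ l, ∫ x in Set.Icc (-1 : ℝ) 1, f x * (legendre l).eval x = 0) :
    f =ᵐ[volume.restrict (Set.Icc (-1 : ℝ) 1)] 0 := by
  refine ae_eq_zero_of_integral_contDiff_smul_eq_zero hf.integrable.locallyIntegrable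
    fun g hg _ => ?_
  have hgc : Continuous g := hg.continuous
  have hi : ∀ {u : ℝ → ℝ}, Continuous u →
      IntegrableOn (fun x => f x * u x) (Set.Icc (-1 : ℝ) 1) := fun hu =>
    hf.mul_continuousOn hu.continuousOn isCompact_Icc
  have hkey : ∀ ε > 0, |∫ x in Set.Icc (-1 : ℝ) 1, f x * g x| ≤
      ε * ∫ x in Set.Icc (-1 : ℝ) 1, |f x| := by
    intro ε hε
    -- Weierstrass approximation: subtracting a polynomial from the test function does not change
    -- the integral.
    obtain ⟨q, hq⟩ := exists_polynomial_near_of_continuousOn (-1) 1 g hgc.continuousOn ε hε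
    have h1 : ∫ x in Set.Icc (-1 : ℝ) 1, f x * g x =
        ∫ x in Set.Icc (-1 : ℝ) 1, f x * (g x - q.eval x) := by
      simp only [mul_sub]
      rw [integral_sub (hi hgc) (hi q.continuous), setIntegral_mul_poly_eq_zero hf h q, sub_zero]
    rw [h1, ← Real.norm_eq_abs, ← integral_const_mul]
    refine norm_integral_le_of_norm_le (hf.abs.const_mul ε)
      ((ae_restrict_iff' measurableSet_Icc).mpr (.of_forall fun x hx => ?_))
    rw [norm_mul, Real.norm_eq_abs, Real.norm_eq_abs, mul_comm, abs_sub_comm]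
    exact mul_le_mul_of_nonneg_right (hq x hx).le (abs_nonneg _)
  have hI : 0 ≤ ∫ x in Set.Icc (-1 : ℝ) 1, |f x| := integral_nonneg fun x => abs_nonneg _
  simp only [smul_eq_mul, mul_comm (g _)]
  refine abs_eq_zero.mp (le_antisymm (le_of_forall_pos_le_add fun ε hε => ?_) (abs_nonneg _))
  refine (hkey (ε / (1 + ∫ x in Set.Icc (-1 : ℝ) 1, |f x|)) (by positivity)).trans ?_
  rw [zero_add, div_mul_eq_mul_div, div_le_iff₀ (by positivity)]
  nlinarith

lemma ae_eq_of_coeff_eq {f g : ℝ → ℝ} (hf : IntegrableOn f (Set.Icc (-1 : ℝ) 1))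
    (hg : IntegrableOn g (Set.Icc (-1 : ℝ) 1)) (h : ∀ l, coeff f l = coeff g l) :
    f =ᵐ[volume.restrict (Set.Icc (-1 : ℝ) 1)] g := by
  have hi : ∀ (l : ℕ) {u : ℝ → ℝ}, IntegrableOn u (Set.Icc (-1 : ℝ) 1) →
      IntegrableOn (fun x => u x * (legendre l).eval x) (Set.Icc (-1 : ℝ) 1) := fun l _ hu =>
    hu.mul_continuousOn (legendre l).continuous.continuousOn isCompact_Icc
  have h1 := ae_eq_zero_of_integral_mul_legendre (f := fun x => f x - g x) (hf.sub hg) fun l => by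
    simp only [sub_mul]
    rw [integral_sub (hi l hf) (hi l hg), sub_eq_zero]
    exact mul_left_cancel₀ (by positivity : (2 * Real.pi : ℝ) ≠ 0) (h l)
  filter_upwards [h1] with x hx
  exact sub_eq_zero.mp hx

/-- Parseval's identity for Legendre expansions. -/
lemma hasSum_coeff_sq {g : ℝ → ℝ} (hg : MemLp g 2 (volume.restrict (Set.Icc (-1 : ℝ) 1))) :
    HasSum (fun l : ℕ => (2 * (l : ℝ) + 1) / (8 * Real.pi ^ 2) * coeff g l ^ 2)
      (∫ z in Set.Icc (-1 : ℝ) 1, g z * g z) := by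
  have hP : ∀ l : ℕ, MemLp (fun x => √((2 * (l : ℝ) + 1) / 2) * (legendre l).eval x) 2
      (volume.restrict (Set.Icc (-1 : ℝ) 1)) := fun l =>
    memLp_Icc_of_continuousOn (continuous_const.mul (legendre l).continuous).continuousOn 2
  have hs : ∀ l : ℕ, √((2 * (l : ℝ) + 1) / 2) * √((2 * (l : ℝ) + 1) / 2) =
      (2 * (l : ℝ) + 1) / 2 := fun l => Real.mul_self_sqrt (by positivity)
  have horth : Orthonormal ℝ fun l => (hP l).toLp := by
    classical
    rw [orthonormal_iff_ite]
    intro l l'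
    rw [inner_toLp]
    have h1 : ∫ x in Set.Icc (-1 : ℝ) 1, √((2 * (l : ℝ) + 1) / 2) * (legendre l).eval x *
        (√((2 * (l' : ℝ) + 1) / 2) * (legendre l').eval x) = √((2 * (l : ℝ) + 1) / 2) *
        √((2 * (l' : ℝ) + 1) / 2) * ∫ x in (-1 : ℝ)..1, (legendre l).eval x * (legendre l').eval x := by
      rw [intervalIntegral.integral_of_le (by norm_num), ← integral_Icc_eq_integral_Ioc,
        ← integral_const_mul]
      exact integral_congr_ae (.of_forall fun x => by simp only; ring)
    rw [h1]
    split_ifs with hl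
    · subst hl
      have h2 := integral_legendre_sq l
      rw [h2, hs]
      field_simp
    · rw [integral_legendre_mul_legendre_of_ne hl, mul_zero]
  have hinner : ∀ (l : ℕ) {f : ℝ → ℝ} (hf : MemLp f 2 (volume.restrict (Set.Icc (-1 : ℝ) 1))),
      inner ℝ (hP l).toLp hf.toLp = √((2 * (l : ℝ) + 1) / 2) *
        ∫ x in Set.Icc (-1 : ℝ) 1, f x * (legendre l).eval x := fun l f hf => by
    rw [inner_toLp, ← integral_const_mul]
    exact integral_congr_ae (.of_forall fun x => by simp only; ring)
  have hspan : (Submodule.span ℝ (Set.range fun l => (hP l).toLp))ᗮ = ⊥ := by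
    rw [Submodule.eq_bot_iff]
    intro f hf
    have h1 := (Submodule.mem_orthogonal _ _).mp hf
    refine Lp.eq_zero_iff_ae_eq_zero.mpr (ae_eq_zero_of_integral_mul_legendre
      ((Lp.memLp f).integrable (by norm_num)) fun l => ?_)
    have h2 := h1 _ (Submodule.subset_span ⟨l, rfl⟩)
    have h3 := hinner l (Lp.memLp f)
    rw [Lp.toLp_coeFn, h2] at h3
    exact (mul_eq_zero.mp h3.symm).resolve_left (by positivity)
  have hb := (HilbertBasis.mkOfOrthogonalEqBot horth hspan).hasSum_inner_mul_inner
    hg.toLp hg.toLp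
  rw [inner_toLp] at hb
  refine hb.congr_fun fun l => ?_
  rw [HilbertBasis.coe_mkOfOrthogonalEqBot, real_inner_comm, hinner l hg]
  unfold coeff
  have h4 := hs l
  have hpi := Real.pi_pos
  set I := ∫ x in Set.Icc (-1 : ℝ) 1, g x * (legendre l).eval x
  calc _ = (2 * (l : ℝ) + 1) / 2 * I ^ 2 := by field_simp; ring
    _ = √((2 * (l : ℝ) + 1) / 2) * √((2 * (l : ℝ) + 1) / 2) * I ^ 2 := by rw [h4]
    _ = _ := by ring

/-- A telescoping form of comparison with an integral, from `log((n+1)/n) ≥ 1/(n+1)` and `exp x ≥ 1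
+ x`. -/
lemma rpow_neg_succ_le {s : ℝ} (hs : 0 < s) {n : ℕ} (hn : 0 < n) :
    ((n : ℝ) + 1) ^ (-(s + 1)) ≤ s⁻¹ * ((n : ℝ) ^ (-s) - ((n : ℝ) + 1) ^ (-s)) := by
  have hn' : (0 : ℝ) < n := by exact_mod_cast hn
  have h1 : 1 + s / (n + 1) ≤ (((n : ℝ) + 1) / n) ^ s := by
    rw [Real.rpow_def_of_pos (by positivity)]
    have h2 := Real.one_sub_inv_le_log_of_pos (show (0 : ℝ) < ((n : ℝ) + 1) / n by positivity)
    have h3 : 1 - (((n : ℝ) + 1) / n)⁻¹ = 1 / (n + 1) := by field_simp; ring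
    rw [h3] at h2
    have h4 := Real.add_one_le_exp (Real.log (((n : ℝ) + 1) / n) * s)
    have h5 : s / (n + 1) ≤ Real.log (((n : ℝ) + 1) / n) * s := by
      rw [div_eq_mul_one_div, mul_comm]
      exact mul_le_mul_of_nonneg_right h2 hs.le
    linarith
  have h6 : (n : ℝ) ^ (-s) = ((n : ℝ) + 1) ^ (-s) * (((n : ℝ) + 1) / n) ^ s := by
    rw [Real.div_rpow (by positivity) hn'.le, Real.rpow_neg hn'.le, Real.rpow_neg (by positivity)]
    have := (Real.rpow_pos_of_pos (show (0 : ℝ) < (n : ℝ) + 1 by positivity) s).ne'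
    field_simp
  have h7 : ((n : ℝ) + 1) ^ (-(s + 1)) = ((n : ℝ) + 1) ^ (-s) * ((n : ℝ) + 1)⁻¹ := by
    rw [neg_add, Real.rpow_add (by positivity), Real.rpow_neg_one]
  rw [h6, h7, inv_mul_eq_div, le_div_iff₀ hs]
  have h8 : 0 ≤ ((n : ℝ) + 1) ^ (-s) := by positivity
  calc ((n : ℝ) + 1) ^ (-s) * ((n : ℝ) + 1)⁻¹ * s = ((n : ℝ) + 1) ^ (-s) * (s / (n + 1)) := by
        rw [div_eq_mul_inv]; ring
    _ ≤ ((n : ℝ) + 1) ^ (-s) * ((((n : ℝ) + 1) / n) ^ s - 1) :=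
        mul_le_mul_of_nonneg_left (by linarith) h8
    _ = _ := by ring

/-- A bound for the tails of Dirichlet series at a real point. -/
lemma tail_rpow_le {s : ℝ} (hs : 0 < s) {L : ℕ} (hL : 0 < L) :
    Summable (fun i : ℕ => ((i + (L + 1) : ℕ) : ℝ) ^ (-(s + 1))) ∧
      ∑' i : ℕ, ((i + (L + 1) : ℕ) : ℝ) ^ (-(s + 1)) ≤ s⁻¹ * (L : ℝ) ^ (-s) := by
  have h : ∀ n, ∑ i ∈ Finset.range n, ((i + (L + 1) : ℕ) : ℝ) ^ (-(s + 1)) ≤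
      s⁻¹ * (L : ℝ) ^ (-s) := by
    intro n
    suffices h : ∑ i ∈ Finset.range n, ((i + (L + 1) : ℕ) : ℝ) ^ (-(s + 1)) ≤
        s⁻¹ * ((L : ℝ) ^ (-s) - ((n + L : ℕ) : ℝ) ^ (-s)) by
      refine h.trans (mul_le_mul_of_nonneg_left ?_ (by positivity))
      have : 0 ≤ ((n + L : ℕ) : ℝ) ^ (-s) := by positivity
      linarith
    induction n with
    | zero => simp
    | succ n ih =>
      rw [Finset.sum_range_succ]
      have h1 := rpow_neg_succ_le hs (n := n + L) (by omega)
      have h2 : ((n + (L + 1) : ℕ) : ℝ) = ((n + L : ℕ) : ℝ) + 1 := by push_cast; ring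
      have h3 : ((n + 1 + L : ℕ) : ℝ) = ((n + L : ℕ) : ℝ) + 1 := by push_cast; ring
      rw [h2, h3]
      calc _ ≤ s⁻¹ * ((L : ℝ) ^ (-s) - ((n + L : ℕ) : ℝ) ^ (-s)) +
            s⁻¹ * (((n + L : ℕ) : ℝ) ^ (-s) - (((n + L : ℕ) : ℝ) + 1) ^ (-s)) := add_le_add ih h1
        _ = _ := by ring
  exact ⟨summable_of_sum_range_le (fun i => by positivity) h,
    Real.tsum_le_of_sum_range_le (fun i => by positivity) h⟩

lemma tail_le_of_le_rpow {s D : ℝ} (hs : 0 < s) {u : ℕ → ℝ} (hu : ∀ n, 0 ≤ u n)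
    (h : ∀ n : ℕ, 0 < n → u n ≤ D * (n : ℝ) ^ (-(s + 1))) : Summable u ∧
      ∀ L : ℕ, 0 < L → ∑' i, u (i + (L + 1)) ≤ D * (s⁻¹ * (L : ℝ) ^ (-s)) := by
  have hD : 0 ≤ D := by simpa using (hu 1).trans (h 1 one_pos)
  have hs1 : ∀ L : ℕ, 0 < L → Summable fun i => u (i + (L + 1)) := fun L hL =>
    Summable.of_nonneg_of_le (fun i => hu _) (fun i => h _ (by omega))
      ((tail_rpow_le hs hL).1.mul_left D)
  -- The tail estimate requires `L ≥ 1`, so summability is read off from the tail starting at index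
  -- `2`.
  refine ⟨(summable_nat_add_iff (1 + 1)).mp (hs1 1 one_pos), fun L hL => ?_⟩
  obtain ⟨h1, h2⟩ := tail_rpow_le hs hL
  calc _ ≤ ∑' i : ℕ, D * ((i + (L + 1) : ℕ) : ℝ) ^ (-(s + 1)) :=
        (hs1 L hL).tsum_le_tsum (fun i => h _ (by omega)) (h1.mul_left D)
    _ = D * ∑' i : ℕ, ((i + (L + 1) : ℕ) : ℝ) ^ (-(s + 1)) := tsum_mul_left
    _ ≤ _ := mul_le_mul_of_nonneg_left h2 hD

variable {k : ℝ → ℝ} {β γ : ℝ}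

lemma two_mul_add_one_mul_le {c : ℝ} {n : ℕ} (hn : 0 < n) (h : |c| ≤ γ / (n : ℝ) ^ β) :
    (2 * (n : ℝ) + 1) * |c| ≤ 3 * γ * (n : ℝ) ^ (-(β - 2 + 1)) := by
  have hn1 : (1 : ℝ) ≤ n := by exact_mod_cast hn
  have hn0 : (0 : ℝ) < n := by linarith
  have h3 : (n : ℝ) ^ (-(β - 2 + 1)) = n * (n : ℝ) ^ (-β) := by
    conv_rhs => rw [← Real.rpow_one (n : ℝ), ← Real.rpow_mul hn0.le, ← Real.rpow_add hn0]
    congr 1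
    ring
  rw [div_eq_mul_inv, ← Real.rpow_neg hn0.le] at h
  rw [h3]
  calc (2 * (n : ℝ) + 1) * |c| ≤ (3 * n) * (γ * (n : ℝ) ^ (-β)) :=
        mul_le_mul (by linarith) h (abs_nonneg _) (by linarith)
    _ = _ := by ring

lemma two_mul_add_one_mul_sq_le {c : ℝ} {n : ℕ} (hn : 0 < n) (h : |c| ≤ γ / (n : ℝ) ^ β) :
    (2 * (n : ℝ) + 1) * c ^ 2 ≤ 3 * γ ^ 2 * (n : ℝ) ^ (-(2 * β - 2 + 1)) := by
  have hn0 : (0 : ℝ) < n := by exact_mod_cast hn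
  have h1 : |c ^ 2| ≤ γ ^ 2 / (n : ℝ) ^ (2 * β) := by
    rw [abs_pow]
    refine (pow_le_pow_left₀ (abs_nonneg _) h 2).trans (le_of_eq ?_)
    rw [div_pow, mul_comm 2 β, Real.rpow_mul hn0.le, Real.rpow_ofNat]
  simpa [abs_of_nonneg (sq_nonneg c)] using two_mul_add_one_mul_le hn h1

lemma coeff_sub {κ κ' : ℝ → ℝ} (hκ : IntegrableOn κ (Set.Icc (-1 : ℝ) 1))
    (hκ' : IntegrableOn κ' (Set.Icc (-1 : ℝ) 1)) (l : ℕ) :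
    coeff (fun z => κ z - κ' z) l = coeff κ l - coeff κ' l := by
  have h1 : (fun z => κ z - κ' z) = κ + (-1 : ℝ) • κ' := by ext z; simp; ring
  rw [h1, coeff_add hκ (hκ'.smul (-1 : ℝ)), coeff_smul]
  ring

/-- The mean square error of a band-limited approximation. -/
lemma setLIntegral_sub_sq_le (hk : MemLp k 2 (volume.restrict (Set.Icc (-1 : ℝ) 1))) (hβ : 1 < β)
    (hsm : ∀ l : ℕ, 0 < l → |coeff k l| ≤ γ / (l : ℝ) ^ β) {L : ℕ} (hL : 0 < L) {κ : ℝ → ℝ}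
    (hκ : κ ∈ zonalSpan L) : ∫⁻ z in Set.Icc (-1 : ℝ) 1, ‖κ z - k z‖ₑ ^ 2 ≤
      ∑ l ∈ Finset.range (L + 1), ENNReal.ofReal ((2 * (l : ℝ) + 1) / (8 * Real.pi ^ 2)) *
        ENNReal.ofReal ((coeff κ l - coeff k l) ^ 2) +
      ENNReal.ofReal (3 * γ ^ 2 / (8 * Real.pi ^ 2) *
        ((2 * β - 2)⁻¹ * (L : ℝ) ^ (-(2 * β - 2)))) := by
  have hκm : MemLp κ 2 (volume.restrict (Set.Icc (-1 : ℝ) 1)) :=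
    memLp_Icc_of_continuousOn (continuous_of_mem_zonalSpan hκ).continuousOn 2
  have hg : MemLp (fun z => κ z - k z) 2 (volume.restrict (Set.Icc (-1 : ℝ) 1)) := hκm.sub hk
  have hsum := hasSum_coeff_sq hg
  have hpi := Real.pi_pos
  have hi : Integrable (fun z => (κ z - k z) * (κ z - k z))
    (volume.restrict (Set.Icc (-1 : ℝ) 1)) := hg.integrable_mul hg
  have h1 : ∫⁻ z in Set.Icc (-1 : ℝ) 1, ‖κ z - k z‖ₑ ^ 2 =
      ENNReal.ofReal (∫ z in Set.Icc (-1 : ℝ) 1, (κ z - k z) * (κ z - k z)) := by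
    rw [ofReal_integral_eq_lintegral_ofReal hi (.of_forall fun ω => mul_self_nonneg _)]
    exact lintegral_congr fun z => by rw [enorm_sq_eq, sq]
  have hcs : ∀ l, coeff (fun z => κ z - k z) l = coeff κ l - coeff k l :=
    coeff_sub (memLp_one_of_two hκm) (memLp_one_of_two hk)
  simp only [hcs] at hsum
  have hT := (tail_le_of_le_rpow (s := 2 * β - 2) (D := 3 * γ ^ 2 / (8 * Real.pi ^ 2))
    (by linarith) (u := fun l => (2 * (l : ℝ) + 1) / (8 * Real.pi ^ 2) * coeff k l ^ 2)
    (fun l => by positivity) fun l hl => by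
      have := div_le_div_of_nonneg_right (two_mul_add_one_mul_sq_le hl (hsm l hl))
        (by positivity : 0 ≤ 8 * Real.pi ^ 2)
      rw [div_mul_eq_mul_div, div_mul_eq_mul_div]
      exact this).2 L hL
  have hT' : ∑' i : ℕ, (2 * ((i + (L + 1) : ℕ) : ℝ) + 1) / (8 * Real.pi ^ 2) *
      (coeff κ (i + (L + 1)) - coeff k (i + (L + 1))) ^ 2 ≤
      3 * γ ^ 2 / (8 * Real.pi ^ 2) * ((2 * β - 2)⁻¹ * (L : ℝ) ^ (-(2 * β - 2))) := by
    refine le_trans (le_of_eq (tsum_congr fun i => ?_)) hT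
    rw [(eq_sum_coeff_of_mem_zonalSpan hκ).1 _ (by omega), zero_sub, neg_sq]
  rw [h1, ← hsum.tsum_eq, ← hsum.summable.sum_add_tsum_nat_add (L + 1)]
  refine ENNReal.ofReal_add_le.trans (add_le_add ?_ (ENNReal.ofReal_le_ofReal hT'))
  rw [ENNReal.ofReal_sum_of_nonneg fun l _ => by positivity]
  exact Finset.sum_le_sum fun l _ => (ENNReal.ofReal_mul (by positivity)).le

lemma tail_zonal_coeff (hβ : 2 < β) (hsm : ∀ l : ℕ, 0 < l → |coeff k l| ≤ γ / (l : ℝ) ^ β) :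
    Summable (fun l : ℕ => (2 * (l : ℝ) + 1) / (4 * Real.pi) * |coeff k l|) ∧ ∀ L : ℕ, 0 < L →
      ∑' i, (2 * ((i + (L + 1) : ℕ) : ℝ) + 1) / (4 * Real.pi) * |coeff k (i + (L + 1))| ≤
        3 * γ / (4 * Real.pi) * ((β - 2)⁻¹ * (L : ℝ) ^ (-(β - 2))) := by
  have hpi := Real.pi_pos
  refine tail_le_of_le_rpow (by linarith) (fun l => by positivity) fun l hl => ?_
  have := div_le_div_of_nonneg_right (two_mul_add_one_mul_le hl (hsm l hl))
    (by positivity : 0 ≤ 4 * Real.pi)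
  rw [div_mul_eq_mul_div, div_mul_eq_mul_div]
  exact this

/-- The uniform error of a band-limited approximation. -/
lemma abs_sub_le_of_hasSum (hβ : 2 < β)
    (hsm : ∀ l : ℕ, 0 < l → |coeff k l| ≤ γ / (l : ℝ) ^ β) {L : ℕ} (hL : 0 < L) {κ : ℝ → ℝ}
    (hκ : κ ∈ zonalSpan L) {z y : ℝ} (hz : z ∈ Set.Icc (-1 : ℝ) 1)
    (hy : HasSum (fun l => coeff k l * zonal l z) y) :
    |κ z - y| ≤ ∑ l ∈ Finset.range (L + 1), (2 * (l : ℝ) + 1) / (4 * Real.pi) *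
        |coeff κ l - coeff k l| +
      3 * γ / (4 * Real.pi) * ((β - 2)⁻¹ * (L : ℝ) ^ (-(β - 2))) := by
  obtain ⟨h1, h2⟩ := tail_zonal_coeff hβ hsm
  rw [← hy.tsum_eq, ← hy.summable.sum_add_tsum_nat_add (L + 1),
    congrFun (eq_sum_coeff_of_mem_zonalSpan hκ).2 z, ← sub_sub, ← Finset.sum_sub_distrib]
  refine (abs_sub _ _).trans (add_le_add ?_ ?_)
  · refine (Finset.abs_sum_le_sum_abs _ _).trans (Finset.sum_le_sum fun l _ => ?_)
    rw [← sub_mul]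
    exact norm_mul_zonal_le (fun l => coeff κ l - coeff k l) l hz
  · have h3 := (summable_nat_add_iff (L + 1)).mpr h1
    exact (tsum_of_norm_bounded h3.hasSum fun i => norm_mul_zonal_le (coeff k) _ hz).trans (h2 L hL)

end Truncation


/-! ### Rates of convergence -/

section Rates

set_option linter.unusedSectionVars false

open scoped ENNReal NNReal Topology

variable {Ω : Type*} [MeasurableSpace Ω] {P : Measure Ω} [IsProbabilityMeasure P] {p : ℕ}
  {k k₀ : Fin p → ℝ → ℝ} {β : ℝ} {γ : Fin p → ℝ}

lemma norm_diffVec_sq (κ κ' : Fin p → ℝ → ℝ) (z : ℝ) :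
    ‖diffVec κ κ' z‖ ^ 2 = ∑ j, (κ j z - κ' j z) ^ 2 := by
  rw [EuclideanSpace.real_norm_sq_eq]
  rfl

lemma enorm_diffVec_sq (κ κ' : Fin p → ℝ → ℝ) (z : ℝ) :
    ‖diffVec κ κ' z‖ₑ ^ 2 = ∑ j, ‖κ j z - κ' j z‖ₑ ^ 2 := by
  rw [← ofReal_norm, ← ENNReal.ofReal_pow (norm_nonneg _), norm_diffVec_sq,
    ENNReal.ofReal_sum_of_nonneg fun j _ => sq_nonneg _]
  exact Finset.sum_congr rfl fun j _ => (enorm_sq_eq _).symm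

lemma norm_diffVec_le (κ κ' : Fin p → ℝ → ℝ) (z : ℝ) :
    ‖diffVec κ κ' z‖ ≤ ∑ j, |κ j z - κ' j z| := by
  refine (sq_le_sq₀ (norm_nonneg _) (Finset.sum_nonneg fun j _ => abs_nonneg _)).mp ?_
  rw [norm_diffVec_sq]
  simp_rw [← sq_abs (κ _ z - κ' _ z)]
  exact Finset.sum_sq_le_sq_sum_of_nonneg fun j _ => abs_nonneg _

lemma lintegral_sqrt_le {B : Ω → ℝ≥0∞} (hB : Measurable B) :
    ∫⁻ ω, B ω ^ (1 / 2 : ℝ) ∂P ≤ (∫⁻ ω, B ω ∂P) ^ (1 / 2 : ℝ) := by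
  have h := lintegral_mul_le_sqrt (μ := P) (hB.pow_const (1 / 2 : ℝ)).aemeasurable
    (aemeasurable_const (b := (1 : ℝ≥0∞)))
  have h2 : ∀ x : ℝ≥0∞, (x ^ (1 / 2 : ℝ)) ^ 2 = x := fun x => by
    rw [← ENNReal.rpow_natCast, ← ENNReal.rpow_mul]; norm_num
  simp only [h2, mul_one, one_pow, lintegral_const, measure_univ, ENNReal.one_rpow] at h
  exact h

/-- The mean integrated square error, given bounds for the errors of the coefficients. -/
lemma lintegral_sq_error_le (hk : ∀ j, MemLp (k j) 2 (volume.restrict (Set.Icc (-1 : ℝ) 1)))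
    (hβ : 1 < β) (hsm : ∀ (j : Fin p) (l : ℕ), 0 < l → |coeff (k j) l| ≤ γ j / (l : ℝ) ^ β)
    {L N : ℕ} (hL : 0 < L) {K : ℝ} (hK : 0 ≤ K) {B : ℕ → Ω → ℝ≥0∞} (hBm : ∀ l, Measurable (B l))
    (hB : ∀ l : ℕ, ∫⁻ ω, B l ω ∂P ≤ ENNReal.ofReal (K / ((2 * (l : ℝ) + 1) * N)))
    {κ : Ω → Fin p → ℝ → ℝ} (hκ : ∀ᵐ ω ∂P, (∀ j, κ ω j ∈ zonalSpan L) ∧ ∀ l ≤ L, ∀ j,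
      ENNReal.ofReal ((coeff (κ ω j) l - coeff (k j) l) ^ 2) ≤ B l ω) :
    ∫⁻ ω, (∫⁻ z in Set.Icc (-1 : ℝ) 1, ‖diffVec (κ ω) k z‖ₑ ^ 2) ∂P ≤ ENNReal.ofReal
      (p * ((L + 1 : ℕ) * (K / (8 * Real.pi ^ 2 * N))) + ∑ j, 3 * γ j ^ 2 / (8 * Real.pi ^ 2) *
        ((2 * β - 2)⁻¹ * (L : ℝ) ^ (-(2 * β - 2)))) := by
  have hβ' : 0 < 2 * β - 2 := by linarith
  have h1 : ∀ᵐ ω ∂P, (∫⁻ z in Set.Icc (-1 : ℝ) 1, ‖diffVec (κ ω) k z‖ₑ ^ 2) ≤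
      ∑ j : Fin p, (∑ l ∈ Finset.range (L + 1),
        ENNReal.ofReal ((2 * (l : ℝ) + 1) / (8 * Real.pi ^ 2)) * B l ω +
        ENNReal.ofReal (3 * γ j ^ 2 / (8 * Real.pi ^ 2) *
          ((2 * β - 2)⁻¹ * (L : ℝ) ^ (-(2 * β - 2))))) := by
    filter_upwards [hκ] with ω hω
    simp_rw [enorm_diffVec_sq]
    rw [lintegral_finsetSum']
    · refine Finset.sum_le_sum fun j _ => (setLIntegral_sub_sq_le (hk j) hβ (hsm j) hL
        (hω.1 j)).trans ?_
      gcongr with l hl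
      exact hω.2 l (by simpa [Nat.lt_succ_iff] using hl) j
    · intro j _
      have h2 : AEStronglyMeasurable (fun z => κ ω j z - k j z)
          (volume.restrict (Set.Icc (-1 : ℝ) 1)) :=
        (continuous_of_mem_zonalSpan (hω.1 j)).aestronglyMeasurable.sub (hk j).1
      exact h2.enorm.pow_const 2
  refine (lintegral_mono_ae h1).trans ?_
  have hm : Measurable fun ω => ∑ l ∈ Finset.range (L + 1),
      ENNReal.ofReal ((2 * (l : ℝ) + 1) / (8 * Real.pi ^ 2)) * B l ω :=
    Finset.measurable_sum _ fun l _ => (hBm l).const_mul _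
  -- The Parseval weight cancels the `2l+1` observations per time, so each degree contributes the
  -- same amount.
  have h3 : ∫⁻ ω, ∑ l ∈ Finset.range (L + 1),
      ENNReal.ofReal ((2 * (l : ℝ) + 1) / (8 * Real.pi ^ 2)) * B l ω ∂P ≤
      ENNReal.ofReal ((L + 1 : ℕ) * (K / (8 * Real.pi ^ 2 * N))) := by
    rw [lintegral_finsetSum _ fun l _ => (hBm l).const_mul _, ← nsmul_eq_mul,
      ← Finset.card_range (L + 1), ← Finset.sum_const,
      ENNReal.ofReal_sum_of_nonneg fun l _ => by positivity, Finset.card_range]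
    refine Finset.sum_le_sum fun l _ => ?_
    rw [lintegral_const_mul _ (hBm l)]
    refine (mul_le_mul_right (hB l) _).trans (le_of_eq ?_)
    rw [← ENNReal.ofReal_mul (by positivity)]
    congr 1
    have : 2 * (l : ℝ) + 1 ≠ 0 := by positivity
    rcases eq_or_ne (N : ℝ) 0 with hN | hN
    · simp [hN]
    · field_simp
  have hnn : ∀ j, 0 ≤ 3 * γ j ^ 2 / (8 * Real.pi ^ 2) *
      ((2 * β - 2)⁻¹ * (L : ℝ) ^ (-(2 * β - 2))) := fun j => by positivity
  rw [lintegral_finsetSum _ fun j _ => hm.add_const _, ENNReal.ofReal_add (by positivity)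
    (Finset.sum_nonneg fun j _ => hnn j), ENNReal.ofReal_sum_of_nonneg fun j _ => hnn j]
  simp_rw [lintegral_add_right _ measurable_const]
  rw [Finset.sum_add_distrib]
  refine add_le_add ?_ (le_of_eq (by simp))
  rw [Finset.sum_const, Finset.card_univ, Fintype.card_fin, nsmul_eq_mul,
    ENNReal.ofReal_mul (Nat.cast_nonneg p), ENNReal.ofReal_natCast]
  exact mul_le_mul_right h3 _

/-- The mean uniform error, given bounds for the errors of the coefficients. -/
lemma lintegral_sup_error_le (hβ : 2 < β) (hγ : ∀ j, 0 ≤ γ j)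
    (hsm : ∀ (j : Fin p) (l : ℕ), 0 < l → |coeff (k j) l| ≤ γ j / (l : ℝ) ^ β)
    (hk₀ : ∀ j, ∀ z ∈ Set.Icc (-1 : ℝ) 1, HasSum (fun l => coeff (k j) l * zonal l z) (k₀ j z))
    {L N : ℕ} (hL : 0 < L) {K : ℝ} (hK : 0 ≤ K) {B : ℕ → Ω → ℝ≥0∞} (hBm : ∀ l, Measurable (B l))
    (hB : ∀ l : ℕ, ∫⁻ ω, B l ω ∂P ≤ ENNReal.ofReal (K / ((2 * (l : ℝ) + 1) * N)))
    {κ : Ω → Fin p → ℝ → ℝ} (hκ : ∀ᵐ ω ∂P, (∀ j, κ ω j ∈ zonalSpan L) ∧ ∀ l ≤ L, ∀ j,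
      ENNReal.ofReal ((coeff (κ ω j) l - coeff (k j) l) ^ 2) ≤ B l ω) :
    ∫⁻ ω, (⨆ z ∈ Set.Icc (-1 : ℝ) 1, ‖diffVec (κ ω) k₀ z‖ₑ) ∂P ≤ ENNReal.ofReal
      (p * ((L + 1 : ℕ) * (√(2 * L + 1) * √(K / N) / (4 * Real.pi))) +
        ∑ j, 3 * γ j / (4 * Real.pi) * ((β - 2)⁻¹ * (L : ℝ) ^ (-(β - 2)))) := by
  have hβ' : 0 < β - 2 := by linarith
  have hpi := Real.pi_pos
  have hnn : ∀ j, 0 ≤ 3 * γ j / (4 * Real.pi) * ((β - 2)⁻¹ * (L : ℝ) ^ (-(β - 2))) := fun j => by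
    have := hγ j
    positivity
  have h1 : ∀ᵐ ω ∂P, (⨆ z ∈ Set.Icc (-1 : ℝ) 1, ‖diffVec (κ ω) k₀ z‖ₑ) ≤
      ∑ j : Fin p, (∑ l ∈ Finset.range (L + 1),
        ENNReal.ofReal ((2 * (l : ℝ) + 1) / (4 * Real.pi)) * B l ω ^ (1 / 2 : ℝ) +
        ENNReal.ofReal (3 * γ j / (4 * Real.pi) * ((β - 2)⁻¹ * (L : ℝ) ^ (-(β - 2))))) := by
    filter_upwards [hκ] with ω hω
    refine iSup₂_le fun z hz => ?_
    rw [← ofReal_norm]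
    refine (ENNReal.ofReal_le_ofReal (norm_diffVec_le _ _ _)).trans ?_
    rw [ENNReal.ofReal_sum_of_nonneg fun j _ => abs_nonneg _]
    refine Finset.sum_le_sum fun j _ => (ENNReal.ofReal_le_ofReal
      (abs_sub_le_of_hasSum hβ (hsm j) hL (hω.1 j) hz (hk₀ j z hz))).trans ?_
    refine ENNReal.ofReal_add_le.trans (add_le_add ?_ le_rfl)
    rw [ENNReal.ofReal_sum_of_nonneg fun l _ => by positivity]
    refine Finset.sum_le_sum fun l hl => ?_
    rw [ENNReal.ofReal_mul (by positivity)]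
    refine mul_le_mul_right ?_ _
    have h2 := hω.2 l (by simpa [Nat.lt_succ_iff] using hl) j
    refine le_trans (le_of_eq ?_) (ENNReal.rpow_le_rpow h2 (by norm_num : (0 : ℝ) ≤ 1 / 2))
    rw [ENNReal.ofReal_rpow_of_nonneg (sq_nonneg _) (by norm_num), ← Real.sqrt_eq_rpow,
      Real.sqrt_sq_eq_abs]
  refine (lintegral_mono_ae h1).trans ?_
  have hBm' : ∀ l, Measurable fun ω => B l ω ^ (1 / 2 : ℝ) := fun l => (hBm l).pow_const _
  have hm : Measurable fun ω => ∑ l ∈ Finset.range (L + 1),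
      ENNReal.ofReal ((2 * (l : ℝ) + 1) / (4 * Real.pi)) * B l ω ^ (1 / 2 : ℝ) :=
    Finset.measurable_sum _ fun l _ => (hBm' l).const_mul _
  have h3 : ∫⁻ ω, ∑ l ∈ Finset.range (L + 1),
      ENNReal.ofReal ((2 * (l : ℝ) + 1) / (4 * Real.pi)) * B l ω ^ (1 / 2 : ℝ) ∂P ≤
      ENNReal.ofReal ((L + 1 : ℕ) * (√(2 * L + 1) * √(K / N) / (4 * Real.pi))) := by
    rw [lintegral_finsetSum _ fun l _ => (hBm' l).const_mul _, ← nsmul_eq_mul,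
      ← Finset.card_range (L + 1), ← Finset.sum_const,
      ENNReal.ofReal_sum_of_nonneg fun l _ => by positivity, Finset.card_range]
    refine Finset.sum_le_sum fun l hl => ?_
    rw [lintegral_const_mul _ (hBm' l)]
    refine (mul_le_mul_right ((lintegral_sqrt_le (hBm l)).trans
      (ENNReal.rpow_le_rpow (hB l) (by norm_num))) _).trans ?_
    rw [ENNReal.ofReal_rpow_of_nonneg (by positivity) (by norm_num), ← Real.sqrt_eq_rpow,
      ← ENNReal.ofReal_mul (by positivity)]
    refine ENNReal.ofReal_le_ofReal ?_
    have hl' : (l : ℝ) ≤ L := by exact_mod_cast Nat.lt_succ_iff.mp (Finset.mem_range.mp hl)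
    have hc : 0 < 2 * (l : ℝ) + 1 := by positivity
    -- Here the weight is cancelled only up to a factor `√(2l+1)`, the source of the exponent `3/2`
    -- of `L`.
    have h4 : (2 * (l : ℝ) + 1) * √(K / ((2 * (l : ℝ) + 1) * N)) =
        √(2 * (l : ℝ) + 1) * √(K / N) := by
      rw [mul_comm (2 * (l : ℝ) + 1) (N : ℝ), ← div_div, Real.sqrt_div (by positivity)]
      nth_rewrite 1 [← Real.mul_self_sqrt hc.le]
      have := (Real.sqrt_pos.mpr hc).ne'
      field_simp
    rw [div_mul_eq_mul_div, h4]
    gcongr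
  rw [lintegral_finsetSum _ fun j _ => hm.add_const _, ENNReal.ofReal_add (by positivity)
    (Finset.sum_nonneg fun j _ => hnn j), ENNReal.ofReal_sum_of_nonneg fun j _ => hnn j]
  simp_rw [lintegral_add_right _ measurable_const]
  rw [Finset.sum_add_distrib]
  refine add_le_add ?_ (le_of_eq (by simp))
  rw [Finset.sum_const, Finset.card_univ, Fintype.card_fin, nsmul_eq_mul,
    ENNReal.ofReal_mul (Nat.cast_nonneg p), ENNReal.ofReal_natCast]
  exact mul_le_mul_right h3 _

/-- Bounds for truncation levels of the order of `N ^ d`. -/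
lemma exists_truncation_bounds {L : ℕ → ℕ} {d : ℝ}
    (hL : (fun N : ℕ => (L N : ℝ)) =Θ[atTop] fun N : ℕ => (N : ℝ) ^ d) :
    ∃ c₁ c₂ : ℝ, 0 < c₁ ∧ 0 < c₂ ∧ ∀ᶠ N : ℕ in atTop, 0 < N ∧ 0 < L N ∧
      (L N : ℝ) ≤ c₁ * (N : ℝ) ^ d ∧ c₂ * (N : ℝ) ^ d ≤ L N := by
  obtain ⟨c₁, hc₁, h1⟩ := hL.1.exists_pos
  obtain ⟨c₂, hc₂, h2⟩ := hL.2.exists_pos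
  refine ⟨c₁, c₂⁻¹, hc₁, inv_pos.mpr hc₂, ?_⟩
  filter_upwards [h1.bound, h2.bound, eventually_gt_atTop 0] with N h3 h4 hN
  have hN' : (0 : ℝ) < N := by exact_mod_cast hN
  have hNd : 0 < (N : ℝ) ^ d := Real.rpow_pos_of_pos hN' d
  rw [Real.norm_of_nonneg (Nat.cast_nonneg _), Real.norm_of_nonneg hNd.le] at h3 h4
  refine ⟨hN, ?_, h3, ?_⟩
  · by_contra h
    have h0 : L N = 0 := by omega
    rw [h0, Nat.cast_zero, mul_zero] at h4
    linarith
  · rw [inv_mul_le_iff₀ hc₂]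
    exact h4

lemma rpow_neg_le_of_le {c x s d : ℝ} {N : ℕ} (hN : 0 < N) (hc : 0 < c) (hs : 0 ≤ s)
    (h : c * (N : ℝ) ^ d ≤ x) : x ^ (-s) ≤ c ^ (-s) * (N : ℝ) ^ (-(d * s)) := by
  have hN' : (0 : ℝ) < N := by exact_mod_cast hN
  have hNd : 0 < (N : ℝ) ^ d := Real.rpow_pos_of_pos hN' d
  refine (Real.rpow_le_rpow_of_nonpos (by positivity) h (by linarith)).trans (le_of_eq ?_)
  rw [Real.mul_rpow hc.le hNd.le, ← Real.rpow_mul hN'.le, mul_neg]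

lemma mul_add_mul_le_mul_add {A B x y : ℝ} (hA : 0 ≤ A) (hB : 0 ≤ B) (hx : 0 ≤ x) (hy : 0 ≤ y) :
    A * x + B * y ≤ (A + B) * (x + y) := by nlinarith [mul_nonneg hA hy, mul_nonneg hB hx]

lemma tendsto_coeff_zero {k : ℝ → ℝ} {γ : ℝ} (hβ : 0 < β)
    (hsm : ∀ l : ℕ, 0 < l → |coeff k l| ≤ γ / (l : ℝ) ^ β) :
    Tendsto (fun l => coeff k l) atTop (𝓝 0) := by
  have h1 : Tendsto (fun l : ℕ => γ / (l : ℝ) ^ β) atTop (𝓝 0) :=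
    ((tendsto_rpow_atTop hβ).comp tendsto_natCast_atTop_atTop).const_div_atTop γ
  refine squeeze_zero_norm' ?_ h1
  filter_upwards [eventually_gt_atTop 0] with l hl
  exact hsm l hl

lemma div_rpow_le {γ β β' : ℝ} (hγ : 0 ≤ γ) (h : β' ≤ β) {l : ℕ} (hl : 0 < l) :
    γ / (l : ℝ) ^ β ≤ γ / (l : ℝ) ^ β' := by
  have hl' : (1 : ℝ) ≤ l := by exact_mod_cast hl
  have := Real.rpow_pos_of_pos (by linarith : (0 : ℝ) < l) β'
  gcongr

end Rates

end SPHAR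

/-! ### The two rates of convergence -/

theorem theorem1 {Ω : Type*} [MeasurableSpace Ω] (P : Measure Ω) [IsProbabilityMeasure P]
    (p : ℕ) (hp : 0 < p)
    -- the fields, the kernels, and the spectrum of the noise
    (T Z : SPHAR.S2 → ℤ → Ω → ℝ) (k : Fin p → ℝ → ℝ) (C : ℕ → ℝ)
    (hT : SPHAR.IsGaussianIsotropicStationary P T)
    (hZ : SPHAR.IsSphericalWhiteNoise P Z C)
    (hAR : SPHAR.IsSPHAR P k T Z)
    -- stationarity, identifiability, smoothness
    (hstat : SPHAR.StationarityCondition k)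
    (hident : ∀ l, 0 < C l)
    (β γ : Fin p → ℝ) (hγ : ∀ j, 0 < γ j) (hβ : ∀ j, 1 < β j)
    (hsmooth : ∀ (j : Fin p) (l : ℕ), 0 < l → |SPHAR.coeff (k j) l| ≤ γ j / (l : ℝ) ^ β j)
    -- the truncation levels `L_N ~ N^d`
    (d : ℝ) (hd0 : 0 < d) (hd1 : d < 1)
    (L : ℕ → ℕ) (hL : (fun N : ℕ => (L N : ℝ)) =Θ[atTop] fun N : ℕ => (N : ℝ) ^ d)
    -- the estimators (almost surely unique, hence almost everywhere measurable, for `N > p`)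
    (khat : ℕ → Ω → Fin p → ℝ → ℝ)
    (hkhat : ∀ N : ℕ, p < N → ∀ᵐ ω ∂P,
      SPHAR.IsLeastSquaresEstimate (fun x t => T x t ω) N (L N) (khat N ω)) :
    (∃ K : ℝ, ∀ᶠ N : ℕ in atTop,
      ∫⁻ ω, (∫⁻ z in Set.Icc (-1 : ℝ) 1, ‖SPHAR.diffVec (khat N ω) k z‖ₑ ^ 2) ∂P ≤
        ENNReal.ofReal (K * ((N : ℝ) ^ (d - 1) + (N : ℝ) ^ (2 * d * (1 - ⨅ j, β j))))) ∧
    ((∀ j, 2 < β j) → d < 1 / 3 →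
      -- `k₀` is `k`, defined at every point as the limit of its Legendre expansion
      ∃ k₀ : Fin p → ℝ → ℝ,
        (∀ j, k₀ j =ᵐ[volume.restrict (Set.Icc (-1 : ℝ) 1)] k j) ∧
        (∀ j, ContinuousOn (k₀ j) (Set.Icc (-1 : ℝ) 1)) ∧
        (∀ j, ∀ z ∈ Set.Icc (-1 : ℝ) 1,
          HasSum (fun l : ℕ => SPHAR.coeff (k j) l * SPHAR.zonal l z) (k₀ j z)) ∧
        ∃ K : ℝ, ∀ᶠ N : ℕ in atTop,
          ∫⁻ ω, (⨆ z ∈ Set.Icc (-1 : ℝ) 1, ‖SPHAR.diffVec (khat N ω) k₀ z‖ₑ) ∂P ≤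
            ENNReal.ofReal
              (K * ((N : ℝ) ^ ((3 * d - 1) / 2) + (N : ℝ) ^ (d * (2 - ⨅ j, β j))))) := by
  have : Nonempty (Fin p) := ⟨⟨0, hp⟩⟩
  obtain ⟨j₀, hj₀⟩ : ∃ j₀, β j₀ = ⨅ j, β j := exists_eq_ciInf_of_finite
  -- All kernels are treated with the smallest smoothness exponent, attained at `j₀`, which alone
  -- enters the rates.
  obtain ⟨b, hb⟩ : ∃ b, b = ⨅ j, β j := ⟨_, rfl⟩
  have hb1 : 1 < b := by rw [hb, ← hj₀]; exact hβ j₀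
  have hsm : ∀ (j : Fin p) (l : ℕ), 0 < l → |SPHAR.coeff (k j) l| ≤ γ j / (l : ℝ) ^ b :=
    fun j l hl => (hsmooth j l hl).trans (SPHAR.div_rpow_le (hγ j).le
      (hb ▸ ciInf_le (Set.finite_range β).bddBelow j) hl)
  rw [← hb]
  obtain ⟨K, N₀, hK, hN₀⟩ := SPHAR.exists_coeff_error_bound hp hT hZ hAR hstat hident
    fun j => SPHAR.tendsto_coeff_zero (by linarith) (hsm j)
  obtain ⟨c₁, c₂, hc₁, hc₂, hev⟩ := SPHAR.exists_truncation_bounds hL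
  -- Countably many degrees allow a common null set; the error bounds then apply to `khat N ω`
  -- pointwise in `ω`.
  have hbound : ∀ᶠ N : ℕ in atTop, ∃ B : ℕ → Ω → ENNReal, (∀ l, Measurable (B l)) ∧
      (∀ l : ℕ, ∫⁻ ω, B l ω ∂P ≤ ENNReal.ofReal (K / ((2 * (l : ℝ) + 1) * N))) ∧
      ∀ᵐ ω ∂P, (∀ j, khat N ω j ∈ SPHAR.zonalSpan (L N)) ∧ ∀ l ≤ L N, ∀ j,
        ENNReal.ofReal ((SPHAR.coeff (khat N ω j) l - SPHAR.coeff (k j) l) ^ 2) ≤ B l ω := by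
    filter_upwards [eventually_ge_atTop N₀, eventually_gt_atTop p] with N h1 h2
    choose B hBm hB hBe using hN₀ N h1
    refine ⟨B, hBm, hB, ?_⟩
    filter_upwards [hkhat N h2, ae_all_iff.mpr hBe] with ω h3 h4
    exact ⟨h3.1, fun l hl j => h4 l (L N) _ hl h3 j⟩
  have hpi := Real.pi_pos
  refine ⟨?_, fun hβ2 hd3 => ?_⟩
  · refine ⟨p * (2 * c₁ * K / (8 * Real.pi ^ 2)) + ∑ j, 3 * γ j ^ 2 / (8 * Real.pi ^ 2) *
      ((2 * b - 2)⁻¹ * c₂ ^ (-(2 * b - 2))), ?_⟩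
    filter_upwards [hbound, hev] with N ⟨B, hBm, hB, hBe⟩ ⟨hN, hLN, hL1, hL2⟩
    refine (SPHAR.lintegral_sq_error_le hAR.memLp hb1 hsm hLN hK hBm hB hBe).trans
      (ENNReal.ofReal_le_ofReal ?_)
    have hN' : (0 : ℝ) < N := by exact_mod_cast hN
    have hb2 : 0 < 2 * b - 2 := by linarith
    refine le_trans (add_le_add ?_ ?_) (SPHAR.mul_add_mul_le_mul_add (by positivity)
      (Finset.sum_nonneg fun j _ => by positivity) (by positivity) (by positivity))
    · have h1 : ((L N + 1 : ℕ) : ℝ) ≤ 2 * c₁ * (N : ℝ) ^ d := by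
        have : (1 : ℝ) ≤ L N := by exact_mod_cast hLN
        push_cast
        linarith
      rw [Real.rpow_sub_one hN'.ne']
      calc _ ≤ (p : ℝ) * (2 * c₁ * (N : ℝ) ^ d * (K / (8 * Real.pi ^ 2 * N))) := by gcongr
        _ = _ := by field_simp
    · rw [Finset.sum_mul]
      refine Finset.sum_le_sum fun j _ => ?_
      have h1 := SPHAR.rpow_neg_le_of_le hN hc₂ hb2.le hL2
      have h2 : 2 * d * (1 - b) = -(d * (2 * b - 2)) := by ring
      rw [h2, mul_assoc, mul_assoc]
      gcongr
  · have hb2 : 2 < b := by rw [hb, ← hj₀]; exact hβ2 j₀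
    have hsum := fun j => (SPHAR.tail_zonal_coeff hb2 (hsm j)).1
    have hk₀ : ∀ j, ∀ z ∈ Set.Icc (-1 : ℝ) 1, HasSum
        (fun l => SPHAR.coeff (k j) l * SPHAR.zonal l z)
        (∑' l, SPHAR.coeff (k j) l * SPHAR.zonal l z) := fun j z hz =>
      (Summable.of_norm_bounded (hsum j) fun l => SPHAR.norm_mul_zonal_le _ l hz).hasSum
    have hcont := fun j => SPHAR.continuousOn_of_hasSum_zonal (hsum j) (hk₀ j)
    -- The sum of the series, which converges uniformly because `b > 2`. It has the Legendre
    -- coefficients of `k j`, so it agrees with `k j` almost everywhere by completeness.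
    refine ⟨fun j z => ∑' l, SPHAR.coeff (k j) l * SPHAR.zonal l z, fun j => ?_, hcont, hk₀,
      p * (2 * c₁ * √(3 * c₁) * √K / (4 * Real.pi)) + ∑ j, 3 * γ j / (4 * Real.pi) *
      ((b - 2)⁻¹ * c₂ ^ (-(b - 2))), ?_⟩
    · exact SPHAR.ae_eq_of_coeff_eq
        (SPHAR.memLp_one_of_two (SPHAR.memLp_Icc_of_continuousOn (hcont j) 2))
        (SPHAR.memLp_one_of_two (hAR.memLp j)) (SPHAR.coeff_of_hasSum (hsum j) (hk₀ j))
    filter_upwards [hbound, hev] with N ⟨B, hBm, hB, hBe⟩ ⟨hN, hLN, hL1, hL2⟩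
    refine (SPHAR.lintegral_sup_error_le hb2 (fun j => (hγ j).le) hsm hk₀ hLN hK hBm hB hBe).trans
      (ENNReal.ofReal_le_ofReal ?_)
    have hN' : (0 : ℝ) < N := by exact_mod_cast hN
    have hb3 : 0 < b - 2 := by linarith
    refine le_trans (add_le_add ?_ ?_) (SPHAR.mul_add_mul_le_mul_add (by positivity)
      (Finset.sum_nonneg fun j _ => by have := hγ j; positivity) (by positivity) (by positivity))
    · have h0 : (1 : ℝ) ≤ L N := by exact_mod_cast hLN
      have h1 : ((L N + 1 : ℕ) : ℝ) ≤ 2 * c₁ * (N : ℝ) ^ d := by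
        push_cast
        linarith
      have h2 : √(2 * (L N : ℝ) + 1) ≤ √(3 * c₁) * (N : ℝ) ^ (d / 2) := by
        rw [div_eq_mul_one_div, Real.rpow_mul hN'.le, ← Real.sqrt_eq_rpow,
          ← Real.sqrt_mul (by positivity)]
        exact Real.sqrt_le_sqrt (by linarith)
      have h3 : √(K / N) = √K * (N : ℝ) ^ (-(1 / 2) : ℝ) := by
        rw [Real.sqrt_div hK, div_eq_mul_inv, Real.rpow_neg hN'.le, Real.sqrt_eq_rpow (N : ℝ)]
      -- One factor `N^d` counts the degrees, `N^(d/2)` is the root of the largest weight, and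
      -- `N^(-1/2)` is the parametric rate.
      have h4 : (N : ℝ) ^ ((3 * d - 1) / 2) =
          (N : ℝ) ^ d * (N : ℝ) ^ (d / 2) * (N : ℝ) ^ (-(1 / 2) : ℝ) := by
        rw [← Real.rpow_add hN', ← Real.rpow_add hN']
        congr 1
        ring
      rw [h3, h4]
      calc _ ≤ (p : ℝ) * (2 * c₁ * (N : ℝ) ^ d * (√(3 * c₁) * (N : ℝ) ^ (d / 2) *
            (√K * (N : ℝ) ^ (-(1 / 2) : ℝ)) / (4 * Real.pi))) := by gcongr
        _ = _ := by ring
    · rw [Finset.sum_mul]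
      refine Finset.sum_le_sum fun j _ => ?_
      have h1 := SPHAR.rpow_neg_le_of_le hN hc₂ hb3.le hL2
      have h2 : d * (2 - b) = -(d * (b - 2)) := by ring
      have h3 := hγ j
      rw [h2, mul_assoc, mul_assoc]
      gcongr
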